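/- Equip $\mathbb{R}^3$ with the contact structure $\ker(dz-y\,dx)$. A Legendrian link is a compact smooth one-dimensional submanifold of $\mathbb{R}^3$ tangent to it; its front is its projection to the $(x,z)$-plane, here assumed generic, with cusps and crossings at distinct abscissas. A Legendrian link has a *decomposable exact Lagrangian filling* if its front can be reached from the empty front by a finite sequence (of length at least one) of the following moves: Legendrian isotopies (regular isotopies of fronts and Legendrian Reidemeister moves, in either direction); 0-handles, which add a small two-cusped unknot front in an empty region; and 1-handles, which replace a right cusp facing a left cusp by two parallel strands. No orientability is required. A *normal ruling* of a front is a set $\rho$ of crossings such that, after replacing each crossing in $\rho$ by two horizontal strands, (1) every component (*eye*) has exactly one left cusp, one right cusp and no self-crossing; (2) the two strands at each replaced crossing belong to different eyes; (3) in the vertical slice through it, these two eyes are either one above the other or one inside the other (not interleaved). Whenever two eyes are interleaved over a maximal interval of abscissas, that interval is bounded by two crossings between them; it contributes one *clasp*, unless these two crossings have exactly one strand in common, in which case it contributes none (a strand here is the upper or the lower branch of an eye). The number of clasps of $\rho$ is the total over all pairs of eyes. **Theorem.** For every integer $n\ge 0$ there is a Legendrian $(4,-(2n+5))$-torus knot $K\subset\mathbb{R}^3$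 (the negative, i.e. left-handed, torus knot) whose front has exactly one normal ruling, this normal ruling has exactly $2n+5$ clasps, and $K$ has no decomposable exact Lagrangian filling. -/

import Mathlib

open Set
open scoped ContDiff

/-! ### Morse words

A generic planar diagram (the front of a Legendrian link, or an ordinary link diagram) is swept
from left to right. Its strands over a generic abscissa are numbered `0, 1, 2, …` from top to
bottom. Over finitely many pairwise distinct abscissas an elementary event happens, and the
diagram, up to planar isotopy keeping the order of the events, is the word of these events. -/

/-- The elementary events: two strands are born (a left cusp of a front, a left turning point of a
link diagram), two strands cross, two strands die (a right cusp, a right turning point).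
`α` is the decoration carried by a crossing. -/
inductive Elem (α : Type) where
  | birth : Elem α
  | cross (a : α) : Elem α
  | death : Elem α
  deriving DecidableEq

/-- Number of strands that enter an elementary event from the left. -/
def Elem.ins {α : Type} : Elem α → ℕ
  | .birth => 0
  | .cross _ => 2
  | .death => 2

/-- Number of strands that leave an elementary event to the right. -/
def Elem.outs {α : Type} : Elem α → ℕ
  | .birth => 2
  | .cross _ => 2
  | .death => 0

/-- An elementary event with exactly `pos` strands passing above it. So a birth creates the strands
number `pos` and `pos + 1`, and a crossing or a death concerns the strands `pos` and `pos + 1`. -/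
structure Event (α : Type) where
  elem : Elem α
  pos : ℕ
  deriving DecidableEq

/-- Number of strands on the right of the word `w` when `s` strands enter it on the left;
`none` if some event asks for strands that are not there. -/
def strandsAfter {α : Type} : ℕ → List (Event α) → Option ℕ
  | s, [] => some s
  | s, e :: w =>
      if e.pos + e.elem.ins ≤ s then strandsAfter (s - e.elem.ins + e.elem.outs) w else none

/-- The word describes a closed diagram: it starts and ends with no strand. -/
def IsClosedWord {α : Type} (w : List (Event α)) : Prop :=
  strandsAfter 0 w = some 0

/-- Number of strands after the first `i` events of `w`. -/
def strandCount {α : Type} (w : List (Event α)) (i : ℕ) : ℕ :=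
  (strandsAfter 0 (w.take i)).getD 0

/-- Planar isotopy exchanging the abscissas of two consecutive events that share no strand:
the event `e` lies above the event `f`. -/
inductive Exchange {α : Type} : List (Event α) → List (Event α) → Prop
  | mk (e f : Elem α) (i j : ℕ) (hij : i ≤ j) :
      Exchange [⟨e, i⟩, ⟨f, j + e.outs⟩] [⟨f, j + e.ins⟩, ⟨e, i⟩]

/-- `w'` arises from `w` by one application, inside a vertical strip, of a local rule `r`. -/
def InContext {α : Type} (r : List (Event α) → List (Event α) → Prop)
    (w w' : List (Event α)) : Prop :=
  ∃ u v a b, r a b ∧ w = u ++ a ++ v ∧ w' = u ++ b ++ v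

/-! ### Front diagrams, their moves and decomposable fillings -/

/-- Front diagrams; births are left cusps and deaths are right cusps. No crossing information is
needed: the strand of smaller slope is always the one in front. -/
abbrev Front := List (Event Unit)

/-- Left cusp. -/
abbrev lc (k : ℕ) : Event Unit := ⟨.birth, k⟩

/-- Crossing of a front. -/
abbrev xc (k : ℕ) : Event Unit := ⟨.cross (), k⟩

/-- Right cusp. -/
abbrev rc (k : ℕ) : Event Unit := ⟨.death, k⟩

/-- The local moves of a Legendrian isotopy: regular isotopy interchanging two events, and the
three Legendrian Reidemeister moves in all their reflected versions. -/
inductive LegendrianMove : Front → Front → Prop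
  | exchange (a b : Front) (h : Exchange a b) : LegendrianMove a b
  | r1_below (i : ℕ) : LegendrianMove [] [lc (i + 1), xc i, rc (i + 1)]
  | r1_above (i : ℕ) : LegendrianMove [] [lc i, xc (i + 1), rc i]
  | r2_left_below (i : ℕ) : LegendrianMove [lc (i + 1)] [lc i, xc (i + 1), xc i]
  | r2_left_above (i : ℕ) : LegendrianMove [lc i] [lc (i + 1), xc i, xc (i + 1)]
  | r2_right_below (i : ℕ) : LegendrianMove [rc (i + 1)] [xc i, xc (i + 1), rc i]
  | r2_right_above (i : ℕ) : LegendrianMove [rc i] [xc (i + 1), xc i, rc (i + 1)]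
  | r3 (i : ℕ) : LegendrianMove [xc i, xc (i + 1), xc i] [xc (i + 1), xc i, xc (i + 1)]

/-- Handle attachments. A 0-handle adds a small eye (the front of the standard Legendrian unknot)
in an empty region; a 1-handle replaces a right cusp that faces a left cusp by two parallel
strands. Orientations are ignored. -/
inductive HandleMove : Front → Front → Prop
  | zero (i : ℕ) : HandleMove [] [lc i, rc i]
  | one (i : ℕ) : HandleMove [rc i, lc i] []

/-- One elementary move from the front `w` to the front `w'`. Legendrian isotopies can be run in
both directions, handle attachments cannot. -/
def FrontMove (w w' : Front) : Prop :=
  IsClosedWord w ∧ IsClosedWord w' ∧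
    (InContext LegendrianMove w w' ∨ InContext LegendrianMove w' w ∨ InContext HandleMove w w')

/-- The Legendrian link with front `w` has a decomposable exact Lagrangian filling: a finite
sequence (of length at least one) of Legendrian isotopies, 0-handles and 1-handles leads from the
empty front to `w`. -/
def HasDecomposableFilling (w : Front) : Prop :=
  Relation.TransGen FrontMove [] w

/-! ### Normal rulings -/

/-- Effect of the event number `i` on the list (from top to bottom) of the labels of the strands,
in the diagram obtained from a front by resolving the crossings in `ρ` into two horizontal
strands. A strand carries as its label the number of the left cusp from which it issues. -/
def stepLabels (ρ : Finset ℕ) (i : ℕ) (e : Event Unit) (l : List ℕ) : List ℕ :=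
  match e.elem with
  | .birth => l.take e.pos ++ [i, i] ++ l.drop e.pos
  | .cross _ =>
      if i ∈ ρ then l
      else l.take e.pos ++ ((l.drop e.pos).take 2).reverse ++ l.drop (e.pos + 2)
  | .death => l.take e.pos ++ l.drop (e.pos + 2)

/-- The labels, from top to bottom, of the strands of the resolved diagram after the first `i`
events. -/
def slice (w : Front) (ρ : Finset ℕ) : ℕ → List ℕ
  | 0 => []
  | i + 1 =>
      match w[i]? with
      | none => slice w ρ i
      | some e => stepLabels ρ i e (slice w ρ i)

/-- In a vertical slice, the components `a` and `b` are neither one above the other nor one inside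
the other: their strands alternate. -/
def Interleaved (l : List ℕ) (a b : ℕ) : Prop :=
  l.filter (fun c => c = a ∨ c = b) = [a, b, a, b] ∨
    l.filter (fun c => c = a ∨ c = b) = [b, a, b, a]

instance (l : List ℕ) (a b : ℕ) : Decidable (Interleaved l a b) := by
  unfold Interleaved
  infer_instance

/-- `ρ` (a set of crossings, each given by its number in the word `w`) is a normal ruling.
At every right cusp the two strands that meet issue from the same left cusp, so that each component
of the resolved diagram has one left and one right cusp; the two strands at a crossing belong to
different components, both at the crossings that are not resolved (no self-intersections) and at
those that are; and at a resolved crossing the two components are not interleaved. -/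
structure IsNormalRuling (w : Front) (ρ : Finset ℕ) : Prop where
  switches : ∀ i ∈ ρ, ∃ k, w[i]? = some (xc k)
  crossings : ∀ i k, w[i]? = some (xc k) →
    ∃ a b, (slice w ρ i)[k]? = some a ∧ (slice w ρ i)[k + 1]? = some b ∧ a ≠ b ∧
      (i ∈ ρ → ¬ Interleaved (slice w ρ i) a b)
  rightCusps : ∀ i k, w[i]? = some (rc k) →
    ∃ a, (slice w ρ i)[k]? = some a ∧ (slice w ρ i)[k + 1]? = some a

/-! ### Clasps -/

/-- The strand at position `p` of a slice: its component, and whether it is the lower strand of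
that component. -/
def strandAt (l : List ℕ) (p : ℕ) : ℕ × Bool :=
  (l.getD p 0, decide (l.getD p 0 ∈ l.take p))

/-- The two strands that meet at the event number `i` of the resolved diagram. -/
def meetingStrands (w : Front) (ρ : Finset ℕ) (i : ℕ) : Finset (ℕ × Bool) :=
  match w[i]? with
  | none => ∅
  | some e => {strandAt (slice w ρ i) e.pos, strandAt (slice w ρ i) (e.pos + 1)}

/-- The crossings number `i < j` bound a block of the pair of components `a`, `b` in whose middle
part the two components are interleaved. -/
def IsBlock (w : Front) (ρ : Finset ℕ) (a b i j : ℕ) : Prop :=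
  i < j ∧ ¬ Interleaved (slice w ρ i) a b ∧
    (∀ m ∈ Finset.Ioc i j, Interleaved (slice w ρ m) a b) ∧
    ¬ Interleaved (slice w ρ (j + 1)) a b

instance (w : Front) (ρ : Finset ℕ) (a b i j : ℕ) : Decidable (IsBlock w ρ a b i j) := by
  unfold IsBlock
  infer_instance

/-- Such a block has a clasp, except when its two crossings come from two strands that cross one
single strand, that is, when the two crossings have exactly one strand in common. -/
def HasClasp (w : Front) (ρ : Finset ℕ) (i j : ℕ) : Prop :=
  (meetingStrands w ρ i ∩ meetingStrands w ρ j).card ≠ 1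

instance (w : Front) (ρ : Finset ℕ) (i j : ℕ) : Decidable (HasClasp w ρ i j) := by
  unfold HasClasp
  infer_instance

/-- The number of clasps of a normal ruling `ρ`, summed over all pairs of components. -/
def claspCount (w : Front) (ρ : Finset ℕ) : ℕ :=
  ((Finset.range w.length ×ˢ Finset.range w.length ×ˢ Finset.range w.length ×ˢ
      Finset.range w.length).filter fun q =>
    q.1 < q.2.1 ∧ IsBlock w ρ q.1 q.2.1 q.2.2.1 q.2.2.2 ∧ HasClasp w ρ q.2.2.1 q.2.2.2).card

/-! ### Smooth knot types -/

/-- Link diagrams; a crossing carries `true` if the strand that descends from the upper left to the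
lower right is the overcrossing strand, and `false` if the ascending strand is. -/
abbrev LinkDiagram := List (Event Bool)

/-- The local moves that generate isotopy of links on the level of their diagrams: planar isotopy
(exchange of events, cancellation of two turning points, a crossing passing a turning point) and
the three Reidemeister moves. -/
inductive ReidemeisterMove : LinkDiagram → LinkDiagram → Prop
  | exchange (a b : LinkDiagram) (h : Exchange a b) : ReidemeisterMove a b
  | zigzag_below (i : ℕ) : ReidemeisterMove [] [⟨.birth, i + 1⟩, ⟨.death, i⟩]
  | zigzag_above (i : ℕ) : ReidemeisterMove [] [⟨.birth, i⟩, ⟨.death, i + 1⟩]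
  | turn_birth (i : ℕ) (c : Bool) :
      ReidemeisterMove [⟨.birth, i⟩, ⟨.cross c, i + 1⟩] [⟨.birth, i + 1⟩, ⟨.cross (!c), i⟩]
  | turn_death (i : ℕ) (c : Bool) :
      ReidemeisterMove [⟨.cross c, i + 1⟩, ⟨.death, i⟩] [⟨.cross (!c), i⟩, ⟨.death, i + 1⟩]
  | r1_birth (i : ℕ) (c : Bool) : ReidemeisterMove [⟨.birth, i⟩] [⟨.birth, i⟩, ⟨.cross c, i⟩]
  | r1_death (i : ℕ) (c : Bool) : ReidemeisterMove [⟨.death, i⟩] [⟨.cross c, i⟩, ⟨.death, i⟩]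
  | r2 (i : ℕ) (c : Bool) : ReidemeisterMove [] [⟨.cross c, i⟩, ⟨.cross (!c), i⟩]
  | r3 (i : ℕ) (c d e : Bool) (h : c = e → d = c) :
      ReidemeisterMove [⟨.cross c, i⟩, ⟨.cross d, i + 1⟩, ⟨.cross e, i⟩]
        [⟨.cross e, i + 1⟩, ⟨.cross d, i⟩, ⟨.cross c, i + 1⟩]

/-- Two link diagrams represent isotopic links. -/
def IsotopicDiagrams : LinkDiagram → LinkDiagram → Prop :=
  Relation.EqvGen fun D D' =>
    IsClosedWord D ∧ IsClosedWord D' ∧ InContext ReidemeisterMove D D'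

/-- The standard diagram of the `(p, q)`-torus link: the closure of the braid
`(σ₁ σ₂ ⋯ σ_{p-1}) ^ q` on the `p` upper ones of `2 p` strands. Crossings are positive
(right-handed) for `q > 0` and negative for `q < 0`. -/
def torusDiagram (p : ℕ) (q : ℤ) : LinkDiagram :=
  (List.range p).map (fun i => ⟨.birth, i⟩) ++
    (List.replicate q.natAbs
      ((List.range (p - 1)).map fun i => (⟨.cross (decide (0 < q)), i⟩ : Event Bool))).flatten ++
    (List.range p).reverse.map (fun i => ⟨.death, i⟩)

/-- The link diagram underlying a front: cusps are smoothed to turning points, and at a crossing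
the descending strand (the one of smaller slope `y = dz / dx`, the `y`-axis pointing away from
the viewer) goes over. -/
def Front.toDiagram (w : Front) : LinkDiagram :=
  w.map fun e =>
    ⟨match e.elem with
      | .birth => .birth
      | .cross _ => .cross true
      | .death => .death, e.pos⟩

/-- The links with front `w` are `(p, q)`-torus links. -/
def IsTorusLink (w : Front) (p : ℕ) (q : ℤ) : Prop :=
  IsotopicDiagrams w.toDiagram (torusDiagram p q)

/-! ### Legendrian links in `ℝ³` and their fronts

Points of `ℝ³` are written `(x, y, z) = (x, (y, z))`; the contact structure is the kernel of
`dz - y dx`. -/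

/-- On `(-1, 1)`, the curve `c` is a smooth embedded arc tangent to the contact structure. -/
structure IsLegendrianArc (c : ℝ → ℝ × ℝ × ℝ) : Prop where
  smooth : ContDiffOn ℝ ∞ c (Ioo (-1) 1)
  immersed : ∀ s ∈ Ioo (-1 : ℝ) 1, deriv c s ≠ 0
  embedded : Topology.IsEmbedding ((Ioo (-1 : ℝ) 1).domRestrict c)
  tangent : ∀ s ∈ Ioo (-1 : ℝ) 1, (deriv c s).2.2 = (c s).2.1 * (deriv c s).1

/-- Legendrian links: compact smoothly embedded one-dimensional submanifolds of `ℝ³` (without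
boundary) tangent to the contact structure. -/
def IsLegendrianLink (K : Set (ℝ × ℝ × ℝ)) : Prop :=
  IsCompact K ∧ ∀ p ∈ K, ∃ U : Set (ℝ × ℝ × ℝ), IsOpen U ∧ p ∈ U ∧
    ∃ c : ℝ → ℝ × ℝ × ℝ, IsLegendrianArc c ∧ c '' Ioo (-1) 1 = K ∩ U

/-- How strands meet at an event `e`. The points `P 0, P 1, …, P (m - 1)` (with coordinates
`(y, z)`) are the ends of the strands coming from the left, `Q 0, Q 1, …, Q (m' - 1)` the ends of
those going to the right. The heights `z` of two ends on the same side agree only for the two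
strands concerned by the event; all other strands pass. At a crossing the two strands pass through
each other with different slopes `y`. -/
structure StrandsMeet (e : Event Unit) (m m' : ℕ) (P Q : ℕ → ℝ × ℝ) : Prop where
  left_heights : ∀ j l, j < l → l < m →
    ((P j).2 = (P l).2 ↔ e.elem.ins = 2 ∧ j = e.pos ∧ l = e.pos + 1)
  right_heights : ∀ j l, j < l → l < m' →
    ((Q j).2 = (Q l).2 ↔ e.elem.outs = 2 ∧ j = e.pos ∧ l = e.pos + 1)
  above : ∀ j, j < e.pos → P j = Q j
  below : ∀ j, e.pos ≤ j → j + e.elem.ins < m → P (j + e.elem.ins) = Q (j + e.elem.outs)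
  meet : match e.elem with
    | .birth => Q e.pos = Q (e.pos + 1)
    | .cross _ => P e.pos = Q (e.pos + 1) ∧ P (e.pos + 1) = Q e.pos ∧ P e.pos ≠ P (e.pos + 1)
    | .death => P e.pos = P (e.pos + 1)

/-- The front (the projection to the `(x, z)`-plane) of `K` is generic, with its cusps and crossings
over distinct abscissas `t 1 < t 2 < ⋯ < t N`, and it is described by the word `w` of length `N`.
Over the interval between `t i` and `t (i + 1)`, `K` consists of the graphs of the functions
`g i 0, g i 1, …` of `x`, with values `(y, z)`, in order of descending height `z`. -/
def HasFront (K : Set (ℝ × ℝ × ℝ)) (w : Front) : Prop :=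
  IsClosedWord w ∧ ∃ (t : ℕ → ℝ) (g : ℕ → ℕ → ℝ → ℝ × ℝ), StrictMono t ∧
    (∀ p ∈ K, t 0 < p.1 ∧ p.1 < t (w.length + 1)) ∧
    (∀ i ≤ w.length,
      (∀ j < strandCount w i, ContinuousOn (g i j) (Icc (t i) (t (i + 1)))) ∧
      ∀ x ∈ Ioo (t i) (t (i + 1)),
        {q | (x, q) ∈ K} = {q | ∃ j < strandCount w i, q = g i j x} ∧
        ∀ j l, j < l → l < strandCount w i → (g i l x).2 < (g i j x).2) ∧
    ∀ i e, w[i]? = some e →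
      {q | (t (i + 1), q) ∈ K} =
        {q | (∃ j < strandCount w i, q = g i j (t (i + 1))) ∨
          ∃ j < strandCount w (i + 1), q = g (i + 1) j (t (i + 1))} ∧
      StrandsMeet e (strandCount w i) (strandCount w (i + 1))
        (fun j => g i j (t (i + 1))) (fun j => g (i + 1) j (t (i + 1)))

/-! Why the theorem holds. Orient every eye of a normal ruling, upper strand to the right and lower
strand to the left. The signs of the crossings that are not switched then add up to twice the total
linking number of the eyes. Reversing an eye does not change the parity of the total linking number,
so the natural home of the sum is `ZMod 4`.

The obstruction to fillings is that the set of sums realised by normal rulings of a front (`Admits`)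
is unchanged by Legendrian isotopy and can only grow under handles: a 0-handle adds an unlinked eye,
and a 1-handle merges two eyes without touching a crossing. The empty front realises `0`, hence so
does every decomposably fillable front (`HasDecomposableFilling.admits`). All moves except
Reidemeister III preserve the integral sum; in `admits_r3` a pair of crossings may be traded for
another pair with the opposite sign, and this is where only the parity of the linking number
survives.

The example is the Legendrian four-copy of the unknot with `N = 2n + 1` negative quarter twists
inserted (`torusFront`). Its rulings are found by a transfer argument: read from left to right, the
labels of the eight strands pass through finitely many states. After the left end and one twist
there is a single state that can be completed; all others belong to a list that is stable under
double twists and incompatible with the right end. So the ruling is forced, with sum `-6 - 4n - 4`,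
which is `2` modulo `4` (`ruled_torusFront`), and there is no filling. This agrees with the number
`N + 4 = 2n + 5` of clasps being odd: a clasp links its two eyes once. The eyes are a chain in which
each twist ends one eye and starts the next but one, together with two eyes on the lower strands
(`claspCount_torusRuling`).

For the smooth type, each twist becomes one row of the standard negative braid, and the two ends
together give a full twist, which is four more rows (`isTorusLink_torusFront`). Finally any closed
word is the front of a Legendrian link, built from explicit models of cusps and crossings joined by
a smooth interpolation (`isLegendrianLink_frontLift`, `hasFront_frontLift`). -/

/-! ### Rulings as labelled paths, and their linking number modulo two -/

/-- Each label of the list occurs exactly twice. -/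
def Paired (l : List ℕ) : Prop :=
  ∀ x ∈ l, l.count x = 2

/-- Sign of a crossing between the strands `x` and `y` below the strands `u`: positive if both are
upper or both are lower strands of their components. -/
def pairSign (u : List ℕ) (x y : ℕ) : ZMod 4 :=
  if (x ∈ u ↔ y ∈ u) then 1 else -1

/-- `Ruled w l bs s`: the front tangle `w`, entered by strands with labels `l`, has a normal ruling
whose switches are given by the list `bs`, and `s` is the sum of the signs of its crossings that are
not switched. -/
inductive Ruled : Front → List ℕ → List Bool → ZMod 4 → Prop
  | nil : Ruled [] [] [] 0
  | birth {w : Front} {k : ℕ} {l u v : List ℕ} {bs : List Bool} {s : ZMod 4} (x : ℕ)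
      (hl : l = u ++ v) (hk : u.length = k) (hx : x ∉ l)
      (h : Ruled w (u ++ x :: x :: v) bs s) : Ruled (lc k :: w) l bs s
  | pass {w : Front} {k : ℕ} {l u v : List ℕ} {x y : ℕ} {bs : List Bool} {s : ZMod 4}
      (hl : l = u ++ x :: y :: v) (hk : u.length = k) (hxy : x ≠ y)
      (h : Ruled w (u ++ y :: x :: v) bs s) :
      Ruled (xc k :: w) l (false :: bs) (s + pairSign u x y)
  | switch {w : Front} {k : ℕ} {l u v : List ℕ} {x y : ℕ} {bs : List Bool} {s : ZMod 4}
      (hl : l = u ++ x :: y :: v) (hk : u.length = k) (hxy : x ≠ y)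
      (hi : ¬ Interleaved l x y) (h : Ruled w l bs s) : Ruled (xc k :: w) l (true :: bs) s
  | death {w : Front} {k : ℕ} {l u v : List ℕ} {x : ℕ} {bs : List Bool} {s : ZMod 4}
      (hl : l = u ++ x :: x :: v) (hk : u.length = k)
      (h : Ruled w (u ++ v) bs s) : Ruled (rc k :: w) l bs s

/-- `Admits w l s`: some normal ruling of `w` with incoming labels `l` has total sign `s`. -/
def Admits (w : Front) (l : List ℕ) (s : ZMod 4) : Prop :=
  ∃ bs, Ruled w l bs s

/-! #### Renaming of labels -/

theorem interleaved_map {f : ℕ → ℕ} {l : List ℕ} (hf : InjOn f {x | x ∈ l}) {x y : ℕ}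
    (hx : x ∈ l) (hy : y ∈ l) : Interleaved (l.map f) (f x) (f y) ↔ Interleaved l x y := by
  have key : (l.map f).filter (fun c => c = f x ∨ c = f y) =
      (l.filter (fun c => c = x ∨ c = y)).map f := by
    rw [List.filter_map]
    congr 1
    apply List.filter_congr
    intro c hc
    simp [hf.eq_iff hc hx, hf.eq_iff hc hy]
  have inj : ∀ a b c d : ℕ, a ∈ l → b ∈ l → c ∈ l → d ∈ l →
      ((l.filter (fun c => c = x ∨ c = y)).map f = [f a, f b, f c, f d] ↔
        l.filter (fun c => c = x ∨ c = y) = [a, b, c, d]) := by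
    intro a b c d ha hb hc hd
    constructor
    · intro h
      have hinv : ∀ z ∈ l, Function.invFunOn f {x | x ∈ l} (f z) = z := fun z hz =>
        hf.leftInvOn_invFunOn hz
      have h' := congrArg (List.map (Function.invFunOn f {x | x ∈ l})) h
      rw [List.map_map, List.map_congr_left (g := id)] at h'
      · simpa [hinv a ha, hinv b hb, hinv c hc, hinv d hd] using h'
      · intro z hz
        exact hinv z (List.mem_filter.1 hz).1
    · intro h
      rw [h]
      rfl
  unfold Interleaved
  rw [key, inj x y x y hx hy hx hy, inj y x y x hy hx hy hx]

theorem pairSign_map {f : ℕ → ℕ} {l u : List ℕ} (hf : InjOn f {x | x ∈ l}) (hu : ∀ z ∈ u, z ∈ l)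
    {x y : ℕ} (hx : x ∈ l) (hy : y ∈ l) : pairSign (u.map f) (f x) (f y) = pairSign u x y := by
  have key : ∀ z ∈ l, (f z ∈ u.map f ↔ z ∈ u) := by
    intro z hz
    constructor
    · intro h
      obtain ⟨c, hc, hcz⟩ := List.mem_map.1 h
      rwa [← hf (hu c hc) hz hcz]
    · exact List.mem_map_of_mem
  simp only [pairSign, key x hx, key y hy]

theorem exists_fresh (l : List ℕ) : ∃ x, x ∉ l :=
  Infinite.exists_notMem_finset l.toFinset |>.imp fun _ h => by simpa using h

/-- Labels are mere names. Injectivity is asked only on the labels present, so that maps such as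
`idxOf` qualify. -/
theorem Ruled.map {w : Front} {l : List ℕ} {bs : List Bool} {s : ZMod 4} (h : Ruled w l bs s) :
    ∀ f : ℕ → ℕ, InjOn f {x | x ∈ l} → Ruled w (l.map f) bs s := by
  induction h with
  | nil => intro f _; exact Ruled.nil
  | @birth w k l u v bs s x hl hk hx h ih =>
    intro f hf
    -- `f x` may coincide with the image of a label in use, so `f` is redefined at the newborn
    -- label.
    obtain ⟨x', hx'⟩ := exists_fresh (l.map f)
    subst hl
    have hu : u.map (Function.update f x x') = u.map f := by
      apply List.map_congr_left
      intro a ha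
      rw [Function.update_of_ne]
      rintro rfl
      exact hx (by simp [ha])
    have hv : v.map (Function.update f x x') = v.map f := by
      apply List.map_congr_left
      intro a ha
      rw [Function.update_of_ne]
      rintro rfl
      exact hx (by simp [ha])
    have := ih (Function.update f x x') ?_
    · simp only [List.map_append, List.map_cons, hu, hv, Function.update_self] at this
      exact Ruled.birth x' (by simp) (by simpa using hk) hx' this
    · have hm : ∀ a, a ∈ u ++ x :: x :: v → a ≠ x → a ∈ u ++ v := by
        intro a ha hax
        simp only [List.mem_append, List.mem_cons] at ha ⊢
        tauto
      intro a ha b hb hab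
      by_cases hax : a = x <;> by_cases hbx : b = x
      · rw [hax, hbx]
      · rw [hax, Function.update_self, Function.update_of_ne hbx] at hab
        exact absurd (List.mem_map.2 ⟨b, hm b hb hbx, hab.symm⟩) hx'
      · rw [hbx, Function.update_self, Function.update_of_ne hax] at hab
        exact absurd (List.mem_map.2 ⟨a, hm a ha hax, hab⟩) hx'
      · rw [Function.update_of_ne hax, Function.update_of_ne hbx] at hab
        exact hf (hm a ha hax) (hm b hb hbx) hab
  | @pass w k l u v x y bs s hl hk hxy h ih =>
    intro f hf
    have hx : x ∈ l := by simp [hl]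
    have hy : y ∈ l := by simp [hl]
    rw [← pairSign_map hf (fun z hz => by simp [hl, hz]) hx hy]
    refine Ruled.pass (v := v.map f) (by simp [hl]) (by simpa using hk)
      (fun h => hxy (hf hx hy h)) ?_
    have := ih f (hf.mono fun z => by simp +contextual [hl, or_imp])
    simpa using this
  | @switch w k l u v x y bs s hl hk hxy hi h ih =>
    intro f hf
    have hx : x ∈ l := by simp [hl]
    have hy : y ∈ l := by simp [hl]
    exact Ruled.switch (u := u.map f) (v := v.map f) (x := f x) (y := f y) (by simp [hl])
      (by simpa using hk) (fun h => hxy (hf hx hy h)) (by rwa [interleaved_map hf hx hy]) (ih f hf)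
  | @death w k l u v x bs s hl hk h ih =>
    intro f hf
    refine Ruled.death (u := u.map f) (v := v.map f) (x := f x) (by simp [hl])
      (by simpa using hk) ?_
    have := ih f (hf.mono fun z => by simp +contextual [hl, or_imp])
    simpa using this

theorem Ruled.relabel_pair {w : Front} {u v : List ℕ} {x x' : ℕ} {bs : List Bool} {s : ZMod 4}
    (hx : x ∉ u ++ v) (hx' : x' ∉ u ++ v) (h : Ruled w (u ++ x :: x :: v) bs s) :
    Ruled w (u ++ x' :: x' :: v) bs s := by
  have := h.map (Equiv.swap x x') (Equiv.injective _).injOn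
  have key : ∀ m : List ℕ, (∀ z ∈ m, z ∈ u ++ v) → m.map (Equiv.swap x x') = m := by
    intro m hm
    conv_rhs => rw [← List.map_id m]
    apply List.map_congr_left
    intro a ha
    exact Equiv.swap_apply_of_ne_of_ne (by rintro rfl; exact hx (hm _ ha))
      (by rintro rfl; exact hx' (hm _ ha))
  rw [List.map_append, List.map_cons, List.map_cons, key u (by simp +contextual),
    key v (by simp +contextual), Equiv.swap_apply_left] at this
  exact this

/-- With `admits_rc` and `admits_xc` this inverts `Ruled` one event at a time, for any single choice
of a fresh label. The three serve as rewriting rules that evaluate a local tangle completely, so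
that a move becomes a comparison of two propositional formulas. -/
theorem admits_lc {w : Front} {k : ℕ} {l u v : List ℕ} {s : ZMod 4} (hk : u.length = k)
    (hl : l = u ++ v) {x : ℕ} (hx : x ∉ l) :
    Admits (lc k :: w) l s ↔ Admits w (u ++ x :: x :: v) s := by
  constructor
  · rintro ⟨bs, h⟩
    cases h with
    | @birth _ _ _ u' v' _ _ x' hl' hk' hx' h =>
      obtain ⟨rfl, rfl⟩ := List.append_inj (hl.symm.trans hl') (hk.trans hk'.symm)
      exact ⟨bs, h.relabel_pair (hl ▸ hx') (hl ▸ hx)⟩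
  · rintro ⟨bs, h⟩
    exact ⟨bs, Ruled.birth x hl hk hx h⟩

theorem admits_rc {w : Front} {k : ℕ} {l u v : List ℕ} {x y : ℕ} {s : ZMod 4} (hk : u.length = k)
    (hl : l = u ++ x :: y :: v) : Admits (rc k :: w) l s ↔ x = y ∧ Admits w (u ++ v) s := by
  constructor
  · rintro ⟨bs, h⟩
    cases h with
    | @death _ _ _ u' v' x' _ _ hl' hk' h =>
      obtain ⟨rfl, h2⟩ := List.append_inj (hl.symm.trans hl') (hk.trans hk'.symm)
      simp only [List.cons.injEq] at h2
      obtain ⟨rfl, rfl, rfl⟩ := h2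
      exact ⟨rfl, bs, h⟩
  · rintro ⟨rfl, bs, h⟩
    exact ⟨bs, Ruled.death hl hk h⟩

theorem admits_xc {w : Front} {k : ℕ} {l u v : List ℕ} {x y : ℕ} {s : ZMod 4} (hk : u.length = k)
    (hl : l = u ++ x :: y :: v) : Admits (xc k :: w) l s ↔
      x ≠ y ∧ (Admits w (u ++ y :: x :: v) (s - pairSign u x y) ∨ ¬ Interleaved l x y ∧ Admits w l s) := by
  constructor
  · rintro ⟨bs, h⟩
    cases h with
    | @pass _ _ _ u' v' x' y' _ _ hl' hk' hxy h =>
      obtain ⟨rfl, h2⟩ := List.append_inj (hl.symm.trans hl') (hk.trans hk'.symm)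
      simp only [List.cons.injEq] at h2
      obtain ⟨rfl, rfl, rfl⟩ := h2
      exact ⟨hxy, Or.inl ⟨_, by simpa using h⟩⟩
    | @switch _ _ _ u' v' x' y' _ _ hl' hk' hxy hi h =>
      obtain ⟨rfl, h2⟩ := List.append_inj (hl.symm.trans hl') (hk.trans hk'.symm)
      simp only [List.cons.injEq] at h2
      obtain ⟨rfl, rfl, rfl⟩ := h2
      exact ⟨hxy, Or.inr ⟨hi, _, h⟩⟩
  · rintro ⟨hxy, ⟨bs, h⟩ | ⟨hi, bs, h⟩⟩
    · exact ⟨_, by simpa using Ruled.pass hl hk hxy h⟩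
    · exact ⟨_, Ruled.switch hl hk hxy hi h⟩

/-- Needed when two crossings involve the same two eyes: switching one or the other leads to slices
that differ by exchanging the two names. -/
theorem Admits.swap {w : Front} {l : List ℕ} {s : ZMod 4} (x y : ℕ) :
    Admits w (l.map (Equiv.swap x y)) s ↔ Admits w l s := by
  have key : ∀ l', Admits w l' s → Admits w (l'.map (Equiv.swap x y)) s := fun l' ⟨bs, h⟩ =>
    ⟨bs, h.map _ (Equiv.injective _).injOn⟩
  refine ⟨fun h => ?_, key l⟩
  have := key _ h
  rwa [List.map_map, List.map_congr_left (g := id), List.map_id] at this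
  intro a _
  simp

/-! #### Interleaving in terms of the positions of the companion strands -/

theorem interleaved_comm {l : List ℕ} {x y : ℕ} : Interleaved l x y ↔ Interleaved l y x := by
  unfold Interleaved
  simp only [or_comm]

theorem exists_split_of_count_eq_one {m : List ℕ} {x : ℕ} (h : m.count x = 1) :
    ∃ a b, m = a ++ x :: b ∧ x ∉ a ∧ x ∉ b := by
  obtain ⟨a, b, rfl, ha⟩ := List.eq_append_cons_of_mem (List.count_pos_iff.1 (h ▸ one_pos))
  refine ⟨a, b, rfl, ha, ?_⟩
  rw [List.count_append, List.count_cons_self, List.count_eq_zero.2 ha] at h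
  exact List.count_eq_zero.1 (by omega)

theorem filter_pair_eq_nil {m : List ℕ} {x y : ℕ} (hx : x ∉ m) (hy : y ∉ m) :
    m.filter (fun c => c = x ∨ c = y) = [] := by
  rw [List.filter_eq_nil_iff]
  intro a ha
  simp only [decide_eq_true_eq, not_or]
  exact ⟨by rintro rfl; exact hx ha, by rintro rfl; exact hy ha⟩

/-- The strands `x` and `y` that meet at a crossing are interleaved if and only if, going downwards
from the crossing and coming back from above, the companion of `x` comes first. -/
theorem interleaved_iff {u v : List ℕ} {x y : ℕ} (hxy : x ≠ y) (hx : (u ++ v).count x = 1)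
    (hy : (u ++ v).count y = 1) :
    Interleaved (u ++ x :: y :: v) x y ↔ (v ++ u).idxOf x < (v ++ u).idxOf y := by
  rw [List.count_append] at hx hy
  have hyx := hxy.symm
  -- The restriction of a list to `x` and `y` has one of five forms. Applied to the parts above and
  -- below the crossing, the counts leave finitely many combinations, each settled by computation.
  have aux : ∀ m : List ℕ, m.count x = 0 ∨ m.count x = 1 → m.count y = 0 ∨ m.count y = 1 →
      (m.count x = 0 ∧ m.count y = 0 ∧ x ∉ m ∧ y ∉ m ∧ m.filter (fun c => c = x ∨ c = y) = []) ∨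
      (m.count x = 1 ∧ m.count y = 0 ∧ x ∈ m ∧ y ∉ m ∧ m.filter (fun c => c = x ∨ c = y) = [x]) ∨
      (m.count x = 0 ∧ m.count y = 1 ∧ x ∉ m ∧ y ∈ m ∧ m.filter (fun c => c = x ∨ c = y) = [y]) ∨
      (m.count x = 1 ∧ m.count y = 1 ∧ x ∈ m ∧ y ∈ m ∧ m.idxOf x < m.idxOf y ∧
        m.filter (fun c => c = x ∨ c = y) = [x, y]) ∨
      (m.count x = 1 ∧ m.count y = 1 ∧ x ∈ m ∧ y ∈ m ∧ m.idxOf y < m.idxOf x ∧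
        m.filter (fun c => c = x ∨ c = y) = [y, x]) := by
    intro m h1 h2
    rcases h1 with h1 | h1 <;> rcases h2 with h2 | h2
    · have h1' := List.count_eq_zero.1 h1
      have h2' := List.count_eq_zero.1 h2
      exact Or.inl ⟨h1, h2, h1', h2', filter_pair_eq_nil h1' h2'⟩
    · have h1' := List.count_eq_zero.1 h1
      obtain ⟨a, b, rfl, ha, hb⟩ := exists_split_of_count_eq_one h2
      simp only [List.mem_append, List.mem_cons, not_or] at h1'
      refine Or.inr (Or.inr (Or.inl ⟨h1, h2, by simp [h1'], by simp, ?_⟩))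
      simp only [List.filter_append, List.filter_cons, filter_pair_eq_nil h1'.1 ha, filter_pair_eq_nil h1'.2.2 hb]
      simp
    · have h2' := List.count_eq_zero.1 h2
      obtain ⟨a, b, rfl, ha, hb⟩ := exists_split_of_count_eq_one h1
      simp only [List.mem_append, List.mem_cons, not_or] at h2'
      refine Or.inr (Or.inl ⟨h1, h2, by simp, by simp [h2'], ?_⟩)
      simp only [List.filter_append, List.filter_cons, filter_pair_eq_nil ha h2'.1, filter_pair_eq_nil hb h2'.2.2]
      simp
    · obtain ⟨a, b, rfl, ha, hb⟩ := exists_split_of_count_eq_one h1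
      have h2' := h2
      rw [List.count_append, List.count_cons_of_ne hxy] at h2'
      by_cases hya : y ∈ a
      · have hya' : a.count y = 1 := by have := List.count_pos_iff.2 hya; omega
        have hyb : y ∉ b := List.count_eq_zero.1 (by omega)
        obtain ⟨c, d, rfl, hc, hd⟩ := exists_split_of_count_eq_one hya'
        simp only [List.mem_append, List.mem_cons, not_or] at ha
        refine Or.inr (Or.inr (Or.inr (Or.inr ⟨h1, h2, by simp, by simp, ?_, ?_⟩)))
        · simp [List.idxOf_append, hc, ha, hyx]
        · simp only [List.filter_append, List.filter_cons, filter_pair_eq_nil ha.1 hc, filter_pair_eq_nil ha.2.2 hd,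
            filter_pair_eq_nil hb hyb]; simp
      · have hyb' : b.count y = 1 := by rw [List.count_eq_zero.2 hya] at h2'; omega
        obtain ⟨c, d, rfl, hc, hd⟩ := exists_split_of_count_eq_one hyb'
        simp only [List.mem_append, List.mem_cons, not_or] at hb
        refine Or.inr (Or.inr (Or.inr (Or.inl ⟨h1, h2, by simp, by simp, ?_, ?_⟩)))
        · simp [List.idxOf_append, ha, hya, hxy]
        · simp only [List.filter_append, List.filter_cons, filter_pair_eq_nil ha hya, filter_pair_eq_nil hb.1 hc,
            filter_pair_eq_nil hb.2.2 hd]; simp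
  have lt_len : ∀ (m : List ℕ) z, z ∈ m → m.idxOf z < m.length := fun m z => List.idxOf_lt_length_of_mem
  rcases aux u (by omega) (by omega) with h | h | h | h | h <;>
    rcases aux v (by omega) (by omega) with h' | h' | h' | h' | h' <;>
    first
    | (exfalso; omega)
    | (have e1 := lt_len u x; have e2 := lt_len u y
       have e3 := lt_len v x; have e4 := lt_len v y
       simp only [Interleaved, List.filter_append, List.filter_cons, h, h', List.idxOf_append]
       simp [hxy, hyx]
       try grind)

/-- A strand above the crossing comes last in that order. -/
theorem mem_above_of_idxOf_lt {u v : List ℕ} {x y : ℕ} (hx : (u ++ v).count x = 1)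
    (hy : (u ++ v).count y = 1) (h : (v ++ u).idxOf x < (v ++ u).idxOf y) (hxu : x ∈ u) :
    y ∈ u := by
  rw [List.count_append] at hx hy
  by_contra hyu
  have hxv : x ∉ v := by
    have := List.count_pos_iff.2 hxu
    exact List.count_eq_zero.1 (by omega)
  have hyv : y ∈ v := by
    rw [List.count_eq_zero.2 hyu] at hy
    exact List.count_pos_iff.1 (by omega)
  have := List.idxOf_lt_length_of_mem hyv
  rw [List.idxOf_append_of_notMem hxv, List.idxOf_append_of_mem hyv] at h
  omega

/-! #### Invariance under the moves -/

theorem List.exists_append_length {l : List ℕ} {k : ℕ} (h : k ≤ l.length) :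
    ∃ u v, l = u ++ v ∧ u.length = k :=
  ⟨l.take k, l.drop k, (List.take_append_drop k l).symm, by simp [h]⟩

theorem List.exists_append_cons {l : List ℕ} {k : ℕ} (h : k + 1 ≤ l.length) :
    ∃ u x v, l = u ++ x :: v ∧ u.length = k := by
  obtain ⟨u, v, rfl, hu⟩ := List.exists_append_length (Nat.le_of_succ_le h)
  rcases v with _ | ⟨x, v⟩
  · simp at h; omega
  · exact ⟨u, x, v, rfl, hu⟩

theorem List.exists_append_cons₂ {l : List ℕ} {k : ℕ} (h : k + 2 ≤ l.length) :
    ∃ u x y v, l = u ++ x :: y :: v ∧ u.length = k := by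
  obtain ⟨u, x, v, rfl, hu⟩ := List.exists_append_cons (Nat.le_of_succ_le h)
  rcases v with _ | ⟨y, v⟩
  · simp at h; omega
  · exact ⟨u, x, y, v, rfl, hu⟩

theorem Paired.count_eq_one {l u v : List ℕ} {x y : ℕ} (hl : Paired l) (h : l = u ++ x :: y :: v)
    (hxy : x ≠ y) : (u ++ v).count x = 1 ∧ (u ++ v).count y = 1 := by
  have hx := hl x (by simp [h])
  have hy := hl y (by simp [h])
  simp [h, List.count_append, hxy, hxy.symm] at hx hy ⊢
  omega

theorem Paired.notMem {l u v : List ℕ} {x : ℕ} (hl : Paired l) (h : l = u ++ x :: x :: v) :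
    x ∉ u ++ v := by
  have hx := hl x (by simp [h])
  simp [h, List.count_append] at hx
  simp only [List.mem_append, not_or, ← List.count_eq_zero]
  omega

theorem pairSign_comm (u : List ℕ) (x y : ℕ) : pairSign u x y = pairSign u y x := by
  simp only [pairSign, iff_comm]

/-! ### The Legendrian Reidemeister moves. -/

/-- Passing the crossing would make the right cusp join two different eyes, so it must be switched.
The switch is allowed because the new eye has nothing between its strands, and it carries no sign.
-/
theorem admits_r1_below {w : Front} {u v : List ℕ} {z i : ℕ} {s : ZMod 4} (hi : u.length = i)
    (hl : Paired (u ++ z :: v)) :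
    Admits w (u ++ z :: v) s ↔
      Admits (lc (i + 1) :: xc i :: rc (i + 1) :: w) (u ++ z :: v) s := by
  obtain ⟨x, hx⟩ := exists_fresh (u ++ z :: v)
  have hz := hl z (by simp)
  simp only [List.mem_append, List.mem_cons, not_or] at hx
  have hxz : z ≠ x := fun h => hx.2.1 h.symm
  rw [admits_lc (u := u ++ [z]) (v := v) (x := x) (by simp [hi]) (by simp) (by simp [hx]),
    admits_xc (u := u) (x := z) (y := x) (v := x :: v) hi (by simp),
    admits_rc (u := u ++ [x]) (x := z) (y := x) (v := v) (by simp [hi]) (by simp),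
    admits_rc (u := u ++ [z]) (x := x) (y := x) (v := v) (by simp [hi]) (by simp),
    List.append_assoc, List.singleton_append, List.append_assoc, List.singleton_append]
  have : ¬ Interleaved (u ++ z :: x :: x :: v) z x := by
    rw [interleaved_iff hxz]
    · simp
    · simp [List.count_append, hx] at hz ⊢; omega
    · simp [List.count_append, List.count_eq_zero.2 hx.1,
        List.count_eq_zero.2 hx.2.2]
  simp [hxz, this]

theorem admits_r1_above {w : Front} {u v : List ℕ} {z i : ℕ} {s : ZMod 4} (hi : u.length = i)
    (hl : Paired (u ++ z :: v)) :
    Admits w (u ++ z :: v) s ↔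
      Admits (lc i :: xc (i + 1) :: rc i :: w) (u ++ z :: v) s := by
  obtain ⟨x, hx⟩ := exists_fresh (u ++ z :: v)
  have hz := hl z (by simp)
  simp only [List.mem_append, List.mem_cons, not_or] at hx
  have hxz : x ≠ z := hx.2.1
  rw [admits_lc (u := u) (v := z :: v) (x := x) (by simp [hi]) (by simp) (by simp [hx]),
    admits_xc (u := u ++ [x]) (x := x) (y := z) (v := v) (by simp [hi]) (by simp),
    admits_rc (u := u) (x := x) (y := z) (v := x :: v) (by simp [hi]) (by simp),
    admits_rc (u := u) (x := x) (y := x) (v := z :: v) (by simp [hi]) (by simp)]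
  have : ¬ Interleaved (u ++ x :: x :: z :: v) x z := by
    rw [show u ++ x :: x :: z :: v = (u ++ [x]) ++ x :: z :: v by simp, interleaved_iff hxz]
    · have hz' : z ∈ v ++ u := by
        by_contra h
        simp only [List.mem_append, not_or] at h
        simp [List.count_append, List.count_eq_zero.2 h.1, List.count_eq_zero.2 h.2] at hz
      have h1 := List.idxOf_lt_length_of_mem hz'
      rw [← List.append_assoc, List.idxOf_append_of_mem hz',
        List.idxOf_append_of_notMem (by simp [hx])]
      omega
    · simp [List.count_append, List.count_eq_zero.2 hx.1,
        List.count_eq_zero.2 hx.2.2]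
    · simp [List.count_append, hxz] at hz ⊢; omega
  simp [hxz, this]

/-- When `z` crosses both strands of a new eye `x`, one of them is upper and the other lower, so the
two signs cancel. This is the sign count of Reidemeister II. -/
theorem pairSign_append_singleton_left {u : List ℕ} {x z : ℕ} (hx : x ∉ u) (hxz : x ≠ z) :
    pairSign (u ++ [x]) x z = - pairSign u x z := by
  by_cases hz : z ∈ u <;> simp [pairSign, hx, hxz.symm, hz]

/-- Both crossings must be passed. Switching the first would leave the two strands of the new eye to
cross each other; after passing it the two eyes are interleaved, so the second cannot be switched.
-/
theorem admits_r2_left_below {w : Front} {u v : List ℕ} {z i : ℕ} {s : ZMod 4} (hi : u.length = i)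
    (hl : Paired (u ++ z :: v)) :
    Admits (lc (i + 1) :: w) (u ++ z :: v) s ↔
      Admits (lc i :: xc (i + 1) :: xc i :: w) (u ++ z :: v) s := by
  obtain ⟨x, hx⟩ := exists_fresh (u ++ z :: v)
  have hz := hl z (by simp)
  simp only [List.mem_append, List.mem_cons, not_or] at hx
  have hxz : x ≠ z := hx.2.1
  rw [admits_lc (u := u ++ [z]) (v := v) (x := x) (by simp [hi]) (by simp) (by simp [hx]),
    admits_lc (u := u) (v := z :: v) (x := x) (by simp [hi]) (by simp) (by simp [hx]),
    admits_xc (u := u ++ [x]) (x := x) (y := z) (v := v) (by simp [hi]) (by simp),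
    admits_xc (u := u) (x := x) (y := z) (v := x :: v) (by simp [hi]) (by simp),
    admits_xc (u := u) (x := x) (y := x) (v := z :: v) (by simp [hi]) (by simp)]
  have : Interleaved (u ++ x :: z :: x :: v) x z := by
    rw [interleaved_iff hxz]
    · simp [hxz]
    · simp [List.count_append, List.count_eq_zero.2 hx.1,
        List.count_eq_zero.2 hx.2.2]
    · simp [List.count_append, hxz] at hz ⊢; omega
  simp [hxz, this, pairSign_append_singleton_left hx.1 hxz]

theorem pairSign_append_singleton_of_ne {u : List ℕ} {x y z : ℕ} (hx : x ≠ z) (hy : y ≠ z) :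
    pairSign (u ++ [z]) x y = pairSign u x y := by
  simp [pairSign, hx, hy]

theorem admits_r2_left_above {w : Front} {u v : List ℕ} {z i : ℕ} {s : ZMod 4} (hi : u.length = i)
    (hl : Paired (u ++ z :: v)) :
    Admits (lc i :: w) (u ++ z :: v) s ↔
      Admits (lc (i + 1) :: xc i :: xc (i + 1) :: w) (u ++ z :: v) s := by
  obtain ⟨x, hx⟩ := exists_fresh (u ++ z :: v)
  have hz := hl z (by simp)
  simp only [List.mem_append, List.mem_cons, not_or] at hx
  have hxz : x ≠ z := hx.2.1
  rw [admits_lc (k := i + 1) (u := u ++ [z]) (v := v) (x := x)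
    (by simp [hi]) (by simp) (by simp [hx]),
    admits_lc (k := i) (u := u) (v := z :: v) (x := x) (by simp [hi]) (by simp) (by simp [hx]),
    admits_xc (k := i) (u := u) (x := z) (y := x) (v := x :: v) (by simp [hi]) (by simp),
    admits_xc (k := i + 1) (u := u ++ [x]) (x := z) (y := x) (v := v) (by simp [hi]) (by simp),
    admits_xc (k := i + 1) (u := u ++ [z]) (x := x) (y := x) (v := v) (by simp [hi]) (by simp)]
  have : Interleaved (u ++ x :: z :: x :: v) z x := by
    rw [show u ++ x :: z :: x :: v = (u ++ [x]) ++ z :: x :: v by simp, interleaved_iff hxz.symm]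
    · have hz' : z ∈ v ++ u := by
        by_contra h
        simp only [List.mem_append, not_or] at h
        simp [List.count_append, List.count_eq_zero.2 h.1, List.count_eq_zero.2 h.2] at hz
      have h1 := List.idxOf_lt_length_of_mem hz'
      have hx' : x ∉ v ++ u := by simp [hx]
      rw [← List.append_assoc, List.idxOf_append_of_mem hz', List.idxOf_append_of_notMem hx']
      omega
    · simp [List.count_append, hxz] at hz ⊢; omega
    · simp [List.count_append, List.count_eq_zero.2 hx.1,
        List.count_eq_zero.2 hx.2.2]
  simp [hxz.symm, this, pairSign_comm _ z x, pairSign_append_singleton_left hx.1 hxz]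

/-- Unlike at a left cusp, the two strands at the cusp may belong to different eyes; then neither
tangle has a ruling, whatever the eye of the third strand. `Paired` excludes that all three carry
the same label. -/
theorem admits_r2_right_below {w : Front} {u v : List ℕ} {z x y i : ℕ} {s : ZMod 4}
    (hi : u.length = i) (hl : Paired (u ++ z :: x :: y :: v)) :
    Admits (rc (i + 1) :: w) (u ++ z :: x :: y :: v) s ↔
      Admits (xc i :: xc (i + 1) :: rc i :: w) (u ++ z :: x :: y :: v) s := by
  rw [admits_rc (u := u ++ [z]) (x := x) (y := y) (v := v) (by simp [hi]) (by simp),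
    admits_xc (u := u) (x := z) (y := x) (v := y :: v) (by simp [hi]) (by simp),
    admits_xc (u := u ++ [x]) (x := z) (y := y) (v := v) (by simp [hi]) (by simp),
    admits_xc (u := u ++ [z]) (x := x) (y := y) (v := v) (by simp [hi]) (by simp),
    admits_rc (u := u) (x := x) (y := y) (v := z :: v) (by simp [hi]) (by simp),
    admits_rc (u := u) (x := x) (y := z) (v := y :: v) (by simp [hi]) (by simp),
    admits_rc (u := u) (x := z) (y := y) (v := x :: v) (by simp [hi]) (by simp),
    admits_rc (u := u) (x := z) (y := x) (v := y :: v) (by simp [hi]) (by simp)]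
  by_cases hxy : x = y
  · subst hxy
    by_cases hzx : z = x
    · subst hzx
      have := hl z (by simp)
      simp [List.count_append] at this
      omega
    · have hx : x ∉ u := fun h => hl.notMem (u := u ++ [z]) (v := v) (x := x) (by simp) (by simp [h])
      simp [hzx, Ne.symm hzx, pairSign_comm u z x, pairSign_comm _ z x,
        pairSign_append_singleton_left hx (Ne.symm hzx)]
  · by_cases hzx : z = x
    · simp [hxy, hzx]
    · by_cases hzy : z = y
      · subst hzy
        have : Interleaved (u ++ z :: x :: z :: v) z x := by
          obtain ⟨h1, h2⟩ := hl.count_eq_one (v := z :: v) rfl hzx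
          rw [interleaved_iff hzx h1 h2]
          simp [hzx]
        simp [hxy, this]
      · simp [hxy, hzx, Ne.symm hzx, hzy]

theorem admits_r2_right_above {w : Front} {u v : List ℕ} {z x y i : ℕ} {s : ZMod 4}
    (hi : u.length = i) (hl : Paired (u ++ x :: y :: z :: v)) :
    Admits (rc i :: w) (u ++ x :: y :: z :: v) s ↔
      Admits (xc (i + 1) :: xc i :: rc (i + 1) :: w) (u ++ x :: y :: z :: v) s := by
  rw [admits_rc (k := i) (u := u) (x := x) (y := y) (v := z :: v) (by simp [hi]) (by simp),
    admits_xc (k := i + 1) (u := u ++ [x]) (x := y) (y := z) (v := v) (by simp [hi]) (by simp)]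
  simp only [List.append_assoc, List.singleton_append]
  rw [admits_xc (k := i) (u := u) (x := x) (y := z) (v := y :: v) (by simp [hi]) (by simp),
    admits_xc (k := i) (u := u) (x := x) (y := y) (v := z :: v) (by simp [hi]) (by simp),
    admits_rc (k := i + 1) (l := u ++ x :: y :: z :: v) (u := u ++ [x]) (x := y) (y := z) (v := v)
      (by simp [hi]) (by simp),
    admits_rc (k := i + 1) (l := u ++ y :: x :: z :: v) (u := u ++ [y]) (x := x) (y := z) (v := v)
      (by simp [hi]) (by simp),
    admits_rc (k := i + 1) (l := u ++ x :: z :: y :: v) (u := u ++ [x]) (x := z) (y := y) (v := v)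
      (by simp [hi]) (by simp),
    admits_rc (k := i + 1) (l := u ++ z :: x :: y :: v) (u := u ++ [z]) (x := x) (y := y) (v := v)
      (by simp [hi]) (by simp)]
  by_cases hxy : x = y
  · subst hxy
    by_cases hzx : z = x
    · subst hzx
      have := hl z (by simp)
      simp [List.count_append] at this
      omega
    · have hx : x ∉ u := fun h => hl.notMem (u := u) (v := z :: v) (x := x) (by simp) (by simp [h])
      simp [hzx, Ne.symm hzx, pairSign_append_singleton_left hx (Ne.symm hzx)]
  · by_cases hzx : z = x
    · subst hzx
      have : Interleaved (u ++ z :: y :: z :: v) y z := by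
        obtain ⟨h1, h2⟩ := hl.count_eq_one (u := u ++ [z]) (v := v) (by simp) (Ne.symm hxy)
        rw [show u ++ z :: y :: z :: v = (u ++ [z]) ++ y :: z :: v by simp,
          interleaved_iff (Ne.symm hxy) h1 h2]
        have hzu : z ∉ v ++ u := by
          simp [List.count_append] at h2
          simp only [List.mem_append, not_or, ← List.count_eq_zero]
          omega
        have hy' : y ∈ v ++ u := by
          by_contra h
          simp only [List.mem_append, not_or] at h
          simp [List.count_append, List.count_eq_zero.2 h.1, List.count_eq_zero.2 h.2, hxy] at h1
        have h1 := List.idxOf_lt_length_of_mem hy'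
        rw [← List.append_assoc, List.idxOf_append_of_mem hy', List.idxOf_append_of_notMem hzu]
        omega
      simp [hxy, this]
    · by_cases hzy : z = y
      · subst hzy
        simp [hxy]
      · simp [hxy, Ne.symm hzy, hzy, Ne.symm hzx]

-- For three strands of distinct eyes, `interleaved_iff` says that a switch is allowed or not
-- according to the order of the companions, seen cyclically from the tangle. This order is the same
-- in all slices of both sides, so there are six orders and eight ways of placing the companions
-- above or below. The rulings correspond with equal outgoing labels, but pass-switch-pass crosses
-- the upper pair twice on one side and the lower pair twice on the other, so the sums may differ by
-- `4`.
set_option maxHeartbeats 1000000 in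
theorem admits_r3 {w : Front} {u v : List ℕ} {x y z i : ℕ} {s : ZMod 4}
    (hi : u.length = i) (hl : Paired (u ++ x :: y :: z :: v)) :
    Admits (xc i :: xc (i + 1) :: xc i :: w) (u ++ x :: y :: z :: v) s ↔
      Admits (xc (i + 1) :: xc i :: xc (i + 1) :: w) (u ++ x :: y :: z :: v) s := by
  have top : ∀ (w : Front) (x y z : ℕ) (s : ZMod 4), Admits (xc i :: w) (u ++ x :: y :: z :: v) s ↔
      x ≠ y ∧ (Admits w (u ++ y :: x :: z :: v) (s - pairSign u x y) ∨
        ¬ Interleaved (u ++ x :: y :: z :: v) x y ∧ Admits w (u ++ x :: y :: z :: v) s) :=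
    fun w x y z s => admits_xc hi rfl
  have bot : ∀ (w : Front) (x y z : ℕ) (s : ZMod 4),
      Admits (xc (i + 1) :: w) (u ++ x :: y :: z :: v) s ↔
      y ≠ z ∧ (Admits w (u ++ x :: z :: y :: v) (s - pairSign (u ++ [x]) y z) ∨
        ¬ Interleaved (u ++ x :: y :: z :: v) y z ∧ Admits w (u ++ x :: y :: z :: v) s) := by
    intro w x y z s
    rw [admits_xc (u := u ++ [x]) (x := y) (y := z) (v := v) (by simp [hi]) (by simp)]
    simp
  simp only [top, bot]
  -- If two of the three strands belong to one eye, neither side has a ruling: their crossing is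
  -- forbidden, and the switches that would avoid it are between interleaved eyes or lead to it
  -- later.
  by_cases hxy : x = y
  · subst hxy
    by_cases hzx : z = x
    · subst hzx
      simp
    have hz : Interleaved (u ++ x :: z :: x :: v) x z := by
      have h := hl.count_eq_one (u := u ++ [x]) (v := v) (by simp) (Ne.symm hzx)
      simp only [List.count_append, List.count_cons, List.count_nil] at h
      rw [interleaved_iff (Ne.symm hzx)]
      · simp [Ne.symm hzx]
      · simp [List.count_append] at h ⊢; omega
      · simp [List.count_append, Ne.symm hzx] at h ⊢; omega
    simp [hz]
  by_cases hyz : y = z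
  · subst hyz
    have hz : Interleaved (u ++ y :: x :: y :: v) x y := by
      obtain ⟨h1, h2⟩ := hl.count_eq_one (u := u) (v := y :: v) (by simp) hxy
      simp [List.count_append, Ne.symm hxy] at h1 h2
      rw [show u ++ y :: x :: y :: v = (u ++ [y]) ++ x :: y :: v by simp,
        interleaved_iff hxy]
      · have hzu : y ∉ v ++ u := by
          simp only [List.mem_append, not_or, ← List.count_eq_zero]
          omega
        have hy' : x ∈ v ++ u := by
          rw [← List.count_pos_iff, List.count_append]
          omega
        have h1 := List.idxOf_lt_length_of_mem hy'
        rw [← List.append_assoc, List.idxOf_append_of_mem hy', List.idxOf_append_of_notMem hzu]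
        omega
      · simp [List.count_append, Ne.symm hxy]; omega
      · simp [List.count_append]; omega
    simp [hz]
  by_cases hxz : x = z
  · subst hxz
    have h1 : Interleaved (u ++ x :: y :: x :: v) x y := by
      obtain ⟨h1, h2⟩ := hl.count_eq_one rfl hxy
      rw [interleaved_iff hxy h1 h2]
      simp [hxy]
    have h2 : Interleaved (u ++ x :: y :: x :: v) y x := interleaved_comm.1 h1
    simp [h1, h2]
  have cx : (u ++ v).count x = 1 := by
    have := hl x (by simp)
    simp [List.count_append, Ne.symm hxy, Ne.symm hxz] at this ⊢; omega
  have cy : (u ++ v).count y = 1 := by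
    have := hl y (by simp)
    simp [List.count_append, hxy, Ne.symm hyz] at this ⊢; omega
  have cz : (u ++ v).count z = 1 := by
    have := hl z (by simp)
    simp [List.count_append, hxz, hyz] at this ⊢; omega
  have itop : ∀ a b c, a ≠ b → c ≠ a → c ≠ b → (u ++ v).count a = 1 → (u ++ v).count b = 1 →
      (Interleaved (u ++ a :: b :: c :: v) a b ↔ (v ++ u).idxOf a < (v ++ u).idxOf b) := by
    intro a b c hab hca hcb ha hb
    rw [interleaved_iff hab]
    · simp [hca, hcb]
    · simpa [List.count_append, List.count_cons, hca] using ha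
    · simpa [List.count_append, List.count_cons, hcb] using hb
  have ibot : ∀ a b c, a ≠ b → c ≠ a → c ≠ b → (u ++ v).count a = 1 → (u ++ v).count b = 1 →
      (Interleaved (u ++ c :: a :: b :: v) a b ↔ (v ++ u).idxOf a < (v ++ u).idxOf b) := by
    intro a b c hab hca hcb ha hb
    rw [show u ++ c :: a :: b :: v = (u ++ [c]) ++ a :: b :: v by simp, interleaved_iff hab]
    · have ha' : a ∈ v ++ u := by
        rw [← List.count_pos_iff]; rw [List.count_append] at ha ⊢; omega
      have hb' : b ∈ v ++ u := by
        rw [← List.count_pos_iff]; rw [List.count_append] at hb ⊢; omega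
      rw [← List.append_assoc, List.idxOf_append_of_mem ha', List.idxOf_append_of_mem hb']
    · simpa [List.count_append, List.count_cons, hca] using ha
    · simpa [List.count_append, List.count_cons, hcb] using hb
  have hyx := Ne.symm hxy
  have hzy := Ne.symm hyz
  have hzx := Ne.symm hxz
  simp only [itop x y z hxy hzx hzy cx cy, itop x z y hxz hyx hyz cx cz, itop y x z hyx hzy hzx cy cx,
    itop y z x hyz hxy hxz cy cz,
    ibot x y z hxy hzx hzy cx cy, ibot x z y hxz hyx hyz cx cz,
    ibot y z x hyz hxy hxz cy cz, ibot z y x hzy hxz hxy cz cy,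
    ne_eq, hxy, hyx, hxz, hyz, hzy, not_false_eq_true, true_and,
    pairSign_append_singleton_of_ne hyx hzx, pairSign_append_singleton_of_ne hzx hyx,
    pairSign_append_singleton_of_ne hxy hzy,
    pairSign_append_singleton_of_ne hxz hyz,
    pairSign_comm u y x, pairSign_comm u z y]
  -- The order of the companions restricts which of them lie above the tangle, and hence the signs.
  have m1 : ∀ a b, (u ++ v).count a = 1 → (u ++ v).count b = 1 →
      (v ++ u).idxOf a < (v ++ u).idxOf b → a ∈ u → b ∈ u := fun a b ha hb =>
    mem_above_of_idxOf_lt ha hb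
  have mxy := m1 x y cx cy
  have mxz := m1 x z cx cz
  have myx := m1 y x cy cx
  have myz := m1 y z cy cz
  have mzx := m1 z x cz cx
  have mzy := m1 z y cz cy
  have hmem : ∀ a, (u ++ v).count a = 1 → a ∈ v ++ u := by
    intro a ha
    rw [← List.count_pos_iff]; rw [List.count_append] at ha ⊢; omega
  have oxy : (v ++ u).idxOf x ≠ (v ++ u).idxOf y := fun h => hxy ((List.idxOf_inj (hmem x cx)).1 h)
  have oxz : (v ++ u).idxOf x ≠ (v ++ u).idxOf z := fun h => hxz ((List.idxOf_inj (hmem x cx)).1 h)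
  have oyz : (v ++ u).idxOf y ≠ (v ++ u).idxOf z := fun h => hyz ((List.idxOf_inj (hmem y cy)).1 h)
  generalize (v ++ u).idxOf x = ox at *
  generalize (v ++ u).idxOf y = oy at *
  generalize (v ++ u).idxOf z = oz at *
  clear top bot itop ibot m1 hmem cx cy cz hxy hyz hxz hyx hzy hzx hl hi
  rcases lt_or_gt_of_ne oxy with h1 | h1 <;> rcases lt_or_gt_of_ne oxz with h2 | h2 <;>
    rcases lt_or_gt_of_ne oyz with h3 | h3 <;> first | (exfalso; omega) | skip
  all_goals
    simp only [h1, h2, h3, h1.not_gt, h2.not_gt, h3.not_gt, forall_const, false_imp_iff] at mxy mxz myx myz mzx mzy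
    simp only [h1, h2, h3, h1.not_gt, h2.not_gt, h3.not_gt, not_true_eq_false, false_and, or_false,
      not_false_eq_true, true_and]
  all_goals
    by_cases ux : x ∈ u <;> by_cases uy : y ∈ u <;> by_cases uz : z ∈ u <;>
      simp only [ux, uy, uz, not_false_eq_true, forall_const, imp_false,
        imp_true_iff] at mxy mxz myx myz mzx mzy <;>
      simp only [pairSign, ux, uy, uz, iff_self, iff_true, iff_false, not_true_eq_false,
        if_true, if_false, sub_neg_eq_add] <;>
      ring_nf
  all_goals
    -- The sums `2` and `-2` of a pair crossing twice are identified here; over the integers the two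
    -- sides would differ.
    try simp only [show (-2 : ZMod 4) = 2 from by decide]
    clear * -
    tauto

/-! ### Exchange of two events without a common strand. -/

theorem interleaved_congr {l l' : List ℕ} {a b : ℕ}
    (h : l.filter (fun c => c = a ∨ c = b) = l'.filter (fun c => c = a ∨ c = b)) :
    Interleaved l a b ↔ Interleaved l' a b := by
  unfold Interleaved
  rw [h]

theorem interleaved_insert_pair {u v : List ℕ} {a b x : ℕ} (ha : a ≠ x) (hb : b ≠ x) :
    Interleaved (u ++ x :: x :: v) a b ↔ Interleaved (u ++ v) a b :=
  interleaved_congr (by simp [List.filter_append, ha.symm, hb.symm])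

theorem interleaved_swap_pair {u v : List ℕ} {a b x y : ℕ}
    (h : ¬ (x = a ∧ y = b)) (h' : ¬ (x = b ∧ y = a)) :
    Interleaved (u ++ x :: y :: v) a b ↔ Interleaved (u ++ y :: x :: v) a b := by
  apply interleaved_congr
  by_cases h1 : x = a <;> by_cases h2 : x = b <;> by_cases h3 : y = a <;> by_cases h4 : y = b <;>
    simp [List.filter_append, h1, h2, h3, h4] <;> simp_all

theorem map_swap_eq_self {m : List ℕ} {x y : ℕ} (hx : x ∉ m) (hy : y ∉ m) :
    m.map (Equiv.swap x y) = m := by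
  conv_rhs => rw [← List.map_id m]
  apply List.map_congr_left
  intro a ha
  exact Equiv.swap_apply_of_ne_of_ne (by rintro rfl; exact hx ha) (by rintro rfl; exact hy ha)

theorem admits_exchange_birth_birth {w : Front} {p q r : List ℕ} {i j : ℕ} {s : ZMod 4}
    (hp : p.length = i) (hq : (p ++ q).length = j) :
    Admits (lc i :: lc (j + 2) :: w) (p ++ (q ++ r)) s ↔
      Admits (lc j :: lc i :: w) (p ++ (q ++ r)) s := by
  obtain ⟨x, hx⟩ := exists_fresh (p ++ (q ++ r))
  obtain ⟨y, hy⟩ := exists_fresh (x :: (p ++ (q ++ r)))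
  simp only [List.mem_append, List.mem_cons, not_or] at hx hy
  rw [admits_lc (k := i) (l := p ++ (q ++ r)) (x := x) hp rfl (by simp [hx]),
    admits_lc (k := j + 2) (u := p ++ x :: x :: q) (v := r) (x := y) (by simp [← hq]; omega)
      (by simp) (by simp [hy]),
    admits_lc (k := j) (u := p ++ q) (v := r) (x := y) hq (by simp) (by simp [hy]),
    admits_lc (k := i) (u := p) (v := q ++ y :: y :: r) (x := x) hp (by simp)
      (by simp [hx, Ne.symm hy.1])]
  simp

theorem admits_exchange_birth_cross {w : Front} {p q r : List ℕ} {i j a b : ℕ} {s : ZMod 4}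
    (hp : p.length = i) (hq : (p ++ q).length = j) :
    Admits (lc i :: xc (j + 2) :: w) (p ++ (q ++ a :: b :: r)) s ↔
      Admits (xc j :: lc i :: w) (p ++ (q ++ a :: b :: r)) s := by
  obtain ⟨x, hx⟩ := exists_fresh (p ++ (q ++ a :: b :: r))
  simp only [List.mem_append, List.mem_cons, not_or] at hx
  have hxa := Ne.symm hx.2.2.1
  have hxb := Ne.symm hx.2.2.2.1
  rw [admits_lc (k := i) (l := p ++ (q ++ a :: b :: r)) (x := x) hp rfl (by simp [hx]),
    admits_xc (k := j + 2) (u := p ++ x :: x :: q) (v := r) (x := a) (y := b)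
      (by simp [← hq]; omega) (by simp),
    admits_xc (k := j) (u := p ++ q) (v := r) (x := a) (y := b) hq (by simp),
    admits_lc (k := i) (u := p) (v := q ++ b :: a :: r) (x := x) hp (by simp) (by simp [hx]),
    admits_lc (k := i) (u := p) (v := q ++ a :: b :: r) (x := x) hp (by simp) (by simp [hx]),
    interleaved_insert_pair hxa hxb]
  simp [pairSign, hxa, hxb]

theorem admits_exchange_birth_death {w : Front} {p q r : List ℕ} {i j a b : ℕ} {s : ZMod 4}
    (hp : p.length = i) (hq : (p ++ q).length = j) :
    Admits (lc i :: rc (j + 2) :: w) (p ++ (q ++ a :: b :: r)) s ↔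
      Admits (rc j :: lc i :: w) (p ++ (q ++ a :: b :: r)) s := by
  obtain ⟨x, hx⟩ := exists_fresh (p ++ (q ++ a :: b :: r))
  simp only [List.mem_append, List.mem_cons, not_or] at hx
  rw [admits_lc (k := i) (l := p ++ (q ++ a :: b :: r)) (x := x) hp rfl (by simp [hx]),
    admits_rc (k := j + 2) (u := p ++ x :: x :: q) (v := r) (x := a) (y := b)
      (by simp [← hq]; omega) (by simp),
    admits_rc (k := j) (u := p ++ q) (v := r) (x := a) (y := b) hq (by simp),
    admits_lc (k := i) (u := p) (v := q ++ r) (x := x) hp (by simp) (by simp [hx])]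
  simp

theorem admits_exchange_cross_birth {w : Front} {p q r : List ℕ} {i j x y : ℕ} {s : ZMod 4}
    (hp : p.length = i) (hq : (p ++ q).length = j) :
    Admits (xc i :: lc (j + 2) :: w) (p ++ x :: y :: (q ++ r)) s ↔
      Admits (lc (j + 2) :: xc i :: w) (p ++ x :: y :: (q ++ r)) s := by
  obtain ⟨z, hz⟩ := exists_fresh (p ++ x :: y :: (q ++ r))
  simp only [List.mem_append, List.mem_cons, not_or] at hz
  have hzx := Ne.symm hz.2.1
  have hzy := Ne.symm hz.2.2.1
  have hI : Interleaved (p ++ x :: y :: (q ++ z :: z :: r)) x y ↔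
      Interleaved (p ++ x :: y :: (q ++ r)) x y := by
    simpa using interleaved_insert_pair (u := p ++ x :: y :: q) (v := r) hzx hzy
  rw [admits_xc (k := i) (u := p) (x := x) (y := y) (v := q ++ r) hp rfl,
    admits_lc (k := j + 2) (u := p ++ y :: x :: q) (v := r) (x := z)
      (by simp [← hq]; omega) (by simp) (by simp [hz]),
    admits_lc (k := j + 2) (u := p ++ x :: y :: q) (v := r) (x := z)
      (by simp [← hq]; omega) (by simp) (by simp [hz]),
    admits_lc (k := j + 2) (u := p ++ x :: y :: q) (v := r) (x := z)
      (by simp [← hq]; omega) (by simp) (by simp [hz]),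
    admits_xc (k := i) (u := p) (x := x) (y := y) (v := q ++ z :: z :: r) hp (by simp)]
  simp [hI]

theorem admits_exchange_cross_death {w : Front} {p q r : List ℕ} {i j x y a b : ℕ} {s : ZMod 4}
    (hp : p.length = i) (hq : (p ++ q).length = j)
    (hl : Paired (p ++ x :: y :: (q ++ a :: b :: r))) :
    Admits (xc i :: rc (j + 2) :: w) (p ++ x :: y :: (q ++ a :: b :: r)) s ↔
      Admits (rc (j + 2) :: xc i :: w) (p ++ x :: y :: (q ++ a :: b :: r)) s := by
  rw [admits_xc (k := i) (u := p) (x := x) (y := y) (v := q ++ a :: b :: r) hp rfl,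
    admits_rc (k := j + 2) (u := p ++ y :: x :: q) (x := a) (y := b) (v := r)
      (by simp [← hq]; omega) (by simp),
    admits_rc (k := j + 2) (u := p ++ x :: y :: q) (x := a) (y := b) (v := r)
      (by simp [← hq]; omega) (by simp),
    admits_rc (k := j + 2) (u := p ++ x :: y :: q) (x := a) (y := b) (v := r)
      (by simp [← hq]; omega) (by simp),
    admits_xc (k := i) (u := p) (x := x) (y := y) (v := q ++ r) hp (by simp)]
  by_cases hab : a = b
  · subst hab
    have hn := hl.notMem (u := p ++ x :: y :: q) (v := r) (x := a) (by simp)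
    simp only [List.mem_append, List.mem_cons, not_or] at hn
    have hI : Interleaved (p ++ x :: y :: (q ++ a :: a :: r)) x y ↔
        Interleaved (p ++ x :: y :: (q ++ r)) x y := by
      simpa using interleaved_insert_pair (u := p ++ x :: y :: q) (v := r)
        (Ne.symm hn.1.2.1) (Ne.symm hn.1.2.2.1)
    simp [hI]
  · simp [hab]

theorem admits_exchange_death_birth {w : Front} {p q r : List ℕ} {i j x y : ℕ} {s : ZMod 4}
    (hp : p.length = i) (hq : (p ++ q).length = j) :
    Admits (rc i :: lc j :: w) (p ++ x :: y :: (q ++ r)) s ↔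
      Admits (lc (j + 2) :: rc i :: w) (p ++ x :: y :: (q ++ r)) s := by
  obtain ⟨z, hz⟩ := exists_fresh (p ++ x :: y :: (q ++ r))
  simp only [List.mem_append, List.mem_cons, not_or] at hz
  rw [admits_rc (k := i) (u := p) (x := x) (y := y) (v := q ++ r) hp rfl,
    admits_lc (k := j) (u := p ++ q) (v := r) (x := z) hq (by simp) (by simp [hz]),
    admits_lc (k := j + 2) (u := p ++ x :: y :: q) (v := r) (x := z)
      (by simp [← hq]; omega) (by simp) (by simp [hz]),
    admits_rc (k := i) (u := p) (x := x) (y := y) (v := q ++ z :: z :: r) hp (by simp)]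
  simp

theorem admits_exchange_death_cross {w : Front} {p q r : List ℕ} {i j x y a b : ℕ} {s : ZMod 4}
    (hp : p.length = i) (hq : (p ++ q).length = j)
    (hl : Paired (p ++ x :: y :: (q ++ a :: b :: r))) :
    Admits (rc i :: xc j :: w) (p ++ x :: y :: (q ++ a :: b :: r)) s ↔
      Admits (xc (j + 2) :: rc i :: w) (p ++ x :: y :: (q ++ a :: b :: r)) s := by
  rw [admits_rc (k := i) (u := p) (x := x) (y := y) (v := q ++ a :: b :: r) hp rfl,
    admits_xc (k := j) (u := p ++ q) (x := a) (y := b) (v := r) hq (by simp),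
    admits_xc (k := j + 2) (u := p ++ x :: y :: q) (x := a) (y := b) (v := r)
      (by simp [← hq]; omega) (by simp),
    admits_rc (k := i) (u := p) (x := x) (y := y) (v := q ++ b :: a :: r) hp (by simp),
    admits_rc (k := i) (u := p) (x := x) (y := y) (v := q ++ a :: b :: r) hp (by simp)]
  by_cases hxy : x = y
  · subst hxy
    have hn := hl.notMem (u := p) (v := q ++ a :: b :: r) (x := x) (by simp)
    simp only [List.mem_append, List.mem_cons, not_or] at hn
    have hax := Ne.symm hn.2.2.1
    have hbx := Ne.symm hn.2.2.2.1
    rw [interleaved_insert_pair hax hbx]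
    simp [pairSign, hax, hbx]
  · simp [hxy]

theorem admits_exchange_death_death {w : Front} {p q r : List ℕ} {i j x y a b : ℕ} {s : ZMod 4}
    (hp : p.length = i) (hq : (p ++ q).length = j) :
    Admits (rc i :: rc j :: w) (p ++ x :: y :: (q ++ a :: b :: r)) s ↔
      Admits (rc (j + 2) :: rc i :: w) (p ++ x :: y :: (q ++ a :: b :: r)) s := by
  rw [admits_rc (k := i) (u := p) (x := x) (y := y) (v := q ++ a :: b :: r) hp rfl,
    admits_rc (k := j) (u := p ++ q) (x := a) (y := b) (v := r) hq (by simp),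
    admits_rc (k := j + 2) (u := p ++ x :: y :: q) (x := a) (y := b) (v := r)
      (by simp [← hq]; omega) (by simp),
    admits_rc (k := i) (u := p) (x := x) (y := y) (v := q ++ r) hp (by simp)]
  simp only [List.append_assoc]
  tauto

/-- The crossings are independent unless they involve the same two eyes. In that case passing one of
them changes whether the other may be switched, and the bijection of rulings is not the obvious one.
-/
theorem admits_exchange_cross_cross {w : Front} {p q r : List ℕ} {i j x y a b : ℕ} {s : ZMod 4}
    (hp : p.length = i) (hq : (p ++ q).length = j)
    (hl : Paired (p ++ x :: y :: (q ++ a :: b :: r))) :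
    Admits (xc i :: xc (j + 2) :: w) (p ++ x :: y :: (q ++ a :: b :: r)) s ↔
      Admits (xc (j + 2) :: xc i :: w) (p ++ x :: y :: (q ++ a :: b :: r)) s := by
  have up : ∀ (w : Front) (x y a b : ℕ) (s : ZMod 4),
      Admits (xc i :: w) (p ++ x :: y :: (q ++ a :: b :: r)) s ↔
      x ≠ y ∧ (Admits w (p ++ y :: x :: (q ++ a :: b :: r)) (s - pairSign p x y) ∨
        ¬ Interleaved (p ++ x :: y :: (q ++ a :: b :: r)) x y ∧
          Admits w (p ++ x :: y :: (q ++ a :: b :: r)) s) :=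
    fun w x y a b s => admits_xc hp rfl
  have down : ∀ (w : Front) (x y a b : ℕ) (s : ZMod 4),
      Admits (xc (j + 2) :: w) (p ++ x :: y :: (q ++ a :: b :: r)) s ↔
      a ≠ b ∧ (Admits w (p ++ x :: y :: (q ++ b :: a :: r)) (s - pairSign (p ++ x :: y :: q) a b) ∨
        ¬ Interleaved (p ++ x :: y :: (q ++ a :: b :: r)) a b ∧
          Admits w (p ++ x :: y :: (q ++ a :: b :: r)) s) := by
    intro w x y a b s
    rw [admits_xc (u := p ++ x :: y :: q) (x := a) (y := b) (v := r) (by simp [← hq]; omega)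
      (by simp)]
    simp
  have hsign : pairSign (p ++ y :: x :: q) a b = pairSign (p ++ x :: y :: q) a b := by
    simp only [pairSign, List.mem_append, List.mem_cons, or_left_comm]
  simp only [up, down, hsign]
  by_cases hxy : x = y
  · simp [hxy]
  by_cases hab : a = b
  · simp [hab]
  -- The two eyes are interleaved, so the crossing met first has to be passed and only the second
  -- may be switched. The exchange moves the switch to the other crossing; the outgoing slices agree
  -- after exchanging the two names.
  by_cases h1 : x = a ∧ y = b
  · obtain ⟨rfl, rfl⟩ := h1
    have hx := hl x (by simp)
    have hy := hl y (by simp)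
    simp [List.count_append, hxy, Ne.symm hxy] at hx hy
    have hxp : x ∉ p ∧ x ∉ q ∧ x ∉ r := by simp only [← List.count_eq_zero]; omega
    have hyp : y ∉ p ∧ y ∉ q ∧ y ∉ r := by simp only [← List.count_eq_zero]; omega
    have fp := filter_pair_eq_nil hxp.1 hyp.1
    have fq := filter_pair_eq_nil hxp.2.1 hyp.2.1
    have fr := filter_pair_eq_nil hxp.2.2 hyp.2.2
    have I1 : Interleaved (p ++ x :: y :: (q ++ x :: y :: r)) x y := by
      simp only [Interleaved, List.filter_append, List.filter_cons, fp, fq, fr]; simp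
    have I2 : ¬ Interleaved (p ++ y :: x :: (q ++ x :: y :: r)) x y := by
      simp only [Interleaved, List.filter_append, List.filter_cons, fp, fq, fr]
      simp [hxy, Ne.symm hxy]
    have I3 : ¬ Interleaved (p ++ x :: y :: (q ++ y :: x :: r)) x y := by
      simp only [Interleaved, List.filter_append, List.filter_cons, fp, fq, fr]
      simp [hxy, Ne.symm hxy]
    have hs : pairSign p x y = pairSign (p ++ x :: y :: q) x y := by simp [pairSign, hxp, hyp]
    have hsw : Admits w (p ++ x :: y :: (q ++ y :: x :: r)) (s - pairSign p x y) ↔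
        Admits w (p ++ y :: x :: (q ++ x :: y :: r)) (s - pairSign p x y) := by
      rw [← Admits.swap x y]
      simp [map_swap_eq_self hxp.1 hyp.1, map_swap_eq_self hxp.2.1 hyp.2.1,
        map_swap_eq_self hxp.2.2 hyp.2.2]
    simp only [I1, I2, I3, ← hs, hsw]
  -- The two eyes are nested. Passing the first crossing interleaves them and forces the second to
  -- be passed too; a single switch sits at the crossing met first, and the exchange again moves it
  -- to the other crossing.
  by_cases h2 : x = b ∧ y = a
  · obtain ⟨rfl, rfl⟩ := h2
    have hx := hl x (by simp)
    have hy := hl y (by simp)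
    simp [List.count_append, hxy, Ne.symm hxy] at hx hy
    have hxp : x ∉ p ∧ x ∉ q ∧ x ∉ r := by simp only [← List.count_eq_zero]; omega
    have hyp : y ∉ p ∧ y ∉ q ∧ y ∉ r := by simp only [← List.count_eq_zero]; omega
    have fp := filter_pair_eq_nil hxp.1 hyp.1
    have fq := filter_pair_eq_nil hxp.2.1 hyp.2.1
    have fr := filter_pair_eq_nil hxp.2.2 hyp.2.2
    have I1 : ¬ Interleaved (p ++ x :: y :: (q ++ y :: x :: r)) x y := by
      simp only [Interleaved, List.filter_append, List.filter_cons, fp, fq, fr]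
      simp [hxy, Ne.symm hxy]
    have I1' : ¬ Interleaved (p ++ x :: y :: (q ++ y :: x :: r)) y x :=
      fun h => I1 (interleaved_comm.1 h)
    have I2 : Interleaved (p ++ y :: x :: (q ++ y :: x :: r)) y x := by
      rw [interleaved_comm]
      simp only [Interleaved, List.filter_append, List.filter_cons, fp, fq, fr]; simp
    have I3 : Interleaved (p ++ x :: y :: (q ++ x :: y :: r)) x y := by
      simp only [Interleaved, List.filter_append, List.filter_cons, fp, fq, fr]; simp
    have hs : pairSign p x y = pairSign (p ++ x :: y :: q) y x := by simp [pairSign, hxp, hyp]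
    have hsw : Admits w (p ++ x :: y :: (q ++ x :: y :: r)) (s - pairSign p x y) ↔
        Admits w (p ++ y :: x :: (q ++ y :: x :: r)) (s - pairSign p x y) := by
      rw [← Admits.swap x y]
      simp [map_swap_eq_self hxp.1 hyp.1, map_swap_eq_self hxp.2.1 hyp.2.1,
        map_swap_eq_self hxp.2.2 hyp.2.2]
    simp only [I1, I1', I2, I3, ← hs, hsw]
    clear * -
    tauto
  rw [interleaved_swap_pair (u := p) (v := q ++ a :: b :: r) h1 h2]
  have := interleaved_swap_pair (u := p ++ x :: y :: q) (v := r) (x := a) (y := b) (a := x) (b := y)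
    (by tauto) (by tauto)
  simp only [List.append_assoc, List.cons_append] at this
  rw [this]
  rw [sub_right_comm]
  tauto

theorem strandsAfter_cons {α : Type} {n : ℕ} {e : Event α} {w : List (Event α)}
    (h : (strandsAfter n (e :: w)).isSome) : e.pos + e.elem.ins ≤ n ∧
      (strandsAfter (n - e.elem.ins + e.elem.outs) w).isSome := by
  rw [strandsAfter] at h
  split_ifs at h with h'
  · exact ⟨h', h⟩
  · simp at h

theorem Exchange.admits_iff {a b v : Front} {l : List ℕ} {s : ZMod 4} (h : Exchange a b)
    (hl : Paired l) (ha : (strandsAfter l.length (a ++ v)).isSome)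
    (hb : (strandsAfter l.length (b ++ v)).isSome) :
    Admits (a ++ v) l s ↔ Admits (b ++ v) l s := by
  obtain ⟨e, f, i, j, hij⟩ := h
  simp only [List.cons_append, List.nil_append] at ha hb ⊢
  obtain ⟨ha1, ha2⟩ := strandsAfter_cons ha
  obtain ⟨hb1, -⟩ := strandsAfter_cons hb
  simp only at ha1 hb1
  obtain ⟨p, m, rfl, hp⟩ := List.exists_append_length (l := l) (k := i) (by omega)
  simp only [List.length_append, hp] at ha1 hb1
  have split : ∀ m : List ℕ, j - i ≤ m.length → ∃ q r, m = q ++ r ∧ (p ++ q).length = j := by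
    intro m hm
    obtain ⟨q, r, rfl, hq⟩ := List.exists_append_length hm
    exact ⟨q, r, rfl, by simp; omega⟩
  have two : ∀ m : List ℕ, 2 ≤ m.length → ∃ x y r, m = x :: y :: r := by
    rintro (_ | ⟨x, _ | ⟨y, r⟩⟩) h
    · simp at h
    · simp at h
    · exact ⟨x, y, r, rfl⟩
  rcases e with _ | ⟨⟨⟩⟩ | _
  · obtain ⟨q, m, rfl, hq⟩ := split m (by simp only [Elem.ins] at hb1; omega)
    have hqj : q.length = j - i := by simp at hq; omega
    rcases f with _ | ⟨⟨⟩⟩ | _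
    · exact admits_exchange_birth_birth hp hq
    all_goals
      simp only [Elem.ins, List.length_append] at hb1
      obtain ⟨a, b, r, rfl⟩ := two m (by omega)
    · exact admits_exchange_birth_cross hp hq
    · exact admits_exchange_birth_death hp hq
  all_goals
    simp only [Elem.ins] at ha1 hb1
    obtain ⟨x, y, m, rfl⟩ := two m (by omega)
    simp only [List.length_cons] at hb1
    obtain ⟨q, m, rfl, hq⟩ := split m (by omega)
    have hqj : q.length = j - i := by simp at hq; omega
    rcases f with _ | ⟨⟨⟩⟩ | _
  · exact admits_exchange_cross_birth hp hq
  rotate_left 2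
  · exact admits_exchange_death_birth hp hq
  all_goals
    simp only [List.length_append] at hb1
    obtain ⟨a, b, r, rfl⟩ := two m (by omega)
  · exact admits_exchange_death_cross hp hq hl
  · exact admits_exchange_death_death hp hq
  · exact admits_exchange_cross_cross hp hq hl
  · exact admits_exchange_cross_death hp hq hl

/-! ### From the local moves to decomposable fillings. -/

theorem List.exists_append_cons₃ {l : List ℕ} {k : ℕ} (h : k + 3 ≤ l.length) :
    ∃ u x y z v, l = u ++ x :: y :: z :: v ∧ u.length = k := by
  obtain ⟨u, x, y, v, rfl, hu⟩ := List.exists_append_cons₂ (Nat.le_of_succ_le h)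
  rcases v with _ | ⟨z, v⟩
  · simp at h; omega
  · exact ⟨u, x, y, z, v, rfl, hu⟩

theorem LegendrianMove.admits_iff {a b v : Front} {l : List ℕ} {s : ZMod 4}
    (h : LegendrianMove a b) (hl : Paired l) (ha : (strandsAfter l.length (a ++ v)).isSome)
    (hb : (strandsAfter l.length (b ++ v)).isSome) :
    Admits (a ++ v) l s ↔ Admits (b ++ v) l s := by
  cases h with
  | exchange a b h => exact h.admits_iff hl ha hb
  | r1_below i =>
    obtain ⟨hb1, -⟩ := strandsAfter_cons hb
    obtain ⟨u, z, v', rfl, hu⟩ := List.exists_append_cons (l := l) (k := i) hb1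
    exact admits_r1_below hu hl
  | r1_above i =>
    obtain ⟨-, hb2⟩ := strandsAfter_cons hb
    obtain ⟨hb1, -⟩ := strandsAfter_cons hb2
    obtain ⟨u, z, v', rfl, hu⟩ := List.exists_append_cons (l := l) (k := i)
      (by simp [Elem.ins, Elem.outs] at hb1; omega)
    exact admits_r1_above hu hl
  | r2_left_below i =>
    obtain ⟨ha1, -⟩ := strandsAfter_cons ha
    obtain ⟨u, z, v', rfl, hu⟩ := List.exists_append_cons (l := l) (k := i) ha1
    exact admits_r2_left_below hu hl
  | r2_left_above i =>
    obtain ⟨hb1, -⟩ := strandsAfter_cons hb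
    obtain ⟨u, z, v', rfl, hu⟩ := List.exists_append_cons (l := l) (k := i) hb1
    exact admits_r2_left_above hu hl
  | r2_right_below i =>
    obtain ⟨ha1, -⟩ := strandsAfter_cons ha
    obtain ⟨u, z, x, y, v', rfl, hu⟩ := List.exists_append_cons₃ (l := l) (k := i)
      (by simp [Elem.ins] at ha1; omega)
    exact admits_r2_right_below hu hl
  | r2_right_above i =>
    obtain ⟨hb1, -⟩ := strandsAfter_cons hb
    obtain ⟨u, z, x, y, v', rfl, hu⟩ := List.exists_append_cons₃ (l := l) (k := i)
      (by simp [Elem.ins] at hb1; omega)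
    exact admits_r2_right_above hu hl
  | r3 i =>
    obtain ⟨hb1, -⟩ := strandsAfter_cons hb
    obtain ⟨u, z, x, y, v', rfl, hu⟩ := List.exists_append_cons₃ (l := l) (k := i)
      (by simp [Elem.ins] at hb1; omega)
    exact admits_r3 hu hl

/-- The eye of a 0-handle has no crossings. In a 1-handle the left cusp may be given the label that
has just died, which merges the two eyes. The converse fails, since the two parallel strands may
belong to different eyes; hence only an implication. -/
theorem HandleMove.admits {a b v : Front} {l : List ℕ} {s : ZMod 4}
    (h : HandleMove a b) (hl : Paired l) (hb : (strandsAfter l.length (b ++ v)).isSome)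
    (hA : Admits (a ++ v) l s) : Admits (b ++ v) l s := by
  cases h with
  | zero i =>
    obtain ⟨hb1, -⟩ := strandsAfter_cons hb
    obtain ⟨u, v', rfl, hu⟩ := List.exists_append_length (l := l) (k := i) hb1
    obtain ⟨x, hx⟩ := exists_fresh (u ++ v')
    simp only [List.cons_append, List.nil_append]
    rw [admits_lc hu rfl hx, admits_rc (x := x) (y := x) hu rfl]
    exact ⟨rfl, hA⟩
  | one i =>
    obtain ⟨bs, h⟩ := hA
    cases h with
    | @death _ _ _ u v' x _ _ hl' hu h =>
      subst hl'
      have := (admits_lc (k := i) (l := u ++ v') (s := s) (w := v) hu rfl (hl.notMem rfl)).1 ⟨bs, h⟩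
      exact this

/-- Two tangles that admit the same rulings do so after any tangle. -/
theorem admits_append_mono {a b : Front}
    (hab : ∀ l s, Paired l → (strandsAfter l.length a).isSome → (strandsAfter l.length b).isSome →
      Admits a l s → Admits b l s) (u : Front) :
    ∀ l s, Paired l → (strandsAfter l.length (u ++ a)).isSome →
      (strandsAfter l.length (u ++ b)).isSome → Admits (u ++ a) l s → Admits (u ++ b) l s := by
  induction u with
  | nil => exact hab
  | cons e u ih =>
    intro l s hl ha hb ⟨bs, h⟩
    obtain ⟨ha1, ha2⟩ := strandsAfter_cons ha
    obtain ⟨hb1, hb2⟩ := strandsAfter_cons hb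
    simp only [List.cons_append] at h ⊢
    cases h with
    | @birth _ k _ p q _ _ x hl' hk hx h =>
      have hlen : l.length - (lc k).elem.ins + (lc k).elem.outs = (p ++ x :: x :: q).length := by
        simp [hl', Elem.ins, Elem.outs, add_assoc]
      rw [hlen] at ha2 hb2
      have hP : Paired (p ++ x :: x :: q) := by
        intro z hz
        rw [hl'] at hx
        simp only [List.mem_append, not_or] at hx
        by_cases hzx : z = x
        · subst hzx
          simp [List.count_append, List.count_eq_zero.2 hx.1, List.count_eq_zero.2 hx.2]
        · have := hl z (by simp [hzx] at hz; simpa [hl'] using hz)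
          simp [hl', List.count_append, Ne.symm hzx] at this ⊢
          exact this
      obtain ⟨bs', h'⟩ := ih (p ++ x :: x :: q) s hP ha2 hb2 ⟨_, h⟩
      exact ⟨_, Ruled.birth x hl' hk hx h'⟩
    | @pass _ k _ p q x y _ s' hl' hk hxy h =>
      have hlen : l.length - (xc k).elem.ins + (xc k).elem.outs = (p ++ y :: x :: q).length := by
        simp [hl', Elem.ins, Elem.outs, ← add_assoc]
      rw [hlen] at ha2 hb2
      have hP : Paired (p ++ y :: x :: q) := by
        have hperm : (p ++ y :: x :: q).Perm l := by
          rw [hl']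
          exact (List.Perm.swap _ _ _).append_left _
        intro z hz
        rw [hperm.count_eq]
        exact hl z (hperm.mem_iff.1 hz)
      obtain ⟨bs', h'⟩ := ih (p ++ y :: x :: q) _ hP ha2 hb2 ⟨_, h⟩
      exact ⟨_, Ruled.pass hl' hk hxy h'⟩
    | @switch _ k _ p q x y _ s' hl' hk hxy hi h =>
      have hlen : l.length - (xc k).elem.ins + (xc k).elem.outs = l.length :=
        Nat.sub_add_cancel (le_trans (Nat.le_add_left _ _) ha1)
      rw [hlen] at ha2 hb2
      obtain ⟨bs', h'⟩ := ih l _ hl ha2 hb2 ⟨_, h⟩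
      exact ⟨_, Ruled.switch hl' hk hxy hi h'⟩
    | @death _ k _ p q x _ _ hl' hk h =>
      have hlen : l.length - (rc k).elem.ins + (rc k).elem.outs = (p ++ q).length := by
        simp [hl', Elem.ins, Elem.outs, ← add_assoc]
      rw [hlen] at ha2 hb2
      have hP : Paired (p ++ q) := by
        intro z hz
        have hn := hl.notMem hl'
        have hzx : x ≠ z := by rintro rfl; exact hn hz
        have := hl z (by simp at hz; simp [hl']; tauto)
        simpa [hl', List.count_append, hzx] using this
      obtain ⟨bs', h'⟩ := ih (p ++ q) s hP ha2 hb2 ⟨_, h⟩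
      exact ⟨_, Ruled.death hl' hk h'⟩

theorem FrontMove.admits {w w' : Front} (h : FrontMove w w') (hw : Admits w [] 0) :
    Admits w' [] 0 := by
  have hp : Paired [] := by simp [Paired]
  obtain ⟨h1, h2, ⟨u, v, a, b, hr, rfl, rfl⟩ | ⟨u, v, a, b, hr, rfl, rfl⟩ | ⟨u, v, a, b, hr, rfl, rfl⟩⟩ := h
  all_goals
    rw [List.append_assoc] at h1 h2 hw ⊢
    refine admits_append_mono ?_ u [] 0 hp (by simp only [IsClosedWord] at h1; simp [h1])
      (by simp only [IsClosedWord] at h2; simp [h2]) hw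
    intro l s hl h3 h4 h5
  · exact (hr.admits_iff hl h3 h4).1 h5
  · exact (hr.admits_iff hl h4 h3).2 h5
  · exact hr.admits hl h4 h5

/-- A decomposably fillable front has a normal ruling whose components have even total linking
number. -/
theorem HasDecomposableFilling.admits {w : Front} (h : HasDecomposableFilling w) :
    Admits w [] 0 := by
  induction h with
  | single h => exact h.admits ⟨_, Ruled.nil⟩
  | tail _ h ih => exact h.admits ih

/-! ### The fronts of the torus links, and the uniqueness of their normal rulings -/

/-- Left end of the front of four parallel copies of the unknot. -/
def leftWord : Front := [lc 0, lc 2, lc 4, lc 6, xc 1, xc 3, xc 2, xc 5, xc 4, xc 3]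

/-- A negative quarter twist of the four upper strands. -/
def twistWord : Front := [lc 4, xc 3, xc 2, xc 1, rc 0]

/-- Right end of the front of four parallel copies of the unknot. -/
def rightWord : Front := [xc 3, xc 4, xc 5, xc 2, xc 3, xc 1, rc 6, rc 4, rc 2, rc 0]

/-- `N` quarter twists. -/
def twists (N : ℕ) : Front := (List.replicate N twistWord).flatten

/-- Four parallel copies of the unknot with `N` negative quarter twists inserted: a front of the
`(4, -(N + 4))`-torus link. -/
def torusFront (N : ℕ) : Front := leftWord ++ (twists N ++ rightWord)

theorem twists_succ (N : ℕ) : twists (N + 1) = twistWord ++ twists N := rfl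

/-! ### Enumeration of the rulings of a tangle. -/

/-- All rulings of a front tangle with given incoming labels: the switches, the total sign of the
other crossings, and the outgoing labels (normalised by the positions of their first
occurrences). -/
def rulings : Front → List ℕ → List (List Bool × ℤ × List ℕ)
  | [], l => [([], 0, l.map fun x => l.idxOf x)]
  | ⟨.birth, k⟩ :: w, l => rulings w (l.take k ++ (l.sum + 1) :: (l.sum + 1) :: l.drop k)
  | ⟨.cross _, k⟩ :: w, l =>
      match l.drop k with
      | x :: y :: v =>
          if x = y then []
          else ((rulings w (l.take k ++ y :: x :: v)).map fun r =>
              (false :: r.1, (if (x ∈ l.take k ↔ y ∈ l.take k) then 1 else -1) + r.2.1, r.2.2)) ++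
            if Interleaved l x y then [] else (rulings w l).map fun r => (true :: r.1, r.2)
      | _ => []
  | ⟨.death, k⟩ :: w, l =>
      match l.drop k with
      | x :: y :: v => if x = y then rulings w (l.take k ++ v) else []
      | _ => []

theorem take_drop_of_eq {l u v : List ℕ} {k : ℕ} (hl : l = u ++ v) (hk : u.length = k) :
    l.take k = u ∧ l.drop k = v := by
  subst hl hk
  simp

/-- Completeness of the enumeration, the only direction needed for uniqueness and for the sum. The
remaining path may start from normalised labels because of `Ruled.map`, which keeps the set of
states finite. -/
theorem Ruled.exists_mem_rulings {w v : Front} : ∀ {l : List ℕ} {bs : List Bool} {s : ZMod 4},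
    Ruled (w ++ v) l bs s → ∃ r ∈ rulings w l, ∃ bs' s', bs = r.1 ++ bs' ∧ s = r.2.1 + s' ∧
      Ruled v r.2.2 bs' s' := by
  induction w with
  | nil =>
    intro l bs s h
    refine ⟨_, List.mem_singleton.2 rfl, bs, s, rfl, by simp, ?_⟩
    exact h.map _ (fun x hx y _ hxy => (List.idxOf_inj hx).1 hxy)
  | cons e w ih =>
    intro l bs s h
    rw [List.cons_append] at h
    cases h with
    | @birth _ k _ p q _ _ x hl hk hx h =>
      -- The label chosen by `rulings` exceeds every label in use.
      have hsum : l.sum + 1 ∉ l := fun hm => by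
        have := List.single_le_sum (fun _ _ => Nat.zero_le _) _ hm
        omega
      obtain ⟨h1, h2⟩ := take_drop_of_eq hl hk
      have := h.relabel_pair (hl ▸ hx) (hl ▸ hsum)
      rw [← h1, ← h2, List.take_append_drop] at this
      exact ih this
    | @pass _ k _ p q x y _ s' hl hk hxy h =>
      obtain ⟨h1, h2⟩ := take_drop_of_eq hl hk
      obtain ⟨r, hr, bs', s', rfl, rfl, h'⟩ := ih h
      refine ⟨(false :: r.1, (if (x ∈ p ↔ y ∈ p) then 1 else -1) + r.2.1, r.2.2), ?_, bs', s', rfl,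
        ?_, h'⟩
      · simp only [rulings, h1, h2, hxy, if_false, List.mem_append, List.mem_map]
        exact Or.inl ⟨r, hr, rfl⟩
      · simp only [pairSign]
        split_ifs <;> push_cast <;> ring
    | @switch _ k _ p q x y _ s' hl hk hxy hi h =>
      obtain ⟨h1, h2⟩ := take_drop_of_eq hl hk
      obtain ⟨r, hr, bs', s', rfl, rfl, h'⟩ := ih h
      refine ⟨(true :: r.1, r.2), ?_, bs', s', rfl, rfl, h'⟩
      simp only [rulings, h2, hxy, hi, if_false, List.mem_append, List.mem_map]
      exact Or.inr ⟨r, hr, rfl⟩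
    | @death _ k _ p q x _ _ hl hk h =>
      obtain ⟨h1, h2⟩ := take_drop_of_eq hl hk
      obtain ⟨r, hr, bs', s', rfl, rfl, h'⟩ := ih h
      refine ⟨r, ?_, bs', s', rfl, rfl, h'⟩
      simp only [rulings, h1, h2, if_true]
      exact hr

theorem Ruled.append_nil {w : Front} {l : List ℕ} {bs : List Bool} {s : ZMod 4}
    (h : Ruled w l bs s) : ∃ r ∈ rulings w l, bs = r.1 ∧ s = r.2.1 ∧ r.2.2 = [] := by
  rw [← List.append_nil w] at h
  obtain ⟨r, hr, bs', s', rfl, rfl, h'⟩ := h.exists_mem_rulings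
  refine ⟨r, hr, ?_⟩
  generalize r.2.2 = m at h'
  cases h'
  simp

/-! ### The transfer argument along the twists. -/

/-- Labels from which neither double twists nor the right end of the front lead to a ruling. -/
def deadLabels : List (List ℕ) :=
  [[0, 0, 2, 2, 4, 5, 5, 4], [0, 1, 1, 0, 4, 4, 6, 6], [0, 1, 2, 0, 4, 4, 1, 2],
    [0, 1, 2, 1, 4, 0, 4, 2], [0, 1, 2, 1, 4, 4, 0, 2], [0, 1, 2, 2, 4, 0, 1, 4],
    [0, 1, 2, 2, 4, 0, 4, 1], [0, 1, 2, 2, 4, 4, 1, 0]]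

/-- Labels between two twists of the ruling. -/
def liveLabels : List ℕ := [0, 1, 0, 1, 4, 5, 4, 5]

/-- Dead states stay dead. With `rulings_right_of_mem_deadLabels`, a path that reaches one of them
can never be completed, for any number of double twists. -/
theorem rulings_double_of_mem_deadLabels : ∀ m ∈ deadLabels,
    ∀ r ∈ rulings (twistWord ++ twistWord) m, r.2.2 ∈ deadLabels := by
  decide +kernel

theorem rulings_right_of_mem_deadLabels : ∀ m ∈ deadLabels, ∀ r ∈ rulings rightWord m,
    r.2.2 ≠ [] := by
  decide +kernel

/-- All continuations but one die, and the survivor returns to the same state, so the switches are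
forced two twists at a time. -/
theorem rulings_double_liveLabels : ∀ r ∈ rulings (twistWord ++ twistWord) liveLabels,
    r = ([false, true, false, false, true, false], -4, liveLabels) ∨ r.2.2 ∈ deadLabels := by
  decide +kernel

theorem rulings_right_liveLabels : ∀ r ∈ rulings rightWord liveLabels, r.2.2 = [] →
    r = ([false, true, false, true, false, false], -4, []) := by
  decide +kernel

/-- One twist is attached to the left end because the total number of twists is odd; the others are
then grouped in pairs. -/
theorem rulings_left : ∀ r ∈ rulings (leftWord ++ twistWord) [],
    r = ([false, false, true, false, true, false, false, true, false], -6, liveLabels) ∨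
      r.2.2 ∈ deadLabels := by
  decide +kernel

theorem not_ruled_of_mem_deadLabels (n : ℕ) : ∀ m ∈ deadLabels, ∀ bs s,
    ¬ Ruled (twists (2 * n) ++ rightWord) m bs s := by
  induction n with
  | zero =>
    intro m hm bs s h
    obtain ⟨r, hr, -, -, h'⟩ := Ruled.append_nil h
    exact rulings_right_of_mem_deadLabels m hm r hr h'
  | succ n ih =>
    intro m hm bs s h
    rw [show twists (2 * (n + 1)) ++ rightWord = (twistWord ++ twistWord) ++
      (twists (2 * n) ++ rightWord) by simp [mul_add, twists_succ]] at h
    obtain ⟨r, hr, bs', s', -, -, h'⟩ := h.exists_mem_rulings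
    exact ih _ (rulings_double_of_mem_deadLabels m hm r hr) _ _ h'

/-- Each double twist and the right end contribute `-4`, which vanishes in `ZMod 4`. -/
theorem Ruled.eq_of_liveLabels (n : ℕ) : ∀ {bs s}, Ruled (twists (2 * n) ++ rightWord) liveLabels bs s →
    bs = (List.replicate n [false, true, false, false, true, false]).flatten ++
      [false, true, false, true, false, false] ∧ s = 0 := by
  induction n with
  | zero =>
    intro bs s h
    obtain ⟨r, hr, rfl, rfl, h'⟩ := Ruled.append_nil h
    rw [rulings_right_liveLabels r hr h']
    exact ⟨rfl, by decide⟩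
  | succ n ih =>
    intro bs s h
    rw [show twists (2 * (n + 1)) ++ rightWord = (twistWord ++ twistWord) ++
      (twists (2 * n) ++ rightWord) by simp [mul_add, twists_succ]] at h
    obtain ⟨r, hr, bs', s', rfl, rfl, h'⟩ := h.exists_mem_rulings
    rcases rulings_double_liveLabels r hr with rfl | hd
    · obtain ⟨rfl, rfl⟩ := ih h'
      exact ⟨rfl, by decide⟩
    · exact absurd h' (not_ruled_of_mem_deadLabels n _ hd _ _)

/-- With an odd number of twists there is at most one ruling, and its total sign is `2`. -/
theorem ruled_torusFront {n : ℕ} {bs : List Bool} {s : ZMod 4}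
    (h : Ruled (torusFront (2 * n + 1)) [] bs s) :
    bs = [false, false, true, false, true, false, false, true, false] ++
      ((List.replicate n [false, true, false, false, true, false]).flatten ++
        [false, true, false, true, false, false]) ∧ s = 2 := by
  rw [show torusFront (2 * n + 1) = (leftWord ++ twistWord) ++ (twists (2 * n) ++ rightWord) by
    simp [torusFront, twists_succ]] at h
  obtain ⟨r, hr, bs', s', rfl, rfl, h'⟩ := h.exists_mem_rulings
  rcases rulings_left r hr with rfl | hd
  · obtain ⟨rfl, rfl⟩ := Ruled.eq_of_liveLabels n h'
    -- Only the `-6` of the left end with the first twist remains, and it is `2` modulo `4`.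
    exact ⟨rfl, by decide⟩
  · exact absurd h' (not_ruled_of_mem_deadLabels n _ hd _ _)

theorem not_hasDecomposableFilling_torusFront (n : ℕ) :
    ¬ HasDecomposableFilling (torusFront (2 * n + 1)) := by
  intro h
  obtain ⟨bs, h⟩ := h.admits
  exact absurd (ruled_torusFront h).2 (by decide)

/-! ### Normal rulings as labelled paths -/

/-- For each crossing of `w`, whether its number (counted from `i`) belongs to `ρ`. -/
def switchBits (ρ : Finset ℕ) : ℕ → Front → List Bool
  | _, [] => []
  | i, ⟨.cross _, _⟩ :: w => decide (i ∈ ρ) :: switchBits ρ (i + 1) w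
  | i, ⟨.birth, _⟩ :: w => switchBits ρ (i + 1) w
  | i, ⟨.death, _⟩ :: w => switchBits ρ (i + 1) w

/-- The bits are indexed by crossings only, the set by all events; switches of a normal ruling are
crossings, so the bits determine the set. -/
theorem mem_iff_of_switchBits_eq {ρ ρ' : Finset ℕ} {w : Front} : ∀ {i : ℕ},
    switchBits ρ i w = switchBits ρ' i w → ∀ {j k : ℕ}, w[j]? = some (xc k) →
      (i + j ∈ ρ ↔ i + j ∈ ρ') := by
  induction w with
  | nil => intro i _ j k hj; simp at hj
  | cons e w ih =>
    intro i h j k hj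
    have htail : switchBits ρ (i + 1) w = switchBits ρ' (i + 1) w := by
      rcases e with ⟨_ | _ | _, _⟩ <;> simp [switchBits] at h <;> first | exact h | exact h.2
    rcases j with _ | j
    · simp only [List.getElem?_cons_zero, Option.some.injEq] at hj
      subst hj
      simp [switchBits] at h
      exact h.1
    · rw [List.getElem?_cons_succ] at hj
      have := ih htail hj
      rwa [show i + 1 + j = i + (j + 1) by omega] at this

theorem slice_succ {w : Front} {ρ : Finset ℕ} {i : ℕ} {e : Event Unit} (h : w[i]? = some e) :
    slice w ρ (i + 1) = stepLabels ρ i e (slice w ρ i) := by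
  simp [slice, h]

theorem exists_split_of_getElem? {l : List ℕ} {k a b : ℕ} (ha : l[k]? = some a)
    (hb : l[k + 1]? = some b) : ∃ u v, l = u ++ a :: b :: v ∧ u.length = k := by
  obtain ⟨h1, rfl⟩ := List.getElem?_eq_some_iff.1 ha
  obtain ⟨h2, rfl⟩ := List.getElem?_eq_some_iff.1 hb
  refine ⟨l.take k, l.drop (k + 2), ?_, by simp; omega⟩
  conv_lhs => rw [← List.take_append_drop k l, List.drop_eq_getElem_cons h1,
    List.drop_eq_getElem_cons h2]

theorem drop_two {u v : List ℕ} {x y k : ℕ} (hk : u.length = k) :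
    (u ++ x :: y :: v).drop (k + 2) = v := by
  subst hk
  rw [← List.drop_drop]
  simp

/-- The slices of a normal ruling form a labelled path, so the statements proved for `Ruled` apply
to normal rulings. -/
theorem IsNormalRuling.ruled {w : Front} {ρ : Finset ℕ} (h : IsNormalRuling w ρ)
    (hw : IsClosedWord w) : ∃ s, Ruled w [] (switchBits ρ 0 w) s := by
  -- The bound `c < i` makes the number `i` a fresh label when the next event is a left cusp.
  have key : ∀ (v : Front) (i : ℕ), w.drop i = v → strandsAfter (slice w ρ i).length v = some 0 →
      (∀ c ∈ slice w ρ i, c < i) → ∃ s, Ruled v (slice w ρ i) (switchBits ρ i v) s := by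
    intro v
    induction v with
    | nil =>
      intro i _ hs _
      simp only [strandsAfter, Option.some.injEq, List.length_eq_zero_iff] at hs
      rw [hs]
      exact ⟨_, Ruled.nil⟩
    | cons e v ih =>
      intro i hi hs hc
      have hie : w[i]? = some e := by
        have := congrArg (fun l => l[0]?) hi
        simpa using this
      have hi' : w.drop (i + 1) = v := by
        rw [← List.drop_drop, hi]; rfl
      have hss := slice_succ (ρ := ρ) hie
      rw [strandsAfter] at hs
      split_ifs at hs with hfit
      rcases e with ⟨_ | ⟨⟨⟩⟩ | _, k⟩
      · obtain ⟨p, q, hl, hk⟩ := List.exists_append_length (l := slice w ρ i) (k := k) hfit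
        obtain ⟨h1, h2⟩ := take_drop_of_eq hl hk
        have hn : slice w ρ (i + 1) = p ++ i :: i :: q := by
          rw [hss]; simp only [stepLabels, h1, h2]; simp
        obtain ⟨s, hr⟩ := ih (i + 1) hi'
          (by rw [← hs, hn, hl]; congr 1; simp [Elem.ins, Elem.outs]; omega)
          (by
            intro c hcm
            rw [hn] at hcm
            simp only [List.mem_append, List.mem_cons] at hcm
            rcases hcm with hcm | rfl | rfl | hcm
            · exact Nat.lt_succ_of_lt (hc c (by simp [hl, hcm]))
            · omega
            · omega
            · exact Nat.lt_succ_of_lt (hc c (by simp [hl, hcm])))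
        rw [hn] at hr
        exact ⟨s, Ruled.birth i hl hk (fun hm => absurd (hc i hm) (lt_irrefl i)) hr⟩
      · obtain ⟨a, b, ha, hb, hab, hI⟩ := h.crossings i k hie
        obtain ⟨p, q, hl, hk⟩ := exists_split_of_getElem? ha hb
        obtain ⟨h1, h2⟩ := take_drop_of_eq hl hk
        by_cases hiρ : i ∈ ρ
        · have hn : slice w ρ (i + 1) = slice w ρ i := by
            rw [hss]; simp [stepLabels, hiρ]
          obtain ⟨s, hr⟩ := ih (i + 1) hi'
            (by rw [← hs, hn, hl]; congr 1; simp [Elem.ins, Elem.outs, ← add_assoc])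
            (by rw [hn]; exact fun c hcm => Nat.lt_succ_of_lt (hc c hcm))
          rw [hn] at hr
          refine ⟨s, ?_⟩
          simp only [switchBits, hiρ, decide_true]
          exact Ruled.switch hl hk hab (hI hiρ) hr
        · have hn : slice w ρ (i + 1) = p ++ b :: a :: q := by
            rw [hss]; simp only [stepLabels, hiρ, if_false, h1, h2]
            rw [hl, drop_two hk]; simp
          obtain ⟨s, hr⟩ := ih (i + 1) hi'
            (by rw [← hs, hn, hl]; congr 1; simp [Elem.ins, Elem.outs, ← add_assoc])
            (by
              intro c hcm
              rw [hn] at hcm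
              refine Nat.lt_succ_of_lt (hc c ?_)
              rw [hl]
              simp only [List.mem_append, List.mem_cons] at hcm ⊢
              tauto)
          rw [hn] at hr
          simp only [switchBits, hiρ, decide_false]
          exact ⟨_, Ruled.pass hl hk hab hr⟩
      · obtain ⟨a, ha, hb⟩ := h.rightCusps i k hie
        obtain ⟨p, q, hl, hk⟩ := exists_split_of_getElem? ha hb
        obtain ⟨h1, h2⟩ := take_drop_of_eq hl hk
        have hn : slice w ρ (i + 1) = p ++ q := by
          rw [hss]; simp only [stepLabels, h1]
          rw [hl, drop_two hk]
        obtain ⟨s, hr⟩ := ih (i + 1) hi'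
          (by rw [← hs, hn, hl]; congr 1; simp [Elem.ins, Elem.outs]; omega)
          (by
            intro c hcm
            rw [hn] at hcm
            refine Nat.lt_succ_of_lt (hc c ?_)
            rw [hl]
            simp only [List.mem_append, List.mem_cons] at hcm ⊢
            tauto)
        rw [hn] at hr
        exact ⟨s, Ruled.death hl hk hr⟩
  exact key w 0 rfl hw (by simp [slice])

theorem IsNormalRuling.eq_of_torusFront {n : ℕ} (hw : IsClosedWord (torusFront (2 * n + 1)))
    {ρ ρ' : Finset ℕ} (h : IsNormalRuling (torusFront (2 * n + 1)) ρ)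
    (h' : IsNormalRuling (torusFront (2 * n + 1)) ρ') : ρ' = ρ := by
  obtain ⟨s, hs⟩ := h.ruled hw
  obtain ⟨s', hs'⟩ := h'.ruled hw
  have hbits := (ruled_torusFront hs).1.trans (ruled_torusFront hs').1.symm
  ext i
  constructor
  · intro hi
    obtain ⟨k, hk⟩ := h'.switches i hi
    simpa using (mem_iff_of_switchBits_eq hbits hk).2 (by simpa using hi)
  · intro hi
    obtain ⟨k, hk⟩ := h.switches i hi
    simpa using (mem_iff_of_switchBits_eq hbits hk).1 (by simpa using hi)

/-! ### The normal ruling and its clasps -/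

/-- The switches of the normal ruling of `torusFront N`. -/
def torusRuling (N : ℕ) : Finset ℕ :=
  (Finset.range (5 * N + 14)).filter fun i =>
    i = 6 ∨ i = 8 ∨ i = 5 * N + 11 ∨ i = 5 * N + 13 ∨ i % 5 = 2 ∧ 12 ≤ i ∧ i < 5 * N + 12

/-- The range in the definition only serves to make the set finite. The switches are `6` and `8` in
the left end, the middle crossing `5 * k + 12` of the twist number `k`, and `5 * N + 11` and `5 * N
+ 13` in the right end. -/
theorem mem_torusRuling {N i : ℕ} : i ∈ torusRuling N ↔
    i = 6 ∨ i = 8 ∨ i = 5 * N + 11 ∨ i = 5 * N + 13 ∨ i % 5 = 2 ∧ 12 ≤ i ∧ i < 5 * N + 12 := by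
  simp only [torusRuling, Finset.mem_filter, Finset.mem_range]
  omega

theorem length_twists (N : ℕ) : (twists N).length = 5 * N := by
  simp [twists, twistWord, mul_comm]

theorem length_torusFront (N : ℕ) : (torusFront N).length = 5 * N + 20 := by
  simp only [torusFront, List.length_append, length_twists, leftWord, rightWord, List.length_cons,
    List.length_nil]
  omega

theorem getElem?_twists {N k r : ℕ} (hk : k < N) (hr : r < 5) :
    (twists N)[5 * k + r]? = twistWord[r]? := by
  induction N generalizing k with
  | zero => omega
  | succ N ih =>
    rw [twists_succ]
    rcases k with _ | k
    · rw [List.getElem?_append_left (by simp [twistWord]; omega)]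
      simp
    · rw [List.getElem?_append_right (by simp [twistWord]; omega), ← ih (k := k) (by omega)]
      congr 1
      simp [twistWord]
      omega

theorem getElem?_torusFront_left {N i : ℕ} (h : i < 10) :
    (torusFront N)[i]? = leftWord[i]? := by
  rw [torusFront, List.getElem?_append_left (by simpa [leftWord] using h)]

theorem getElem?_torusFront_twist {N k r : ℕ} (hk : k < N) (hr : r < 5) :
    (torusFront N)[5 * k + 10 + r]? = twistWord[r]? := by
  rw [torusFront, List.getElem?_append_right (by simp [leftWord]; omega),
    List.getElem?_append_left (by simp [leftWord, length_twists]; omega),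
    ← getElem?_twists hk hr]
  congr 1
  simp [leftWord]
  omega

theorem getElem?_torusFront_right {N r : ℕ} :
    (torusFront N)[5 * N + 10 + r]? = rightWord[r]? := by
  rw [torusFront, List.getElem?_append_right (by simp [leftWord]; omega),
    List.getElem?_append_right (by simp [leftWord, length_twists]; omega)]
  congr 1
  simp [leftWord, length_twists]
  omega

/-- The left cusps of the components that occupy the upper four strands, from left to right. -/
def eyeLabel : ℕ → ℕ
  | 0 => 0
  | 1 => 1
  | k + 2 => 5 * k + 10

theorem eyeLabel_facts (k : ℕ) : eyeLabel k < eyeLabel (k + 1) ∧ eyeLabel (k + 1) < 5 * k + 10 ∧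
    eyeLabel k ≠ 2 ∧ eyeLabel k ≠ 3 := by
  rcases k with _ | _ | k <;> simp [eyeLabel]

theorem slice_torusFront_succ {N i : ℕ} {e : Event Unit} {l l' : List ℕ}
    (h : slice (torusFront N) (torusRuling N) i = l) (he : (torusFront N)[i]? = some e)
    (hl : stepLabels (torusRuling N) i e l = l') :
    slice (torusFront N) (torusRuling N) (i + 1) = l' := by
  rw [slice_succ he, h, hl]

theorem stepLabels_cross_of_mem {ρ : Finset ℕ} {i k : ℕ} {l : List ℕ} (h : i ∈ ρ) :
    stepLabels ρ i (xc k) l = l := by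
  simp [stepLabels, h]

theorem stepLabels_cross_of_notMem {ρ : Finset ℕ} {i k : ℕ} {l : List ℕ} (h : i ∉ ρ) :
    stepLabels ρ i (xc k) l = l.take k ++ ((l.drop k).take 2).reverse ++ l.drop (k + 2) := by
  simp [stepLabels, h]

/-! ### The slices of this ruling. -/

theorem slice_left_1 (N : ℕ) :
    slice (torusFront N) (torusRuling N) (1) = [0, 0] :=
  slice_torusFront_succ (rfl) (getElem?_torusFront_left (by norm_num)) rfl

theorem slice_left_2 (N : ℕ) :
    slice (torusFront N) (torusRuling N) (2) = [0, 0, 1, 1] :=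
  slice_torusFront_succ (slice_left_1 N) (getElem?_torusFront_left (by norm_num)) rfl

theorem slice_left_3 (N : ℕ) :
    slice (torusFront N) (torusRuling N) (3) = [0, 0, 1, 1, 2, 2] :=
  slice_torusFront_succ (slice_left_2 N) (getElem?_torusFront_left (by norm_num)) rfl

theorem slice_left_4 (N : ℕ) :
    slice (torusFront N) (torusRuling N) (4) = [0, 0, 1, 1, 2, 2, 3, 3] :=
  slice_torusFront_succ (slice_left_3 N) (getElem?_torusFront_left (by norm_num)) rfl

theorem slice_left_5 (N : ℕ) :
    slice (torusFront N) (torusRuling N) (5) = [0, 1, 0, 1, 2, 2, 3, 3] :=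
  slice_torusFront_succ (slice_left_4 N) (getElem?_torusFront_left (by norm_num))
    (stepLabels_cross_of_notMem (by rw [mem_torusRuling]; omega))

theorem slice_left_6 (N : ℕ) :
    slice (torusFront N) (torusRuling N) (6) = [0, 1, 0, 2, 1, 2, 3, 3] :=
  slice_torusFront_succ (slice_left_5 N) (getElem?_torusFront_left (by norm_num))
    (stepLabels_cross_of_notMem (by rw [mem_torusRuling]; omega))

theorem slice_left_7 (N : ℕ) :
    slice (torusFront N) (torusRuling N) (7) = [0, 1, 0, 2, 1, 2, 3, 3] :=
  slice_torusFront_succ (slice_left_6 N) (getElem?_torusFront_left (by norm_num))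
    (stepLabels_cross_of_mem (by rw [mem_torusRuling]; omega))

theorem slice_left_8 (N : ℕ) :
    slice (torusFront N) (torusRuling N) (8) = [0, 1, 0, 2, 1, 3, 2, 3] :=
  slice_torusFront_succ (slice_left_7 N) (getElem?_torusFront_left (by norm_num))
    (stepLabels_cross_of_notMem (by rw [mem_torusRuling]; omega))

theorem slice_left_9 (N : ℕ) :
    slice (torusFront N) (torusRuling N) (9) = [0, 1, 0, 2, 1, 3, 2, 3] :=
  slice_torusFront_succ (slice_left_8 N) (getElem?_torusFront_left (by norm_num))
    (stepLabels_cross_of_mem (by rw [mem_torusRuling]; omega))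

theorem slice_left_10 (N : ℕ) :
    slice (torusFront N) (torusRuling N) (10) = [0, 1, 0, 1, 2, 3, 2, 3] :=
  slice_torusFront_succ (slice_left_9 N) (getElem?_torusFront_left (by norm_num))
    (stepLabels_cross_of_notMem (by rw [mem_torusRuling]; omega))

theorem eyeLabel_pos_two (k : ℕ) : eyeLabel (k + 2) = 5 * k + 10 := rfl

/-- A twist ends the eye number `k` and starts the eye number `k + 2`, so the slice after it has the
same shape with the index raised by one; the lower eyes `2` and `3` are untouched. The slices inside
the twist are computed within the induction because their separate versions rely on this one. -/
theorem slice_twist_0 {N k : ℕ} (hk : k ≤ N) :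
    slice (torusFront N) (torusRuling N) (5 * k + 10) =
      [eyeLabel k, eyeLabel (k + 1), eyeLabel k, eyeLabel (k + 1), 2, 3, 2, 3] := by
  induction k with
  | zero => exact slice_left_10 N
  | succ k ih =>
    have hk' : k < N := hk
    have h1 : slice (torusFront N) (torusRuling N) (5 * k + 11) =
        [eyeLabel k, eyeLabel (k + 1), eyeLabel k, eyeLabel (k + 1), (5 * k + 10), (5 * k + 10),
          2, 3, 2, 3] :=
      slice_torusFront_succ (ih hk'.le) (getElem?_torusFront_twist (r := 0) hk' (by norm_num))
      rfl
    have h2 : slice (torusFront N) (torusRuling N) (5 * k + 12) =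
        [eyeLabel k, eyeLabel (k + 1), eyeLabel k, (5 * k + 10), eyeLabel (k + 1), (5 * k + 10),
         2, 3, 2, 3] :=
      slice_torusFront_succ (h1) (getElem?_torusFront_twist (r := 1) hk' (by norm_num))
      (stepLabels_cross_of_notMem (by rw [mem_torusRuling]; omega))
    have h3 : slice (torusFront N) (torusRuling N) (5 * k + 13) =
        [eyeLabel k, eyeLabel (k + 1), eyeLabel k, (5 * k + 10), eyeLabel (k + 1), (5 * k + 10),
         2, 3, 2, 3] :=
      slice_torusFront_succ (h2) (getElem?_torusFront_twist (r := 2) hk' (by norm_num))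
      (stepLabels_cross_of_mem (by rw [mem_torusRuling]; omega))
    have h4 : slice (torusFront N) (torusRuling N) (5 * k + 14) =
        [eyeLabel k, eyeLabel k, eyeLabel (k + 1), (5 * k + 10), eyeLabel (k + 1), (5 * k + 10),
         2, 3, 2, 3] :=
      slice_torusFront_succ (h3) (getElem?_torusFront_twist (r := 3) hk' (by norm_num))
      (stepLabels_cross_of_notMem (by rw [mem_torusRuling]; omega))
    have h5 : slice (torusFront N) (torusRuling N) (5 * k + 15) =
        [eyeLabel (k + 1), (5 * k + 10), eyeLabel (k + 1), (5 * k + 10), 2, 3, 2, 3] :=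
      slice_torusFront_succ (h4) (getElem?_torusFront_twist (r := 4) hk' (by norm_num))
      rfl
    exact h5

theorem slice_twist_1 {N k : ℕ} (hk : k < N) :
    slice (torusFront N) (torusRuling N) (5 * k + 11) =
      [eyeLabel k, eyeLabel (k + 1), eyeLabel k, eyeLabel (k + 1), (5 * k + 10), (5 * k + 10),
        2, 3, 2, 3] :=
  slice_torusFront_succ (slice_twist_0 hk.le) (getElem?_torusFront_twist (r := 0) hk (by norm_num))
    rfl

theorem slice_twist_2 {N k : ℕ} (hk : k < N) :
    slice (torusFront N) (torusRuling N) (5 * k + 12) =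
      [eyeLabel k, eyeLabel (k + 1), eyeLabel k, (5 * k + 10), eyeLabel (k + 1), (5 * k + 10),
       2, 3, 2, 3] :=
  slice_torusFront_succ (slice_twist_1 hk) (getElem?_torusFront_twist (r := 1) hk (by norm_num))
    (stepLabels_cross_of_notMem (by rw [mem_torusRuling]; omega))

theorem slice_twist_3 {N k : ℕ} (hk : k < N) :
    slice (torusFront N) (torusRuling N) (5 * k + 13) =
      [eyeLabel k, eyeLabel (k + 1), eyeLabel k, (5 * k + 10), eyeLabel (k + 1), (5 * k + 10),
       2, 3, 2, 3] :=
  slice_torusFront_succ (slice_twist_2 hk) (getElem?_torusFront_twist (r := 2) hk (by norm_num))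
    (stepLabels_cross_of_mem (by rw [mem_torusRuling]; omega))

theorem slice_twist_4 {N k : ℕ} (hk : k < N) :
    slice (torusFront N) (torusRuling N) (5 * k + 14) =
      [eyeLabel k, eyeLabel k, eyeLabel (k + 1), (5 * k + 10), eyeLabel (k + 1), (5 * k + 10),
       2, 3, 2, 3] :=
  slice_torusFront_succ (slice_twist_3 hk) (getElem?_torusFront_twist (r := 3) hk (by norm_num))
    (stepLabels_cross_of_notMem (by rw [mem_torusRuling]; omega))

theorem slice_right_1 (N : ℕ) :
    slice (torusFront N) (torusRuling N) (5 * N + 11) =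
      [eyeLabel N, eyeLabel (N + 1), eyeLabel N, 2, eyeLabel (N + 1), 3, 2, 3] :=
  slice_torusFront_succ (slice_twist_0 le_rfl) (getElem?_torusFront_right (r := 0))
    (stepLabels_cross_of_notMem (by rw [mem_torusRuling]; omega))

theorem slice_right_2 (N : ℕ) :
    slice (torusFront N) (torusRuling N) (5 * N + 12) =
      [eyeLabel N, eyeLabel (N + 1), eyeLabel N, 2, eyeLabel (N + 1), 3, 2, 3] :=
  slice_torusFront_succ (slice_right_1 N) (getElem?_torusFront_right (r := 1))
    (stepLabels_cross_of_mem (by rw [mem_torusRuling]; omega))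

theorem slice_right_3 (N : ℕ) :
    slice (torusFront N) (torusRuling N) (5 * N + 13) =
      [eyeLabel N, eyeLabel (N + 1), eyeLabel N, 2, eyeLabel (N + 1), 2, 3, 3] :=
  slice_torusFront_succ (slice_right_2 N) (getElem?_torusFront_right (r := 2))
    (stepLabels_cross_of_notMem (by rw [mem_torusRuling]; omega))

theorem slice_right_4 (N : ℕ) :
    slice (torusFront N) (torusRuling N) (5 * N + 14) =
      [eyeLabel N, eyeLabel (N + 1), eyeLabel N, 2, eyeLabel (N + 1), 2, 3, 3] :=
  slice_torusFront_succ (slice_right_3 N) (getElem?_torusFront_right (r := 3))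
    (stepLabels_cross_of_mem (by rw [mem_torusRuling]; omega))

theorem slice_right_5 (N : ℕ) :
    slice (torusFront N) (torusRuling N) (5 * N + 15) =
      [eyeLabel N, eyeLabel (N + 1), eyeLabel N, eyeLabel (N + 1), 2, 2, 3, 3] :=
  slice_torusFront_succ (slice_right_4 N) (getElem?_torusFront_right (r := 4))
    (stepLabels_cross_of_notMem (by rw [mem_torusRuling]; omega))

theorem slice_right_6 (N : ℕ) :
    slice (torusFront N) (torusRuling N) (5 * N + 16) =
      [eyeLabel N, eyeLabel N, eyeLabel (N + 1), eyeLabel (N + 1), 2, 2, 3, 3] :=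
  slice_torusFront_succ (slice_right_5 N) (getElem?_torusFront_right (r := 5))
    (stepLabels_cross_of_notMem (by rw [mem_torusRuling]; omega))

theorem slice_right_7 (N : ℕ) :
    slice (torusFront N) (torusRuling N) (5 * N + 17) =
      [eyeLabel N, eyeLabel N, eyeLabel (N + 1), eyeLabel (N + 1), 2, 2] :=
  slice_torusFront_succ (slice_right_6 N) (getElem?_torusFront_right (r := 6)) rfl

theorem slice_right_8 (N : ℕ) :
    slice (torusFront N) (torusRuling N) (5 * N + 18) =
      [eyeLabel N, eyeLabel N, eyeLabel (N + 1), eyeLabel (N + 1)] :=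
  slice_torusFront_succ (slice_right_7 N) (getElem?_torusFront_right (r := 7)) rfl

theorem slice_right_9 (N : ℕ) :
    slice (torusFront N) (torusRuling N) (5 * N + 19) = [eyeLabel N, eyeLabel N] :=
  slice_torusFront_succ (slice_right_8 N) (getElem?_torusFront_right (r := 8)) rfl

/-- Reduces a check at all events to twenty-five cases, uniformly in `N`. -/
theorem torusFront_cases {N : ℕ} {P : ℕ → Event Unit → Prop}
    (left0 : P 0 (lc 0))
    (left1 : P 1 (lc 2))
    (left2 : P 2 (lc 4))
    (left3 : P 3 (lc 6))
    (left4 : P 4 (xc 1))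
    (left5 : P 5 (xc 3))
    (left6 : P 6 (xc 2))
    (left7 : P 7 (xc 5))
    (left8 : P 8 (xc 4))
    (left9 : P 9 (xc 3))
    (twist0 : ∀ k < N, P (5 * k + 10) (lc 4))
    (twist1 : ∀ k < N, P (5 * k + 11) (xc 3))
    (twist2 : ∀ k < N, P (5 * k + 12) (xc 2))
    (twist3 : ∀ k < N, P (5 * k + 13) (xc 1))
    (twist4 : ∀ k < N, P (5 * k + 14) (rc 0))
    (right0 : P (5 * N + 10) (xc 3))
    (right1 : P (5 * N + 11) (xc 4))
    (right2 : P (5 * N + 12) (xc 5))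
    (right3 : P (5 * N + 13) (xc 2))
    (right4 : P (5 * N + 14) (xc 3))
    (right5 : P (5 * N + 15) (xc 1))
    (right6 : P (5 * N + 16) (rc 6))
    (right7 : P (5 * N + 17) (rc 4))
    (right8 : P (5 * N + 18) (rc 2))
    (right9 : P (5 * N + 19) (rc 0))
    {i : ℕ} {e : Event Unit} (h : (torusFront N)[i]? = some e) : P i e := by
  have hi : i < 5 * N + 20 := by
    rw [← length_torusFront]
    exact (List.getElem?_eq_some_iff.1 h).1
  by_cases h1 : i < 10
  · rw [getElem?_torusFront_left h1] at h
    interval_cases i <;> (cases h; assumption)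
  by_cases h2 : i < 5 * N + 10
  · obtain ⟨k, r, hr, rfl⟩ : ∃ k r, r < 5 ∧ i = 5 * k + 10 + r :=
      ⟨(i - 10) / 5, (i - 10) % 5, Nat.mod_lt _ (by norm_num), by omega⟩
    have hk : k < N := by omega
    rw [getElem?_torusFront_twist hk hr] at h
    interval_cases r <;> cases h
    · exact twist0 k hk
    · exact twist1 k hk
    · exact twist2 k hk
    · exact twist3 k hk
    · exact twist4 k hk
  · obtain ⟨r, hr, rfl⟩ : ∃ r, r < 10 ∧ i = 5 * N + 10 + r := ⟨i - (5 * N + 10), by omega, by omega⟩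
    rw [getElem?_torusFront_right] at h
    interval_cases r <;> (cases h; assumption)

/-- Distinctness of the labels around a twist. -/
theorem eyeLabel_ne (k : ℕ) :
    (eyeLabel k ≠ eyeLabel (k + 1) ∧ eyeLabel (k + 1) ≠ eyeLabel k) ∧
    (eyeLabel k ≠ 5 * k + 10 ∧ 5 * k + 10 ≠ eyeLabel k) ∧
    (eyeLabel (k + 1) ≠ 5 * k + 10 ∧ 5 * k + 10 ≠ eyeLabel (k + 1)) ∧
    (eyeLabel k ≠ 2 ∧ 2 ≠ eyeLabel k) ∧ (eyeLabel k ≠ 3 ∧ 3 ≠ eyeLabel k) ∧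
    (eyeLabel (k + 1) ≠ 2 ∧ 2 ≠ eyeLabel (k + 1)) ∧
    (eyeLabel (k + 1) ≠ 3 ∧ 3 ≠ eyeLabel (k + 1)) ∧
    (5 * k + 10 ≠ 2 ∧ 2 ≠ 5 * k + 10) ∧ (5 * k + 10 ≠ 3 ∧ 3 ≠ 5 * k + 10) := by
  have h1 := eyeLabel_facts k
  have h2 := eyeLabel_facts (k + 1)
  omega

/-- One `match` covers crossings and right cusps, so that a single case distinction yields both
conditions of a normal ruling. -/
theorem torusRuling_crossing_or_cusp {N i : ℕ} {e : Event Unit} (h : (torusFront N)[i]? = some e) :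
    match e.elem with
    | .birth => True
    | .cross _ => ∃ a b, (slice (torusFront N) (torusRuling N) i)[e.pos]? = some a ∧
        (slice (torusFront N) (torusRuling N) i)[e.pos + 1]? = some b ∧ a ≠ b ∧
          (i ∈ torusRuling N → ¬ Interleaved (slice (torusFront N) (torusRuling N) i) a b)
    | .death => ∃ a, (slice (torusFront N) (torusRuling N) i)[e.pos]? = some a ∧
        (slice (torusFront N) (torusRuling N) i)[e.pos + 1]? = some a := by
  refine torusFront_cases (P := fun i e => match e.elem with
    | .birth => True
    | .cross _ => ∃ a b, (slice (torusFront N) (torusRuling N) i)[e.pos]? = some a ∧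
        (slice (torusFront N) (torusRuling N) i)[e.pos + 1]? = some b ∧ a ≠ b ∧
          (i ∈ torusRuling N → ¬ Interleaved (slice (torusFront N) (torusRuling N) i) a b)
    | .death => ∃ a, (slice (torusFront N) (torusRuling N) i)[e.pos]? = some a ∧
        (slice (torusFront N) (torusRuling N) i)[e.pos + 1]? = some a) ?_ ?_ ?_ ?_ ?_ ?_ ?_ ?_ ?_ ?_
    ?_ ?_ ?_ ?_ ?_ ?_ ?_ ?_ ?_ ?_ ?_ ?_ ?_ ?_ ?_ h
  · trivial
  · trivial
  · trivial
  · trivial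
  · dsimp only; rw [slice_left_4 N]
    exact ⟨_, _, rfl, rfl, by decide, fun h => by rw [mem_torusRuling] at h; omega⟩
  · dsimp only; rw [slice_left_5 N]
    exact ⟨_, _, rfl, rfl, by decide, fun h => by rw [mem_torusRuling] at h; omega⟩
  · dsimp only; rw [slice_left_6 N]
    exact ⟨_, _, rfl, rfl, by decide, fun _ => by decide⟩
  · dsimp only; rw [slice_left_7 N]
    exact ⟨_, _, rfl, rfl, by decide, fun h => by rw [mem_torusRuling] at h; omega⟩
  · dsimp only; rw [slice_left_8 N]
    exact ⟨_, _, rfl, rfl, by decide, fun _ => by decide⟩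
  · dsimp only; rw [slice_left_9 N]
    exact ⟨_, _, rfl, rfl, by decide, fun h => by rw [mem_torusRuling] at h; omega⟩
  · intro k hk; trivial
  · intro k hk; dsimp only; rw [slice_twist_1 hk]
    exact ⟨_, _, rfl, rfl, by have := eyeLabel_ne k; omega,
      fun h => by rw [mem_torusRuling] at h; omega⟩
  · intro k hk; dsimp only; rw [slice_twist_2 hk]
    exact ⟨_, _, rfl, rfl, by have := eyeLabel_ne k; omega,
      fun _ => by simp [Interleaved, eyeLabel_ne k]⟩
  · intro k hk; dsimp only; rw [slice_twist_3 hk]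
    exact ⟨_, _, rfl, rfl, by have := eyeLabel_ne k; omega,
      fun h => by rw [mem_torusRuling] at h; omega⟩
  · intro k hk; dsimp only; rw [slice_twist_4 hk]; exact ⟨_, rfl, rfl⟩
  · dsimp only; rw [slice_twist_0 le_rfl]
    exact ⟨_, _, rfl, rfl, by have := eyeLabel_ne N; omega,
      fun h => by rw [mem_torusRuling] at h; omega⟩
  · dsimp only; rw [slice_right_1 N]
    exact ⟨_, _, rfl, rfl, by have := eyeLabel_ne N; omega,
      fun _ => by simp [Interleaved, eyeLabel_ne N]⟩
  · dsimp only; rw [slice_right_2 N]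
    exact ⟨_, _, rfl, rfl, by have := eyeLabel_ne N; omega,
      fun h => by rw [mem_torusRuling] at h; omega⟩
  · dsimp only; rw [slice_right_3 N]
    exact ⟨_, _, rfl, rfl, by have := eyeLabel_ne N; omega,
      fun _ => by simp [Interleaved, eyeLabel_ne N]⟩
  · dsimp only; rw [slice_right_4 N]
    exact ⟨_, _, rfl, rfl, by have := eyeLabel_ne N; omega,
      fun h => by rw [mem_torusRuling] at h; omega⟩
  · dsimp only; rw [slice_right_5 N]
    exact ⟨_, _, rfl, rfl, by have := eyeLabel_ne N; omega,
      fun h => by rw [mem_torusRuling] at h; omega⟩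
  · dsimp only; rw [slice_right_6 N]; exact ⟨_, rfl, rfl⟩
  · dsimp only; rw [slice_right_7 N]; exact ⟨_, rfl, rfl⟩
  · dsimp only; rw [slice_right_8 N]; exact ⟨_, rfl, rfl⟩
  · dsimp only; rw [slice_right_9 N]; exact ⟨_, rfl, rfl⟩

theorem isNormalRuling_torusRuling (N : ℕ) : IsNormalRuling (torusFront N) (torusRuling N) where
  switches i hi := by
    rw [mem_torusRuling] at hi
    rcases hi with rfl | rfl | rfl | rfl | ⟨h1, h2, h3⟩
    · exact ⟨_, getElem?_torusFront_left (by norm_num)⟩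
    · exact ⟨_, getElem?_torusFront_left (by norm_num)⟩
    · exact ⟨_, getElem?_torusFront_right (r := 1)⟩
    · exact ⟨_, getElem?_torusFront_right (r := 3)⟩
    · refine ⟨2, ?_⟩
      rw [show i = 5 * ((i - 12) / 5) + 10 + 2 by omega]
      exact getElem?_torusFront_twist (by omega) (by norm_num)
  crossings i k h := torusRuling_crossing_or_cusp h
  rightCusps i k h := torusRuling_crossing_or_cusp h

theorem isClosedWord_torusFront (N : ℕ) : IsClosedWord (torusFront N) := by
  have key : strandsAfter 8 (twists N ++ rightWord) = some 0 := by
    induction N with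
    | zero => rfl
    -- A twist takes eight strands to eight strands, and this unfolds by computation.
    | succ N ih => exact ih
  exact key

/-! #### Blocks -/

theorem mem_slice_lt {w : Front} {ρ : Finset ℕ} : ∀ {i c : ℕ}, c ∈ slice w ρ i → c < i := by
  intro i
  induction i with
  | zero => intro c h; simp [slice] at h
  | succ i ih =>
    intro c h
    rcases he : w[i]? with _ | e
    · simp only [slice, he] at h
      exact Nat.lt_succ_of_lt (ih h)
    · rw [slice_succ he] at h
      have key : c = i ∨ c ∈ slice w ρ i := by
        rcases e with ⟨_ | _ | _, k⟩ <;> simp only [stepLabels] at h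
        · simp only [List.append_assoc, List.mem_append, List.mem_cons] at h
          rcases h with h | h | h
          · exact Or.inr (List.mem_of_mem_take h)
          · simp at h; exact Or.inl h
          · exact Or.inr (List.mem_of_mem_drop h)
        · right
          split_ifs at h
          · exact h
          · simp only [List.mem_append, List.mem_reverse] at h
            rcases h with (h | h) | h
            · exact List.mem_of_mem_take h
            · exact List.mem_of_mem_drop (List.mem_of_mem_take h)
            · exact List.mem_of_mem_drop h
        · right
          simp only [List.mem_append] at h
          rcases h with h | h
          · exact List.mem_of_mem_take h
          · exact List.mem_of_mem_drop h
      rcases key with rfl | h'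
      · exact Nat.lt_succ_self _
      · exact Nat.lt_succ_of_lt (ih h')

theorem Interleaved.mem {l : List ℕ} {a b : ℕ} (h : Interleaved l a b) : a ∈ l ∧ b ∈ l := by
  have key : ∀ c, c = a ∨ c = b → c ∈ l := by
    intro c hc
    have : c ∈ l.filter (fun c => c = a ∨ c = b) := by
      rcases h with h | h <;> rw [h] <;> rcases hc with rfl | rfl <;> simp
    exact (List.mem_filter.1 this).1
  exact ⟨key a (Or.inl rfl), key b (Or.inr rfl)⟩

/-- At a right cusp the two strands of an eye are adjacent, which excludes that this eye is
interleaved with another one. -/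
theorem alternating_ne {c d z : ℕ} (hcd : c ≠ d) (p q : List ℕ) :
    p ++ z :: z :: q ≠ [c, d, c, d] := by
  intro h
  have hlen := congrArg List.length h
  rcases p with _ | ⟨p1, _ | ⟨p2, _ | ⟨p3, p⟩⟩⟩ <;> simp at h hlen <;> omega

/-- Interleaving ends at a crossing of the two components that is not switched. -/
theorem IsNormalRuling.exists_crossing {w : Front} {ρ : Finset ℕ} (h : IsNormalRuling w ρ)
    {a b j : ℕ} (hab : a ≠ b) (h1 : Interleaved (slice w ρ j) a b)
    (h2 : ¬ Interleaved (slice w ρ (j + 1)) a b) : ∃ k x y, w[j]? = some (xc k) ∧ j ∉ ρ ∧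
      (slice w ρ j)[k]? = some x ∧ (slice w ρ j)[k + 1]? = some y ∧
      (x = a ∧ y = b ∨ x = b ∧ y = a) := by
  have hlt := fun c hc => @mem_slice_lt w ρ j c hc
  rcases he : w[j]? with _ | ⟨_ | ⟨⟨⟩⟩ | _, k⟩
  · simp only [slice, he] at h2
    exact absurd h1 h2
  · rw [slice_succ he] at h2
    have ha := hlt a h1.mem.1
    have hb := hlt b h1.mem.2
    refine absurd ?_ h2
    simp only [stepLabels, List.append_assoc, List.cons_append, List.nil_append]
    rw [interleaved_insert_pair ha.ne hb.ne, List.take_append_drop]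
    exact h1
  · by_cases hj : j ∈ ρ
    · rw [slice_succ he, stepLabels_cross_of_mem hj] at h2
      exact absurd h1 h2
    obtain ⟨x, y, hx, hy, hxy, -⟩ := h.crossings j k he
    refine ⟨k, x, y, rfl, hj, hx, hy, ?_⟩
    by_contra hne
    push Not at hne
    obtain ⟨u, v, hl, hk⟩ := exists_split_of_getElem? hx hy
    obtain ⟨e1, e2⟩ := take_drop_of_eq hl hk
    rw [slice_succ he, stepLabels_cross_of_notMem hj, e1, e2, hl, drop_two hk] at h2
    rw [hl, interleaved_swap_pair (fun h => hne.1 h.1 h.2) (fun h => hne.2 h.1 h.2)] at h1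
    exact h2 (by simpa using h1)
  · obtain ⟨x, hx, hy⟩ := h.rightCusps j k he
    obtain ⟨u, v, hl, hk⟩ := exists_split_of_getElem? hx hy
    obtain ⟨e1, -⟩ := take_drop_of_eq hl hk
    rw [slice_succ he] at h2
    simp only [stepLabels, e1] at h2
    rw [hl, drop_two hk] at h2
    rw [hl] at h1
    by_cases hax : a = x
    · subst hax
      exfalso
      simp only [Interleaved, List.filter_append, List.filter_cons] at h1
      simp only [true_or, decide_true, if_true] at h1
      rcases h1 with h1 | h1
      · exact alternating_ne hab _ _ h1
      · exact alternating_ne hab.symm _ _ h1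
    by_cases hbx : b = x
    · subst hbx
      exfalso
      simp only [Interleaved, List.filter_append, List.filter_cons] at h1
      simp only [or_true, decide_true, if_true] at h1
      rcases h1 with h1 | h1
      · exact alternating_ne hab _ _ h1
      · exact alternating_ne hab.symm _ _ h1
    rw [interleaved_insert_pair hax hbx] at h1
    exact absurd h1 h2

theorem IsBlock.start_unique {w : Front} {ρ : Finset ℕ} {a b i i' j : ℕ} (h : IsBlock w ρ a b i j)
    (h' : IsBlock w ρ a b i' j) : i = i' := by
  obtain ⟨h1, h2, h3, -⟩ := h
  obtain ⟨h1', h2', h3', -⟩ := h'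
  by_contra hne
  rcases Nat.lt_or_gt_of_ne hne with hlt | hlt
  · exact h2' (h3 i' (Finset.mem_Ioc.2 ⟨hlt, h1'.le⟩))
  · exact h2 (h3' i (Finset.mem_Ioc.2 ⟨hlt, h1.le⟩))

theorem IsBlock.symm {w : Front} {ρ : Finset ℕ} {a b i j : ℕ} (h : IsBlock w ρ a b i j) :
    IsBlock w ρ b a i j := by
  simpa only [IsBlock, interleaved_comm (x := b)] using h

/-- The clasps are counted by the crossings at which they end. -/
theorem claspCount_eq_card {w : Front} {ρ : Finset ℕ} (h : IsNormalRuling w ρ) (E : Finset ℕ)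
    (hE : ∀ a b i j, a ≠ b → IsBlock w ρ a b i j → j ∈ E)
    (hE' : ∀ j ∈ E, j < w.length ∧ ∃ a b i, a ≠ b ∧ IsBlock w ρ a b i j ∧ HasClasp w ρ i j) :
    claspCount w ρ = E.card := by
  refine Finset.card_bij (fun q _ => q.2.2.2) ?_ ?_ ?_
  · rintro ⟨a, b, i, j⟩ hq
    simp only [Finset.mem_filter] at hq
    exact hE a b i j hq.2.1.ne hq.2.2.1
  · rintro ⟨a, b, i, j⟩ hq ⟨a', b', i', j'⟩ hq' hj
    simp only [Finset.mem_filter] at hq hq' hj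
    subst hj
    obtain ⟨-, hab, hB, -⟩ := hq
    obtain ⟨-, hab', hB', -⟩ := hq'
    -- The crossing number `j` is one between the two components, so `j` determines the pair, and `a
    -- < b` its order; the start of the block is then unique.
    obtain ⟨k, x, y, hk, -, hx, hy, hxy⟩ := h.exists_crossing hab.ne
      (hB.2.2.1 j (Finset.mem_Ioc.2 ⟨hB.1, le_rfl⟩)) hB.2.2.2
    obtain ⟨k', x', y', hk', -, hx', hy', hxy'⟩ := h.exists_crossing hab'.ne
      (hB'.2.2.1 j (Finset.mem_Ioc.2 ⟨hB'.1, le_rfl⟩)) hB'.2.2.2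
    rw [hk] at hk'
    obtain rfl : k = k' := by simpa using hk'
    rw [hx] at hx'
    rw [hy] at hy'
    simp only [Option.some.injEq] at hx' hy'
    obtain ⟨rfl, rfl⟩ : a = a' ∧ b = b' := by omega
    rw [hB.start_unique hB']
  · intro j hj
    obtain ⟨hjl, a, b, i, hab, hB, hC⟩ := hE' j hj
    have hmem : ∀ {a b}, a < b → IsBlock w ρ a b i j → ∃ q, ∃ (_ : q ∈ (Finset.range w.length ×ˢ
        Finset.range w.length ×ˢ Finset.range w.length ×ˢ Finset.range w.length).filter fun q =>
          q.1 < q.2.1 ∧ IsBlock w ρ q.1 q.2.1 q.2.2.1 q.2.2.2 ∧ HasClasp w ρ q.2.2.1 q.2.2.2),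
        q.2.2.2 = j := by
      intro a b hab hB
      refine ⟨(a, b, i, j), ?_, rfl⟩
      have hm := (hB.2.2.1 j (Finset.mem_Ioc.2 ⟨hB.1, le_rfl⟩)).mem
      have ha := mem_slice_lt hm.1
      have hb := mem_slice_lt hm.2
      have hi := hB.1
      simp only [Finset.mem_filter, Finset.mem_product, Finset.mem_range]
      exact ⟨⟨by omega, by omega, by omega, hjl⟩, hab, hB, hC⟩
    rcases lt_or_gt_of_ne hab with hlt | hlt
    · exact hmem hlt hB
    · exact hmem hlt hB.symm

theorem hasClasp_of_meetingStrands_eq {w : Front} {ρ : Finset ℕ} {i j : ℕ} {p q : ℕ × Bool}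
    (hpq : p ≠ q) (hi : meetingStrands w ρ i = {p, q}) (hj : meetingStrands w ρ j = {p, q}) :
    HasClasp w ρ i j := by
  rw [HasClasp, hi, hj, Finset.inter_self, Finset.card_pair hpq]
  norm_num

/-! ### The intervals on which two eyes are interleaved. -/

/-- The second part of the interval for the eyes `k` and `k + 1`, inside the twist that ends the eye
`k`. The first part lies in the preceding twist, or in the left end if `k = 0`
(`interleaved_entry`). -/
theorem interleaved_torusFront_twist {N k i : ℕ} (hk : k < N) (h1 : 5 * k + 10 ≤ i)
    (h2 : i ≤ 5 * k + 13) :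
    Interleaved (slice (torusFront N) (torusRuling N) i) (eyeLabel k) (eyeLabel (k + 1)) := by
  obtain ⟨r, rfl⟩ := Nat.exists_eq_add_of_le h1
  have hr : r ≤ 3 := by omega
  have hne := eyeLabel_ne k
  interval_cases r
  · rw [add_zero, slice_twist_0 hk.le]; simp [Interleaved, hne]
  · rw [slice_twist_1 hk]; simp [Interleaved, hne]
  · rw [slice_twist_2 hk]; simp [Interleaved, hne]
  · rw [slice_twist_3 hk]; simp [Interleaved, hne]

theorem interleaved_torusFront_next {N k i : ℕ} (hk : k < N) (h1 : 5 * k + 12 ≤ i)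
    (h2 : i ≤ 5 * k + 15) :
    Interleaved (slice (torusFront N) (torusRuling N) i) (eyeLabel (k + 1)) (eyeLabel (k + 2)) := by
  obtain ⟨r, rfl⟩ := Nat.exists_eq_add_of_le h1
  have hr : r ≤ 3 := by omega
  have hne := eyeLabel_ne k
  rw [eyeLabel_pos_two]
  interval_cases r
  · rw [add_zero, slice_twist_2 hk]; simp [Interleaved, hne]
  · rw [slice_twist_3 hk]; simp [Interleaved, hne]
  · rw [slice_twist_4 hk]; simp [Interleaved, hne]
  · have := slice_twist_0 (Nat.succ_le_of_lt hk)
    rw [show 5 * k + 12 + 3 = 5 * (k + 1) + 10 by ring, this, eyeLabel_pos_two]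
    simp [Interleaved, hne]

theorem interleaved_torusFront_two_three {N i : ℕ} (h1 : 8 ≤ i) (h2 : i ≤ 5 * N + 12) :
    Interleaved (slice (torusFront N) (torusRuling N) i) 2 3 := by
  by_cases h3 : i < 10
  · interval_cases i
    · rw [slice_left_8]; decide
    · rw [slice_left_9]; decide
  by_cases h4 : i < 5 * N + 10
  · obtain ⟨k, r, hr, rfl⟩ : ∃ k r, r < 5 ∧ i = 5 * k + 10 + r :=
      ⟨(i - 10) / 5, (i - 10) % 5, Nat.mod_lt _ (by norm_num), by omega⟩
    have hk : k < N := by omega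
    have hne := eyeLabel_ne k
    interval_cases r
    · rw [add_zero, slice_twist_0 hk.le]; simp [Interleaved, hne]
    · rw [slice_twist_1 hk]; simp [Interleaved, hne]
    · rw [slice_twist_2 hk]; simp [Interleaved, hne]
    · rw [slice_twist_3 hk]; simp [Interleaved, hne]
    · rw [slice_twist_4 hk]; simp [Interleaved, hne]
  · obtain ⟨r, rfl⟩ := Nat.exists_eq_add_of_le (not_lt.1 h4)
    have hr : r ≤ 2 := by omega
    have hne := eyeLabel_ne N
    interval_cases r
    · rw [add_zero, slice_twist_0 le_rfl]; simp [Interleaved, hne]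
    · rw [slice_right_1]; simp [Interleaved, hne]
    · rw [slice_right_2]; simp [Interleaved, hne]

theorem interleaved_torusFront_last {N i : ℕ} (h1 : 5 * N + 10 ≤ i) (h2 : i ≤ 5 * N + 15) :
    Interleaved (slice (torusFront N) (torusRuling N) i) (eyeLabel N) (eyeLabel (N + 1)) := by
  obtain ⟨r, rfl⟩ := Nat.exists_eq_add_of_le h1
  have hr : r ≤ 5 := by omega
  have hne := eyeLabel_ne N
  interval_cases r
  · rw [add_zero, slice_twist_0 le_rfl]; simp [Interleaved, hne]
  · rw [slice_right_1]; simp [Interleaved, hne]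
  · rw [slice_right_2]; simp [Interleaved, hne]
  · rw [slice_right_3]; simp [Interleaved, hne]
  · rw [slice_right_4]; simp [Interleaved, hne]
  · rw [slice_right_5]; simp [Interleaved, hne]

theorem interleaved_torusFront_right {N i : ℕ} (h1 : 5 * N + 11 ≤ i) (h2 : i ≤ 5 * N + 14) :
    Interleaved (slice (torusFront N) (torusRuling N) i) 2 (eyeLabel (N + 1)) := by
  obtain ⟨r, rfl⟩ := Nat.exists_eq_add_of_le h1
  have hr : r ≤ 3 := by omega
  have hne := eyeLabel_ne N
  interval_cases r
  · rw [add_zero, slice_right_1]; simp [Interleaved, hne]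
  · rw [slice_right_2]; simp [Interleaved, hne]
  · rw [slice_right_3]; simp [Interleaved, hne]
  · rw [slice_right_4]; simp [Interleaved, hne]

theorem meetingStrands_eq {w : Front} {ρ : Finset ℕ} {i k : ℕ} {l : List ℕ}
    (he : w[i]? = some (xc k)) (hl : slice w ρ i = l) :
    meetingStrands w ρ i = {strandAt l k, strandAt l (k + 1)} := by
  simp [meetingStrands, he, hl]

/-- The crossing at which the components `eyeLabel k` and `eyeLabel (k + 1)` become interleaved. -/
def entry : ℕ → ℕ
  | 0 => 4
  | k + 1 => 5 * k + 11

theorem meetingStrands_entry {N k : ℕ} (hk : k ≤ N) :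
    meetingStrands (torusFront N) (torusRuling N) (entry k) =
      {(eyeLabel k, true), (eyeLabel (k + 1), false)} := by
  rcases k with _ | k
  · rw [entry, meetingStrands_eq (getElem?_torusFront_left (i := 4) (by norm_num)) (slice_left_4 N)]
    decide
  · rw [entry, meetingStrands_eq (getElem?_torusFront_twist (r := 1) hk (by norm_num))
      (slice_twist_1 hk), eyeLabel_pos_two]
    have hne := eyeLabel_ne k
    simp [strandAt, hne]

theorem not_interleaved_entry {N k : ℕ} (hk : k ≤ N) :
    ¬ Interleaved (slice (torusFront N) (torusRuling N) (entry k)) (eyeLabel k)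
      (eyeLabel (k + 1)) := by
  rcases k with _ | k
  · rw [entry, slice_left_4]; decide
  · rw [entry, slice_twist_1 hk, eyeLabel_pos_two]
    have hne := eyeLabel_ne k
    simp [Interleaved, hne]

theorem interleaved_entry {N k i : ℕ} (hk : k ≤ N) (h1 : entry k < i) (h2 : i ≤ 5 * k + 10) :
    Interleaved (slice (torusFront N) (torusRuling N) i) (eyeLabel k) (eyeLabel (k + 1)) := by
  rcases k with _ | k
  · rw [entry] at h1
    have h0 : eyeLabel 0 = 0 := rfl
    have h0' : eyeLabel (0 + 1) = 1 := rfl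
    rw [h0, h0']
    interval_cases i
    · rw [slice_left_5]; decide
    · rw [slice_left_6]; decide
    · rw [slice_left_7]; decide
    · rw [slice_left_8]; decide
    · rw [slice_left_9]; decide
    · rw [slice_left_10]; decide
  · rw [entry] at h1
    exact interleaved_torusFront_next hk h1 (by omega)

theorem entry_lt (k : ℕ) : entry k < 5 * k + 10 := by
  rcases k with _ | k <;> simp [entry]; omega

/-- The crossings at which clasps end. -/
def claspEnds (N : ℕ) : Finset ℕ :=
  (Finset.range N).image (fun k => 5 * k + 13) ∪ {9, 5 * N + 12, 5 * N + 14, 5 * N + 15}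

theorem card_claspEnds (N : ℕ) : (claspEnds N).card = N + 4 := by
  rw [claspEnds, Finset.card_union_of_disjoint, Finset.card_image_of_injective]
  · simp
  · intro a b h
    simpa using h
  · rw [Finset.disjoint_left]
    intro a ha hb
    simp only [Finset.mem_image, Finset.mem_range, Finset.mem_insert, Finset.mem_singleton] at ha hb
    obtain ⟨k, hk, rfl⟩ := ha
    omega

theorem mem_claspEnds {N j : ℕ} : j ∈ claspEnds N ↔
    (∃ k < N, 5 * k + 13 = j) ∨ j = 9 ∨ j = 5 * N + 12 ∨ j = 5 * N + 14 ∨ j = 5 * N + 15 := by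
  simp only [claspEnds, Finset.mem_union, Finset.mem_image, Finset.mem_range, Finset.mem_insert,
    Finset.mem_singleton]

/-- Shows that no block is missed: by `IsNormalRuling.exists_crossing` a block ends at an unswitched
crossing of interleaved components, and these are all listed. -/
theorem claspEnds_of_interleaved {N j : ℕ} {e : Event Unit} (h : (torusFront N)[j]? = some e) :
    ∀ k x y, e = xc k → j ∉ torusRuling N →
      (slice (torusFront N) (torusRuling N) j)[k]? = some x →
      (slice (torusFront N) (torusRuling N) j)[k + 1]? = some y →
      Interleaved (slice (torusFront N) (torusRuling N) j) x y → j ∈ claspEnds N := by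
  refine torusFront_cases (P := fun j e => ∀ k x y, e = xc k → j ∉ torusRuling N →
      (slice (torusFront N) (torusRuling N) j)[k]? = some x →
      (slice (torusFront N) (torusRuling N) j)[k + 1]? = some y →
      Interleaved (slice (torusFront N) (torusRuling N) j) x y → j ∈ claspEnds N) ?_ ?_ ?_ ?_ ?_ ?_
      ?_ ?_ ?_ ?_ ?_ ?_ ?_ ?_ ?_ ?_ ?_ ?_ ?_ ?_ ?_ ?_ ?_ ?_ ?_ h
  · intro k x y he; cases he
  · intro k x y he; cases he
  · intro k x y he; cases he
  · intro k x y he; cases he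
  · intro k x y he hj hx hy hI; cases he; rw [slice_left_4 N] at hx hy hI; cases hx; cases hy
    exact absurd hI (by decide)
  · intro k x y he hj hx hy hI; cases he; rw [slice_left_5 N] at hx hy hI; cases hx; cases hy
    exact absurd hI (by decide)
  · intro k x y he hj; exact absurd (mem_torusRuling.2 (by omega)) hj
  · intro k x y he hj hx hy hI; cases he; rw [slice_left_7 N] at hx hy hI; cases hx; cases hy
    exact absurd hI (by decide)
  · intro k x y he hj; exact absurd (mem_torusRuling.2 (by omega)) hj
  · intro k x y he hj hx hy hI; exact mem_claspEnds.2 (Or.inr (by omega))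
  · intro m hm k x y he; cases he
  · intro m hm k x y he hj hx hy hI; cases he; rw [slice_twist_1 hm] at hx hy hI; cases hx; cases hy
    exact absurd hI (by simp [Interleaved, eyeLabel_ne m])
  · intro m hm k x y he hj; exact absurd (mem_torusRuling.2 (by omega)) hj
  · intro m hm k x y he hj hx hy hI; exact mem_claspEnds.2 (Or.inl ⟨m, hm, rfl⟩)
  · intro m hm k x y he; cases he
  · intro k x y he hj hx hy hI; cases he; rw [slice_twist_0 le_rfl] at hx hy hI; cases hx; cases hy
    exact absurd hI (by simp [Interleaved, eyeLabel_ne N])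
  · intro k x y he hj; exact absurd (mem_torusRuling.2 (by omega)) hj
  · intro k x y he hj hx hy hI; exact mem_claspEnds.2 (Or.inr (by omega))
  · intro k x y he hj; exact absurd (mem_torusRuling.2 (by omega)) hj
  · intro k x y he hj hx hy hI; exact mem_claspEnds.2 (Or.inr (by omega))
  · intro k x y he hj hx hy hI; exact mem_claspEnds.2 (Or.inr (by omega))
  · intro k x y he; cases he
  · intro k x y he; cases he
  · intro k x y he; cases he
  · intro k x y he; cases he

theorem claspCount_torusRuling (N : ℕ) :
    claspCount (torusFront N) (torusRuling N) = N + 4 := by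
  rw [← card_claspEnds N]
  have hR := isNormalRuling_torusRuling N
  have hne := eyeLabel_ne N
  refine claspCount_eq_card hR _ ?_ ?_
  · intro a b i j hab hB
    have hI := hB.2.2.1 j (Finset.mem_Ioc.2 ⟨hB.1, le_rfl⟩)
    obtain ⟨k, x, y, he, hj, hx, hy, hxy⟩ := hR.exists_crossing hab hI hB.2.2.2
    refine claspEnds_of_interleaved he k x y rfl hj hx hy ?_
    rcases hxy with ⟨rfl, rfl⟩ | ⟨rfl, rfl⟩
    · exact hI
    · exact interleaved_comm.1 hI
  · intro j hj
    refine ⟨by rw [length_torusFront]; rw [mem_claspEnds] at hj; omega, ?_⟩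
    -- The clasping pairs are, in this order: consecutive eyes of the chain up to the last twist,
    -- `1` and `2` in the left end, `2` and `3` along the whole front, `2` and the last eye of the
    -- chain, and the last two eyes of the chain. In each case the same two strands meet at both
    -- ends of the block.
    rcases mem_claspEnds.1 hj with ⟨k, hk, rfl⟩ | rfl | rfl | rfl | rfl
    · have hne := eyeLabel_ne k
      have hlt := entry_lt k
      refine ⟨eyeLabel k, eyeLabel (k + 1), entry k, hne.1.1, ⟨by omega,
        not_interleaved_entry hk.le, ?_, ?_⟩, ?_⟩
      · intro m hm
        rw [Finset.mem_Ioc] at hm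
        rcases le_total m (5 * k + 10) with h | h
        · exact interleaved_entry hk.le hm.1 h
        · exact interleaved_torusFront_twist hk h hm.2
      · rw [slice_twist_4 hk]; simp [Interleaved, hne]
      · refine hasClasp_of_meetingStrands_eq (by simp) (meetingStrands_entry hk.le) ?_
        rw [meetingStrands_eq (getElem?_torusFront_twist (r := 3) hk (by norm_num))
          (slice_twist_3 hk), Finset.pair_comm]
        simp [strandAt, hne]
    · refine ⟨1, 2, 5, by norm_num, ⟨by norm_num, by rw [slice_left_5]; decide, ?_,
        by rw [slice_left_10]; decide⟩, ?_⟩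
      · intro m hm
        rw [Finset.mem_Ioc] at hm
        obtain ⟨h1, h2⟩ := hm
        interval_cases m
        · rw [slice_left_6]; decide
        · rw [slice_left_7]; decide
        · rw [slice_left_8]; decide
        · rw [slice_left_9]; decide
      · refine hasClasp_of_meetingStrands_eq (p := (1, true)) (q := (2, false)) (by simp) ?_ ?_
        · rw [meetingStrands_eq (getElem?_torusFront_left (i := 5) (by norm_num)) (slice_left_5 N)]
          decide
        · rw [meetingStrands_eq (getElem?_torusFront_left (i := 9) (by norm_num)) (slice_left_9 N)]
          decide
    · refine ⟨2, 3, 7, by norm_num, ⟨by omega, by rw [slice_left_7]; decide, ?_,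
        by rw [slice_right_3]; simp [Interleaved, hne]⟩, ?_⟩
      · intro m hm
        rw [Finset.mem_Ioc] at hm
        exact interleaved_torusFront_two_three hm.1 hm.2
      · refine hasClasp_of_meetingStrands_eq (p := (2, true)) (q := (3, false)) (by simp) ?_ ?_
        · rw [meetingStrands_eq (getElem?_torusFront_left (i := 7) (by norm_num)) (slice_left_7 N)]
          decide
        · rw [meetingStrands_eq (getElem?_torusFront_right (r := 2)) (slice_right_2 N),
            Finset.pair_comm]
          simp [strandAt, hne]
    · refine ⟨2, eyeLabel (N + 1), 5 * N + 10, hne.2.2.2.2.2.1.2, ⟨by omega,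
        by rw [slice_twist_0 le_rfl]; simp [Interleaved, hne], ?_,
        by rw [slice_right_5]; simp [Interleaved, hne]⟩, ?_⟩
      · intro m hm
        rw [Finset.mem_Ioc] at hm
        exact interleaved_torusFront_right hm.1 hm.2
      · refine hasClasp_of_meetingStrands_eq (p := (eyeLabel (N + 1), true)) (q := (2, false))
          (by simp) ?_ ?_
        · rw [meetingStrands_eq (getElem?_torusFront_right (r := 0)) (slice_twist_0 le_rfl)]
          simp [strandAt, hne]
        · rw [meetingStrands_eq (getElem?_torusFront_right (r := 4)) (slice_right_4 N),
            Finset.pair_comm]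
          simp [strandAt, hne]
    · have hlt := entry_lt N
      refine ⟨eyeLabel N, eyeLabel (N + 1), entry N, hne.1.1, ⟨by omega,
        not_interleaved_entry le_rfl, ?_, by rw [slice_right_6]; simp [Interleaved, hne]⟩, ?_⟩
      · intro m hm
        rw [Finset.mem_Ioc] at hm
        rcases le_total m (5 * N + 10) with h | h
        · exact interleaved_entry le_rfl hm.1 h
        · exact interleaved_torusFront_last h hm.2
      · refine hasClasp_of_meetingStrands_eq (by simp) (meetingStrands_entry le_rfl) ?_
        rw [meetingStrands_eq (getElem?_torusFront_right (r := 5)) (slice_right_5 N),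
          Finset.pair_comm]
        simp [strandAt, hne]

/-! ### The smooth type of the fronts -/

theorem strandsAfter_append {α : Type} (a b : List (Event α)) : ∀ s : ℕ,
    strandsAfter s (a ++ b) = (strandsAfter s a).bind fun t => strandsAfter t b := by
  induction a with
  | nil => intro s; rfl
  | cons e a ih =>
    intro s
    rw [List.cons_append, strandsAfter, strandsAfter]
    split_ifs
    · exact ih _
    · rfl

/-- Isotopy of tangle diagrams with `s` incoming and `t` outgoing strands. -/
def TangleIsotopic (s t : ℕ) : LinkDiagram → LinkDiagram → Prop :=
  Relation.EqvGen fun D D' =>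
    strandsAfter s D = some t ∧ strandsAfter s D' = some t ∧ InContext ReidemeisterMove D D'

/-- Isotopies of tangles are local. Fixing the numbers of ends keeps every intermediate diagram
closed after insertion. -/
theorem TangleIsotopic.context {s t s' t' : ℕ} {a b : LinkDiagram} (h : TangleIsotopic s t a b)
    {u v : LinkDiagram} (hu : strandsAfter s' u = some s) (hv : strandsAfter t v = some t') :
    TangleIsotopic s' t' (u ++ a ++ v) (u ++ b ++ v) := by
  induction h with
  | rel a b h =>
    obtain ⟨h1, h2, p, q, c, d, hr, rfl, rfl⟩ := h
    refine Relation.EqvGen.rel _ _ ⟨?_, ?_, u ++ p, q ++ v, c, d, hr, by simp, by simp⟩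
    · rw [strandsAfter_append, strandsAfter_append, hu, Option.bind_some, h1, Option.bind_some, hv]
    · rw [strandsAfter_append, strandsAfter_append, hu, Option.bind_some, h2, Option.bind_some, hv]
  | refl a => exact Relation.EqvGen.refl _
  | symm a b _ ih => exact Relation.EqvGen.symm _ _ ih
  | trans a b c _ _ ih1 ih2 => exact Relation.EqvGen.trans _ _ _ ih1 ih2

theorem TangleIsotopic.trans {s t : ℕ} {a b c : LinkDiagram} (h : TangleIsotopic s t a b)
    (h' : TangleIsotopic s t b c) : TangleIsotopic s t a c :=
  Relation.EqvGen.trans _ _ _ h h'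

/-! ### Isotopies certified by lists of moves. -/

/-- The moves used below, each applied at the beginning of a diagram. -/
inductive MoveCode
  | exchange
  | birth
  | death
  | zigzag
  | triple

/-- Effect of a move at the beginning of a diagram (`none` if it is not applicable). -/
def MoveCode.apply : MoveCode → LinkDiagram → Option LinkDiagram
  | .exchange, e :: f :: w =>
      if e.pos + e.elem.outs ≤ f.pos then
        some (⟨f.elem, f.pos - e.elem.outs + e.elem.ins⟩ :: e :: w)
      else if f.pos + f.elem.ins ≤ e.pos then
        some (f :: ⟨e.elem, e.pos - f.elem.ins + f.elem.outs⟩ :: w)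
      else none
  | .birth, ⟨.birth, i⟩ :: ⟨.cross c, j⟩ :: w =>
      if j = i + 1 ∨ i = j + 1 then some (⟨.birth, j⟩ :: ⟨.cross (!c), i⟩ :: w) else none
  | .death, ⟨.cross c, i⟩ :: ⟨.death, j⟩ :: w =>
      if j = i + 1 ∨ i = j + 1 then some (⟨.cross (!c), j⟩ :: ⟨.death, i⟩ :: w) else none
  | .zigzag, ⟨.birth, i⟩ :: ⟨.death, j⟩ :: w => if i = j + 1 then some w else none
  | .triple, ⟨.cross c, i⟩ :: ⟨.cross d, j⟩ :: ⟨.cross e, k⟩ :: w =>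
      if i = k ∧ (j = i + 1 ∨ i = j + 1) ∧ c = d ∧ d = e then
        some (⟨.cross c, j⟩ :: ⟨.cross c, i⟩ :: ⟨.cross c, j⟩ :: w) else none
  | _, _ => none

theorem MoveCode.apply_sound {m : MoveCode} {w w' : LinkDiagram} (h : m.apply w = some w') :
    ∃ a b v, (ReidemeisterMove a b ∨ ReidemeisterMove b a) ∧ w = a ++ v ∧ w' = b ++ v := by
  unfold MoveCode.apply at h
  split at h
  · rename_i e f v
    split_ifs at h with h1 h2
    · obtain rfl := Option.some.inj h
      have := Exchange.mk e.elem f.elem e.pos (f.pos - e.elem.outs) (by omega)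
      rw [Nat.sub_add_cancel (by omega)] at this
      exact ⟨_, _, v, Or.inl (.exchange _ _ this), rfl, rfl⟩
    · obtain rfl := Option.some.inj h
      have := Exchange.mk f.elem e.elem f.pos (e.pos - f.elem.ins) (by omega)
      rw [Nat.sub_add_cancel (by omega)] at this
      exact ⟨_, _, v, Or.inr (.exchange _ _ this), rfl, rfl⟩
  · rename_i i c j v
    split_ifs at h with h1
    obtain rfl := Option.some.inj h
    rcases h1 with rfl | rfl
    · exact ⟨_, _, v, Or.inl (.turn_birth i c), rfl, rfl⟩
    · exact ⟨_, _, v, Or.inr (.turn_birth j (!c)), by simp, rfl⟩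
  · rename_i c i j v
    split_ifs at h with h1
    obtain rfl := Option.some.inj h
    rcases h1 with rfl | rfl
    · exact ⟨_, _, v, Or.inr (.turn_death i (!c)), by simp, rfl⟩
    · exact ⟨_, _, v, Or.inl (.turn_death j c), rfl, rfl⟩
  · rename_i i j v
    split_ifs at h with h1
    obtain rfl := Option.some.inj h
    subst h1
    exact ⟨_, _, _, Or.inr (.zigzag_below j), rfl, rfl⟩
  · rename_i c i d j e k v
    split_ifs at h with h1
    obtain rfl := Option.some.inj h
    obtain ⟨rfl, rfl | rfl, rfl, rfl⟩ := h1
    · exact ⟨_, _, v, Or.inl (.r3 i c c c fun _ => rfl), rfl, rfl⟩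
    · exact ⟨_, _, v, Or.inr (.r3 j c c c fun _ => rfl), rfl, rfl⟩
  · cases h

/-- Apply the move `m` after the first `p` events. -/
def MoveCode.applyAt (m : MoveCode) (p : ℕ) (w : LinkDiagram) : Option LinkDiagram :=
  (m.apply (w.drop p)).map fun v => w.take p ++ v

/-- Apply a sequence of moves to a tangle with `s` incoming and `t` outgoing strands. -/
def applyMoves (s t : ℕ) : List (MoveCode × ℕ) → LinkDiagram → Option LinkDiagram
  | [], w => some w
  | c :: cs, w =>
      match c.1.applyAt c.2 w with
      | none => none
      | some w' => if strandsAfter s w' = some t then applyMoves s t cs w' else none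

/-- Turns an isotopy into a computation: the list of moves is a certificate whose evaluation the
kernel checks. -/
theorem tangleIsotopic_of_applyMoves {s t : ℕ} {cs : List (MoveCode × ℕ)} :
    ∀ {w w' : LinkDiagram}, strandsAfter s w = some t → applyMoves s t cs w = some w' →
      TangleIsotopic s t w w' := by
  induction cs with
  | nil =>
    intro w w' _ h
    obtain rfl := Option.some.inj h
    exact Relation.EqvGen.refl _
  | cons c cs ih =>
    intro w w' hw h
    rw [applyMoves] at h
    split at h
    · cases h
    · rename_i w1 h1
      split_ifs at h with h2
      refine TangleIsotopic.trans ?_ (ih h2 h)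
      rw [MoveCode.applyAt, Option.map_eq_some_iff] at h1
      obtain ⟨v, hv, rfl⟩ := h1
      obtain ⟨a, b, v', hab, h3, rfl⟩ := MoveCode.apply_sound hv
      have hw' : w = w.take c.2 ++ a ++ v' := by
        rw [List.append_assoc, ← h3, List.take_append_drop]
      rcases hab with hab | hab
      · exact Relation.EqvGen.rel _ _ ⟨hw, h2, w.take c.2, v', a, b, hab, hw', by simp⟩
      · exact Relation.EqvGen.symm _ _
          (Relation.EqvGen.rel _ _ ⟨h2, hw, w.take c.2, v', b, a, hab, by simp, hw'⟩)

/-! ### The building blocks of the torus fronts up to isotopy. -/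

/-- One letter of the braid of a torus link: a negative quarter twist of four strands. -/
def braidRow : LinkDiagram := [⟨.cross false, 0⟩, ⟨.cross false, 1⟩, ⟨.cross false, 2⟩]

/-- A negative half twist of the lower four of eight strands. -/
def lowerHalfTwist : LinkDiagram :=
  [⟨.cross false, 6⟩, ⟨.cross false, 5⟩, ⟨.cross false, 6⟩, ⟨.cross false, 4⟩, ⟨.cross false, 5⟩,
    ⟨.cross false, 6⟩]

/-- The left turning points of the standard diagram of a torus link. -/
def births : LinkDiagram := [⟨.birth, 0⟩, ⟨.birth, 1⟩, ⟨.birth, 2⟩, ⟨.birth, 3⟩]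

/-- The right turning points of the standard diagram of a torus link. -/
def deaths : LinkDiagram := [⟨.death, 3⟩, ⟨.death, 2⟩, ⟨.death, 1⟩, ⟨.death, 0⟩]

/-- Three turn moves carry the crossings past the left turning point, each changing from `true` to
`false`; the turning point then cancels with the right one as a zigzag. -/
theorem twistWord_isotopic : TangleIsotopic 8 8 (Front.toDiagram twistWord) braidRow :=
  tangleIsotopic_of_applyMoves (cs :=
  [(.birth, 0), (.exchange, 1), (.birth, 0), (.exchange, 2), (.exchange, 1), (.birth, 0),
    (.exchange, 3), (.exchange, 2), (.exchange, 1), (.zigzag, 0)])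
    (by decide +kernel) (by decide +kernel)

/-- Six turn moves, one for each crossing, nest the left turning points and leave a negative half
twist on the lower strands. -/
theorem leftWord_isotopic : TangleIsotopic 0 8 (Front.toDiagram leftWord)
    (births ++ lowerHalfTwist) :=
  tangleIsotopic_of_applyMoves (cs :=
  [(.exchange, 3), (.exchange, 2), (.birth, 1), (.exchange, 4), (.birth, 3), (.exchange, 5),
    (.exchange, 4), (.birth, 3), (.birth, 6), (.exchange, 7), (.birth, 6), (.exchange, 8),
    (.exchange, 7), (.birth, 6), (.exchange, 2), (.exchange, 5), (.exchange, 4), (.exchange, 3)])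
    (by decide +kernel) (by decide +kernel)

/-- The row uses the upper four strands only, so all exchanges are between disjoint crossings. -/
theorem lowerHalfTwist_comm : TangleIsotopic 8 8 (lowerHalfTwist ++ braidRow)
    (braidRow ++ lowerHalfTwist) :=
  tangleIsotopic_of_applyMoves (cs :=
  [(.exchange, 5), (.exchange, 4), (.exchange, 3), (.exchange, 2), (.exchange, 1), (.exchange, 0),
    (.exchange, 6), (.exchange, 5), (.exchange, 4), (.exchange, 3), (.exchange, 2),
    (.exchange, 1), (.exchange, 7), (.exchange, 6), (.exchange, 5), (.exchange, 4),
    (.exchange, 3), (.exchange, 2)]) (by decide +kernel) (by decide +kernel)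

/-- The six crossings of the right end and the six of the half twist are carried around the right
turning points to the upper strands. They form a full twist, which braid relations bring into the
form of four rows. -/
theorem rightWord_isotopic : TangleIsotopic 8 0 (lowerHalfTwist ++ Front.toDiagram rightWord)
    ((List.replicate 4 braidRow).flatten ++ deaths) :=
  tangleIsotopic_of_applyMoves (cs :=
  [(.exchange, 11), (.exchange, 10), (.exchange, 9), (.death, 8), (.exchange, 7), (.death, 8),
    (.exchange, 6), (.exchange, 7), (.death, 8), (.exchange, 12), (.death, 11), (.exchange, 10),
    (.death, 11), (.death, 13), (.exchange, 9), (.exchange, 10), (.exchange, 12), (.exchange, 11),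
    (.exchange, 11), (.exchange, 12), (.death, 13), (.exchange, 14), (.death, 13),
    (.exchange, 12), (.exchange, 11), (.exchange, 10), (.exchange, 9), (.exchange, 8),
    (.exchange, 7), (.exchange, 6), (.exchange, 5), (.exchange, 4), (.exchange, 3),
    (.exchange, 2), (.exchange, 1), (.exchange, 0), (.exchange, 11), (.death, 12),
    (.exchange, 13), (.death, 12), (.exchange, 11), (.exchange, 10), (.exchange, 9),
    (.exchange, 8), (.exchange, 7), (.exchange, 6), (.exchange, 5), (.exchange, 4),
    (.exchange, 3), (.exchange, 2), (.exchange, 1), (.exchange, 11), (.exchange, 12),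
    (.death, 13), (.exchange, 14), (.death, 13), (.exchange, 12), (.exchange, 11),
    (.exchange, 10), (.exchange, 9), (.exchange, 8), (.exchange, 7), (.exchange, 6),
    (.exchange, 5), (.exchange, 4), (.exchange, 3), (.exchange, 2), (.death, 11), (.exchange, 12),
    (.death, 11), (.exchange, 10), (.exchange, 9), (.exchange, 8), (.exchange, 7), (.exchange, 6),
    (.exchange, 5), (.exchange, 4), (.exchange, 3), (.exchange, 11), (.death, 12),
    (.exchange, 13), (.death, 12), (.exchange, 11), (.exchange, 10), (.exchange, 9),
    (.exchange, 8), (.exchange, 7), (.exchange, 6), (.exchange, 5), (.exchange, 4),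
    (.exchange, 11), (.exchange, 12), (.death, 13), (.exchange, 14), (.death, 13),
    (.exchange, 12), (.exchange, 11), (.exchange, 10), (.exchange, 9), (.exchange, 8),
    (.exchange, 7), (.exchange, 6), (.exchange, 5), (.exchange, 11), (.exchange, 12),
    (.death, 13), (.exchange, 14), (.death, 13), (.exchange, 12), (.exchange, 11),
    (.exchange, 10), (.exchange, 9), (.exchange, 8), (.exchange, 7), (.exchange, 6),
    (.exchange, 11), (.death, 12), (.exchange, 13), (.death, 12), (.exchange, 11),
    (.exchange, 10), (.exchange, 9), (.exchange, 8), (.exchange, 7), (.death, 11),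
    (.exchange, 12), (.death, 11), (.exchange, 10), (.exchange, 9), (.exchange, 8),
    (.exchange, 11), (.exchange, 12), (.death, 13), (.exchange, 14), (.death, 13),
    (.exchange, 12), (.exchange, 11), (.exchange, 10), (.exchange, 9), (.exchange, 11),
    (.death, 12), (.exchange, 13), (.death, 12), (.exchange, 11), (.exchange, 10),
    (.exchange, 11), (.exchange, 12), (.death, 13), (.exchange, 14), (.death, 13),
    (.exchange, 12), (.exchange, 11), (.exchange, 2), (.exchange, 8), (.triple, 6), (.triple, 8),
    (.exchange, 7), (.exchange, 10), (.triple, 8), (.triple, 6), (.exchange, 5)])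
    (by decide +kernel) (by decide +kernel)

theorem Front.toDiagram_append (u v : Front) :
    Front.toDiagram (u ++ v) = Front.toDiagram u ++ Front.toDiagram v :=
  List.map_append

theorem strandsAfter_rows (N : ℕ) :
   strandsAfter 8 (List.replicate N braidRow).flatten = some 8 := by
  induction N with
  | zero => rfl
  | succ N ih => exact ih

theorem strandsAfter_twists (N : ℕ) :
    strandsAfter 8 (Front.toDiagram (twists N)) = some 8 := by
  induction N with
  | zero => rfl
  | succ N ih => exact ih

theorem twists_isotopic (N : ℕ) : TangleIsotopic 8 8 (Front.toDiagram (twists N))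
    (List.replicate N braidRow).flatten := by
  induction N with
  | zero => exact Relation.EqvGen.refl _
  | succ N ih =>
    have h1 := twistWord_isotopic.context (u := []) (v := Front.toDiagram (twists N)) rfl
      (strandsAfter_twists N)
    have h2 := ih.context (u := braidRow) (v := []) (s' := 8) (t' := 8) rfl rfl
    rw [List.append_nil, List.append_nil] at h2
    exact h1.trans h2

theorem lowerHalfTwist_comm_rows (N : ℕ) :
    TangleIsotopic 8 8 (lowerHalfTwist ++ (List.replicate N braidRow).flatten)
      ((List.replicate N braidRow).flatten ++ lowerHalfTwist) := by
  induction N with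
  | zero => exact Relation.EqvGen.refl _
  | succ N ih =>
    have h1 := lowerHalfTwist_comm.context (u := []) (v := (List.replicate N braidRow).flatten) rfl
      (strandsAfter_rows N)
    have h2 := ih.context (u := braidRow) (v := []) (s' := 8) (t' := 8) rfl rfl
    simp only [List.nil_append, List.append_nil, List.append_assoc] at h1 h2
    simp only [List.replicate_succ, List.flatten_cons, List.append_assoc]
    exact h1.trans h2

/-- The half twist from the left end slides past the `N` rows and joins the right end, where the two
produce four further rows. -/
theorem isTorusLink_torusFront (N : ℕ) : IsTorusLink (torusFront N) 4 (-((N : ℤ) + 4)) := by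
  have hstd : torusDiagram 4 (-((N : ℤ) + 4)) =
      births ++ ((List.replicate N braidRow).flatten ++
        ((List.replicate 4 braidRow).flatten ++ deaths)) := by
    have h1 : (-((N : ℤ) + 4)).natAbs = N + 4 := by omega
    have h2 : ¬ (0 : ℤ) < -((N : ℤ) + 4) := by omega
    rw [torusDiagram, h1, decide_eq_false h2, List.replicate_add, List.flatten_append,
      List.append_assoc, List.append_assoc]
    rfl
  have hright : strandsAfter 8 (Front.toDiagram rightWord) = some 0 := by decide
  have e1 := leftWord_isotopic.context (u := [])
    (v := Front.toDiagram (twists N) ++ Front.toDiagram rightWord) (s' := 0) (t' := 0) rfl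
    (by rw [strandsAfter_append, strandsAfter_twists]; exact hright)
  have e2 := (twists_isotopic N).context (u := births ++ lowerHalfTwist)
    (v := Front.toDiagram rightWord) (s' := 0) (t' := 0) (by decide) hright
  have e3 := (lowerHalfTwist_comm_rows N).context (u := births)
    (v := Front.toDiagram rightWord) (s' := 0) (t' := 0) (by decide) hright
  have e4 := rightWord_isotopic.context (u := births ++ (List.replicate N braidRow).flatten)
    (v := []) (s' := 0) (t' := 0)
    (by rw [strandsAfter_append, show strandsAfter 0 births = some 8 from by decide]
        exact strandsAfter_rows N) rfl
  simp only [List.nil_append, List.append_nil, List.append_assoc] at e1 e2 e3 e4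
  rw [IsTorusLink, hstd, torusFront, Front.toDiagram_append, Front.toDiagram_append]
  exact e1.trans (e2.trans (e3.trans e4))

/-! ### Legendrian links with a given front -/

theorem strandCount_succ {w : Front} (hw : IsClosedWord w) {i : ℕ} {e : Event Unit}
    (he : w[i]? = some e) : e.pos + e.elem.ins ≤ strandCount w i ∧
      strandCount w (i + 1) = strandCount w i - e.elem.ins + e.elem.outs := by
  have hi : i < w.length := (List.getElem?_eq_some_iff.1 he).1
  have hsplit : strandsAfter 0 (w.take i ++ e :: w.drop (i + 1)) = some 0 := by
    have : w.drop i = e :: w.drop (i + 1) := by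
      rw [List.drop_eq_getElem_cons hi, (List.getElem?_eq_some_iff.1 he).2]
    rw [← this, List.take_append_drop]
    exact hw
  rw [strandsAfter_append] at hsplit
  cases h : strandsAfter 0 (w.take i) with
  | none => simp [h] at hsplit
  | some s =>
    rw [h, Option.bind_some, strandsAfter] at hsplit
    have hs : e.pos + e.elem.ins ≤ s := by
      by_contra hs
      simp [hs] at hsplit
    refine ⟨by simpa [strandCount, h] using hs, ?_⟩
    rw [strandCount, strandCount, List.take_add_one, strandsAfter_append, h, he]
    simp [strandsAfter, hs]

theorem strandCount_zero (w : Front) : strandCount w 0 = 0 := by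
  simp [strandCount, strandsAfter]

theorem strandCount_length {w : Front} (hw : IsClosedWord w) : strandCount w w.length = 0 := by
  rw [strandCount, List.take_length, hw, Option.getD_some]

/-! ### Model strands next to an event. -/

/-- Half of the distance of the two strands concerned by an event, at distance `u` from it. -/
noncomputable def Elem.profile : Elem Unit → ℝ → ℝ
  | .cross _, u => u
  | _, u => 2 / 3 * (u * √u)

/-- The derivative of the profile of an event. -/
noncomputable def Elem.slope : Elem Unit → ℝ → ℝ
  | .cross _, _ => 1
  | _, u => √u

theorem Elem.continuous_profile (e : Elem Unit) : Continuous e.profile := by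
  have h : Continuous fun u : ℝ => 2 / 3 * (u * √u) := by fun_prop
  cases e
  · exact h
  · exact continuous_id
  · exact h

theorem Elem.continuous_slope (e : Elem Unit) : Continuous e.slope := by
  cases e
  · exact Real.continuous_sqrt
  · exact continuous_const
  · exact Real.continuous_sqrt

theorem Elem.contDiffOn_profile (e : Elem Unit) : ContDiffOn ℝ ∞ e.profile (Ioi 0) := by
  have h : ContDiffOn ℝ ∞ (fun u : ℝ => 2 / 3 * (u * √u)) (Ioi 0) :=
    contDiffOn_const.mul (contDiffOn_id.mul (contDiffOn_id.sqrt fun u hu => (ne_of_gt hu)))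
  cases e
  · exact h
  · exact contDiffOn_id
  · exact h

theorem Elem.contDiffOn_slope (e : Elem Unit) : ContDiffOn ℝ ∞ e.slope (Ioi 0) := by
  have h : ContDiffOn ℝ ∞ (fun u : ℝ => √u) (Ioi 0) :=
    contDiffOn_id.sqrt fun u hu => (ne_of_gt hu)
  cases e
  · exact h
  · exact contDiffOn_const
  · exact h

theorem Elem.hasDerivAt_profile (e : Elem Unit) {u : ℝ} (hu : 0 < u) :
    HasDerivAt e.profile (e.slope u) u := by
  have h : HasDerivAt (fun u : ℝ => 2 / 3 * (u * √u)) √u u := by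
    have h1 := ((hasDerivAt_id u).mul ((hasDerivAt_id u).sqrt hu.ne')).const_mul (2 / 3 : ℝ)
    have h2 : √u ≠ 0 := (Real.sqrt_pos.2 hu).ne'
    have h3 : √u * √u = u := Real.mul_self_sqrt hu.le
    have h4 : 2 / 3 * (1 * √u + u * (1 / (2 * √u))) = √u := by
      field_simp
      nlinarith
    rw [id, h4] at h1
    exact h1
  cases e
  · exact h
  · exact hasDerivAt_id u
  · exact h

theorem Elem.profile_zero (e : Elem Unit) : e.profile 0 = 0 := by
  cases e <;> simp [profile]

theorem Elem.profile_pos (e : Elem Unit) {u : ℝ} (hu : 0 < u) : 0 < e.profile u := by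
  have := Real.sqrt_pos.2 hu
  have h : 0 < 2 / 3 * (u * √u) := by positivity
  cases e
  · exact h
  · exact hu
  · exact h

theorem Elem.profile_le_one (e : Elem Unit) {u : ℝ} (hu : 0 ≤ u) (hu1 : u ≤ 1) :
    e.profile u ≤ 1 := by
  have h1 : √u ≤ 1 := Real.sqrt_le_one.2 hu1
  have h2 := Real.sqrt_nonneg u
  cases e <;> simp only [Elem.profile] <;> nlinarith

/-- The height of the strand number `j` next to an event that concerns the `k` strands from number
`p` on, up to the profile of the event. -/
noncomputable def baseHeight (p k j : ℕ) : ℝ :=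
  if j < p then 2 * ((p : ℝ) - j) else if j < p + k then 0 else 2 * ((p : ℝ) - j - 1 + k)

/-- The direction in which the profile of an event displaces the strand number `j`. -/
def strandSign (p k j : ℕ) : ℝ :=
  if j < p then 0 else if j < p + k then (if j = p then 1 else -1) else 0

/-- The strand number `j` has this height at distance `u` from the event. -/
noncomputable def sideHeight (e : Event Unit) (k j : ℕ) (u : ℝ) : ℝ :=
  baseHeight e.pos k j + strandSign e.pos k j * e.elem.profile u

theorem sideHeight_zero (e : Event Unit) (k j : ℕ) :
    sideHeight e k j 0 = baseHeight e.pos k j := by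
  simp [sideHeight, Elem.profile_zero]

/-- The base heights are spaced by at least `2`, except that the concerned strands share the height
`0`. These are moved apart by the profile, which is positive and at most `1`, so the order is never
upset. -/
theorem sideHeight_lt (e : Event Unit) {k : ℕ} (hk : k = 0 ∨ k = 2) {j l : ℕ} (hjl : j < l) {u : ℝ}
    (hu : 0 < u) (hu1 : u ≤ 1) : sideHeight e k l u < sideHeight e k j u := by
  have h1 := e.elem.profile_pos hu
  have h2 := e.elem.profile_le_one hu.le hu1
  have h3 : (j : ℝ) + 1 ≤ l := by exact_mod_cast hjl
  unfold sideHeight baseHeight strandSign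
  have c1 : ∀ m : ℕ, m < e.pos → (m : ℝ) + 1 ≤ e.pos := fun m h => by exact_mod_cast h
  have c2 : ∀ m : ℕ, ¬ m < e.pos + k → (e.pos : ℝ) + k ≤ m := fun m h => by
    exact_mod_cast not_lt.1 h
  have c3 : ∀ m : ℕ, ¬ m < e.pos → (e.pos : ℝ) ≤ m := fun m h => by exact_mod_cast not_lt.1 h
  rcases hk with rfl | rfl <;> split_ifs <;> first | omega | skip
  all_goals
    try have d1 := c1 j (by assumption)
    try have d2 := c1 l (by assumption)
    try have d3 := c2 j (by assumption)
    try have d4 := c2 l (by assumption)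
    push_cast at *
    linarith

theorem baseHeight_eq_iff {p k : ℕ} (hk : k = 0 ∨ k = 2) {j l : ℕ} (hjl : j < l) :
    baseHeight p k j = baseHeight p k l ↔ k = 2 ∧ j = p ∧ l = p + 1 := by
  have h3 : (j : ℝ) + 1 ≤ l := by exact_mod_cast hjl
  unfold baseHeight
  have c1 : ∀ m : ℕ, m < p → (m : ℝ) + 1 ≤ p := fun m h => by exact_mod_cast h
  have c2 : ∀ m : ℕ, ¬ m < p + k → (p : ℝ) + k ≤ m := fun m h => by
    exact_mod_cast not_lt.1 h
  by_cases h : k = 2 ∧ j = p ∧ l = p + 1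
  · obtain ⟨rfl, rfl, rfl⟩ := h
    simp
  · refine iff_of_false (fun hh => ?_) h
    rcases hk with rfl | rfl <;> split_ifs at hh <;> first | omega | skip
    all_goals
      try have d1 := c1 j (by assumption)
      try have d2 := c1 l (by assumption)
      try have d3 := c2 j (by assumption)
      try have d4 := c2 l (by assumption)
      push_cast at *
      linarith

/-! ### Strands between two consecutive events. -/

/-- A smooth transition from `0` on `(-∞, 1 / 3]` to `1` on `[2 / 3, ∞)`. -/
noncomputable def transition (u : ℝ) : ℝ :=
  Real.smoothTransition (3 * u - 1)

theorem contDiff_transition : ContDiff ℝ ∞ transition :=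
  Real.smoothTransition.contDiff.comp ((contDiff_const.mul contDiff_id).sub contDiff_const)

theorem contDiff_deriv_transition : ContDiff ℝ ∞ (deriv transition) :=
  (contDiff_infty_iff_deriv.1 contDiff_transition).2

theorem transition_of_lt {u : ℝ} (hu : u < 1 / 3) : transition u = 0 ∧ deriv transition u = 0 := by
  have h : ∀ v : ℝ, v < 1 / 3 → transition v = 0 := fun v hv =>
    Real.smoothTransition.zero_of_nonpos (by linarith)
  refine ⟨h u hu, ?_⟩
  have h2 : transition =ᶠ[nhds u] fun _ => 0 := by
    filter_upwards [Iio_mem_nhds hu] with v hv using h v hv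
  rw [h2.deriv_eq, deriv_const]

theorem transition_of_gt {u : ℝ} (hu : 2 / 3 < u) : transition u = 1 ∧ deriv transition u = 0 := by
  have h : ∀ v : ℝ, 2 / 3 < v → transition v = 1 := fun v hv =>
    Real.smoothTransition.one_of_one_le (by linarith)
  refine ⟨h u hu, ?_⟩
  have h2 : transition =ᶠ[nhds u] fun _ => 1 := by
    filter_upwards [Ioi_mem_nhds hu] with v hv using h v hv
  rw [h2.deriv_eq, deriv_const]

/-- The height of the strand number `j` between the consecutive events `a` and `b`, at distance `u`
from `a` and `1 - u` from `b`. -/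
noncomputable def midHeight (a b : Event Unit) (j : ℕ) (u : ℝ) : ℝ :=
  sideHeight a a.elem.outs j u +
    transition u * (sideHeight b b.elem.ins j (1 - u) - sideHeight a a.elem.outs j u)

/-- The derivative of `midHeight`. -/
noncomputable def midSlope (a b : Event Unit) (j : ℕ) (u : ℝ) : ℝ :=
  strandSign a.pos a.elem.outs j * a.elem.slope u +
    (deriv transition u * (sideHeight b b.elem.ins j (1 - u) - sideHeight a a.elem.outs j u) +
      transition u * (-(strandSign b.pos b.elem.ins j * b.elem.slope (1 - u)) -
        strandSign a.pos a.elem.outs j * a.elem.slope u))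

theorem continuous_sideHeight (e : Event Unit) (k j : ℕ) : Continuous (sideHeight e k j) :=
  continuous_const.add (continuous_const.mul e.elem.continuous_profile)

theorem contDiffOn_sideHeight (e : Event Unit) (k j : ℕ) :
    ContDiffOn ℝ ∞ (sideHeight e k j) (Ioi 0) :=
  contDiffOn_const.add (contDiffOn_const.mul e.elem.contDiffOn_profile)

theorem hasDerivAt_sideHeight (e : Event Unit) (k j : ℕ) {u : ℝ} (hu : 0 < u) :
    HasDerivAt (sideHeight e k j) (strandSign e.pos k j * e.elem.slope u) u :=
  ((e.elem.hasDerivAt_profile hu).const_mul _).const_add _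

theorem continuous_midHeight (a b : Event Unit) (j : ℕ) : Continuous (midHeight a b j) := by
  have h1 := continuous_sideHeight a a.elem.outs j
  have h2 := (continuous_sideHeight b b.elem.ins j).comp (continuous_const.sub continuous_id :
    Continuous fun u : ℝ => 1 - u)
  exact h1.add (contDiff_transition.continuous.mul (h2.sub h1))

theorem continuous_midSlope (a b : Event Unit) (j : ℕ) : Continuous (midSlope a b j) := by
  have h0 : Continuous fun u : ℝ => 1 - u := continuous_const.sub continuous_id
  have h1 := continuous_sideHeight a a.elem.outs j
  have h2 := (continuous_sideHeight b b.elem.ins j).comp h0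
  have h3 : Continuous fun u => strandSign a.pos a.elem.outs j * a.elem.slope u :=
    continuous_const.mul a.elem.continuous_slope
  have h4 : Continuous fun u => -(strandSign b.pos b.elem.ins j * b.elem.slope (1 - u)) :=
    (continuous_const.mul (b.elem.continuous_slope.comp h0)).neg
  exact h3.add ((contDiff_deriv_transition.continuous.mul (h2.sub h1)).add
    (contDiff_transition.continuous.mul (h4.sub h3)))

theorem contDiffOn_midHeight (a b : Event Unit) (j : ℕ) :
    ContDiffOn ℝ ∞ (midHeight a b j) (Ioo 0 1) := by
  have h1 := (contDiffOn_sideHeight a a.elem.outs j).mono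
    (fun u hu => hu.1 : Ioo (0 : ℝ) 1 ⊆ Ioi 0)
  have h2 := (contDiffOn_sideHeight b b.elem.ins j).comp (s := Ioo 0 1) (f := fun u : ℝ => 1 - u)
    (contDiffOn_const.sub contDiffOn_id) fun u hu => sub_pos.2 hu.2
  exact h1.add (contDiff_transition.contDiffOn.mul (h2.sub h1))

theorem contDiffOn_midSlope (a b : Event Unit) (j : ℕ) :
    ContDiffOn ℝ ∞ (midSlope a b j) (Ioo 0 1) := by
  have h0 : ContDiffOn ℝ ∞ (fun u : ℝ => 1 - u) (Ioo 0 1) := contDiffOn_const.sub contDiffOn_id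
  have h0' : MapsTo (fun u : ℝ => 1 - u) (Ioo 0 1) (Ioi 0) := fun u hu => sub_pos.2 hu.2
  have h1 := (contDiffOn_sideHeight a a.elem.outs j).mono
    (fun u hu => hu.1 : Ioo (0 : ℝ) 1 ⊆ Ioi 0)
  have h2 := (contDiffOn_sideHeight b b.elem.ins j).comp h0 h0'
  have h3 : ContDiffOn ℝ ∞ (fun u => strandSign a.pos a.elem.outs j * a.elem.slope u) (Ioo 0 1) :=
    contDiffOn_const.mul (a.elem.contDiffOn_slope.mono fun u hu => hu.1)
  have h4 : ContDiffOn ℝ ∞ (fun u => -(strandSign b.pos b.elem.ins j * b.elem.slope (1 - u)))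
      (Ioo 0 1) := (contDiffOn_const.mul (b.elem.contDiffOn_slope.comp h0 h0')).neg
  exact h3.add ((contDiff_deriv_transition.contDiffOn.mul (h2.sub h1)).add
    (contDiff_transition.contDiffOn.mul (h4.sub h3)))

theorem hasDerivAt_midHeight (a b : Event Unit) (j : ℕ) {u : ℝ} (hu : u ∈ Ioo (0 : ℝ) 1) :
    HasDerivAt (midHeight a b j) (midSlope a b j u) u := by
  have h1 := hasDerivAt_sideHeight a a.elem.outs j hu.1
  have h2 : HasDerivAt (fun u => sideHeight b b.elem.ins j (1 - u))
      (-(strandSign b.pos b.elem.ins j * b.elem.slope (1 - u))) u := by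
    have := (hasDerivAt_sideHeight b b.elem.ins j (sub_pos.2 hu.2)).comp u
      ((hasDerivAt_id u).const_sub 1)
    rwa [mul_neg_one] at this
  have h3 : HasDerivAt transition (deriv transition u) u :=
    (contDiff_transition.differentiable (by simp) u).hasDerivAt
  exact h1.add (h3.mul (h2.sub h1))

theorem Elem.ins_eq (e : Elem Unit) : e.ins = 0 ∨ e.ins = 2 := by
  cases e <;> simp [Elem.ins]

theorem Elem.outs_eq (e : Elem Unit) : e.outs = 0 ∨ e.outs = 2 := by
  cases e <;> simp [Elem.outs]

/-- A convex combination of two strictly decreasing sequences of heights is strictly decreasing. -/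
theorem midHeight_lt (a b : Event Unit) {j l : ℕ} (hjl : j < l) {u : ℝ} (hu : u ∈ Ioo (0 : ℝ) 1) :
    midHeight a b l u < midHeight a b j u := by
  have h1 := sideHeight_lt a a.elem.outs_eq hjl hu.1 hu.2.le
  have h2 := sideHeight_lt b b.elem.ins_eq hjl (sub_pos.2 hu.2) (by linarith [hu.1])
  have h3 : 0 ≤ transition u := Real.smoothTransition.nonneg _
  have h4 : transition u ≤ 1 := Real.smoothTransition.le_one _
  unfold midHeight
  rcases h3.eq_or_lt with h | h
  · rw [← h]
    linarith
  · nlinarith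

/-- The transition is constant near both ends, so next to an event the strands coincide exactly with
the model. -/
theorem mid_of_lt (a b : Event Unit) (j : ℕ) {u : ℝ} (hu : u < 1 / 3) :
    midSlope a b j u = strandSign a.pos a.elem.outs j * a.elem.slope u ∧
      midHeight a b j u = sideHeight a a.elem.outs j u := by
  obtain ⟨h1, h2⟩ := transition_of_lt hu
  simp [midSlope, midHeight, h1, h2]

theorem mid_of_gt (a b : Event Unit) (j : ℕ) {u : ℝ} (hu : 2 / 3 < u) :
    midSlope a b j u = -(strandSign b.pos b.elem.ins j * b.elem.slope (1 - u)) ∧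
      midHeight a b j u = sideHeight b b.elem.ins j (1 - u) := by
  obtain ⟨h1, h2⟩ := transition_of_gt hu
  simp [midSlope, midHeight, h1, h2]

/-- The event number `i` of a front. -/
def Front.event (w : Front) (i : ℕ) : Event Unit :=
  w.getD i (lc 0)

/-- The strand number `j` between the abscissas `i` and `i + 1`: slope and height as functions of
the abscissa. -/
noncomputable def frontStrand (w : Front) (i j : ℕ) (x : ℝ) : ℝ × ℝ :=
  -- For `i = 0` and `i = w.length` one of the two events is meaningless (truncated subtraction,
  -- default value), but a closed word has no strands there.
  (midSlope (w.event (i - 1)) (w.event i) j (x - i),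
    midHeight (w.event (i - 1)) (w.event i) j (x - i))

theorem continuous_frontStrand (w : Front) (i j : ℕ) : Continuous (frontStrand w i j) :=
  ((continuous_midSlope _ _ j).comp (continuous_id.sub continuous_const)).prodMk
    ((continuous_midHeight _ _ j).comp (continuous_id.sub continuous_const))

theorem frontStrand_lt (w : Front) (i : ℕ) {j l : ℕ} (hjl : j < l) {x : ℝ}
    (hx : x ∈ Ioo (i : ℝ) (i + 1)) : (frontStrand w i l x).2 < (frontStrand w i j x).2 :=
  midHeight_lt _ _ hjl ⟨by linarith [hx.1], by linarith [hx.2]⟩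

/-- The factor `-1`, and `1` in `frontStrand_right`, is kept so that both sides are instances of
`exists_strand_iff`, with `ε = -1` and `ε = 1`. -/
theorem frontStrand_left {w : Front} {i : ℕ} {e : Event Unit} (he : w[i]? = some e) (j : ℕ)
    {x : ℝ} (hx : (i : ℝ) + 2 / 3 < x) : frontStrand w i j x =
      (-1 * (strandSign e.pos e.elem.ins j * e.elem.slope (i + 1 - x)),
        sideHeight e e.elem.ins j (i + 1 - x)) := by
  have h : w.event i = e := by simp [Front.event, he]
  obtain ⟨h1, h2⟩ := mid_of_gt (w.event (i - 1)) (w.event i) j (u := x - i) (by linarith)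
  rw [frontStrand, h1, h2, h, show (1 : ℝ) - (x - i) = i + 1 - x by ring, neg_one_mul]

theorem frontStrand_right {w : Front} {i : ℕ} {e : Event Unit} (he : w[i]? = some e) (j : ℕ)
    {x : ℝ} (hx : x < (i : ℝ) + 1 + 1 / 3) : frontStrand w (i + 1) j x =
      (1 * (strandSign e.pos e.elem.outs j * e.elem.slope (x - (i + 1))),
        sideHeight e e.elem.outs j (x - (i + 1))) := by
  have h : w.event i = e := by simp [Front.event, he]
  obtain ⟨h1, h2⟩ := mid_of_lt (w.event i) (w.event (i + 1)) j (u := x - (i + 1)) (by linarith)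
  rw [frontStrand, Nat.add_sub_cancel, Nat.cast_succ, h1, h2, h, one_mul]

/-- The union of the lifted strands of a front. -/
def frontLift (w : Front) : Set (ℝ × ℝ × ℝ) :=
  {p | ∃ i ≤ w.length, ∃ j < strandCount w i,
    p.1 ∈ Icc (i : ℝ) (i + 1) ∧ p.2 = frontStrand w i j p.1}

theorem isCompact_frontLift (w : Front) : IsCompact (frontLift w) := by
  have h : frontLift w = ⋃ i ∈ Finset.range (w.length + 1), ⋃ j ∈ Finset.range (strandCount w i),
      (fun x => (x, frontStrand w i j x)) '' Icc (i : ℝ) (i + 1) := by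
    ext ⟨x, q⟩
    simp only [frontLift, mem_ofPred_eq, mem_iUnion, mem_image, Prod.mk.injEq, Finset.mem_range,
      Nat.lt_succ_iff, exists_prop]
    constructor
    · rintro ⟨i, hi, j, hj, hx, rfl⟩
      exact ⟨i, hi, j, hj, x, hx, rfl, rfl⟩
    · rintro ⟨i, hi, j, hj, y, hy, rfl, rfl⟩
      exact ⟨i, hi, j, hj, hy, rfl⟩
  rw [h]
  exact (Finset.range _).isCompact_biUnion fun i _ => (Finset.range _).isCompact_biUnion fun j _ =>
    isCompact_Icc.image (continuous_id.prodMk (continuous_frontStrand w i j))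

theorem mem_frontLift_of_mem_Ioo {w : Front} {i : ℕ} (hi : i ≤ w.length) {p : ℝ × ℝ × ℝ}
    (hp : p.1 ∈ Ioo (i : ℝ) (i + 1)) :
    p ∈ frontLift w ↔ ∃ j < strandCount w i, p.2 = frontStrand w i j p.1 := by
  constructor
  · rintro ⟨m, -, j, hj, hx, h⟩
    have h1 : (m : ℝ) < (i + 1 : ℕ) := by push_cast; linarith [hx.1, hp.2]
    have h2 : (i : ℝ) < (m + 1 : ℕ) := by push_cast; linarith [hx.2, hp.1]
    obtain rfl : m = i := by
      have h1 := Nat.cast_lt.1 h1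
      have h2 := Nat.cast_lt.1 h2
      omega
    exact ⟨j, hj, h⟩
  · rintro ⟨j, hj, h⟩
    exact ⟨i, hi, j, hj, Ioo_subset_Icc_self hp, h⟩

/-! ### The lifted link near an event. -/

theorem mem_frontLift_near {w : Front} {i : ℕ} (hi : i < w.length) {p : ℝ × ℝ × ℝ}
    (hp : |p.1 - (i + 1)| < 1 / 4) : p ∈ frontLift w ↔
      (p.1 ≤ i + 1 ∧ ∃ j < strandCount w i, p.2 = frontStrand w i j p.1) ∨
      ((i : ℝ) + 1 ≤ p.1 ∧ ∃ j < strandCount w (i + 1), p.2 = frontStrand w (i + 1) j p.1) := by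
  obtain ⟨hp1, hp2⟩ := abs_lt.1 hp
  constructor
  · rintro ⟨m, -, j, hj, hx, h⟩
    have h1 : (m : ℝ) < (i + 2 : ℕ) := by push_cast; linarith [hx.1]
    have h2 : (i : ℝ) < (m + 1 : ℕ) := by push_cast; linarith [hx.2]
    have h1 := Nat.cast_lt.1 h1
    have h2 := Nat.cast_lt.1 h2
    obtain rfl | rfl : m = i ∨ m = i + 1 := by omega
    · exact Or.inl ⟨hx.2, j, hj, h⟩
    · exact Or.inr ⟨by simpa using hx.1, j, hj, h⟩
  · rintro (⟨hx, j, hj, h⟩ | ⟨hx, j, hj, h⟩)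
    · exact ⟨i, hi.le, j, hj, ⟨by linarith, hx⟩, h⟩
    · exact ⟨i + 1, hi, j, hj, ⟨by simpa using hx, by push_cast; linarith⟩, h⟩

/-- The heights of the strands that pass an event, `p` of them above it and `r` of them in total. -/
def PassingHeight (p r : ℕ) (h : ℝ) : Prop :=
  (∃ j < p, h = 2 * ((p : ℝ) - j)) ∨ ∃ j, p ≤ j ∧ j < r ∧ h = 2 * ((p : ℝ) - j - 1)

/-- Passing heights are even integers. -/
theorem PassingHeight.eq_of_abs_lt {p r : ℕ} {h h' : ℝ} (hh : PassingHeight p r h)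
    (hh' : PassingHeight p r h') (hd : |h' - h| < 1) : h' = h := by
  have key : ∀ {h : ℝ}, PassingHeight p r h → ∃ a : ℤ, h = 2 * a := by
    rintro h (⟨j, -, rfl⟩ | ⟨j, -, -, rfl⟩)
    · exact ⟨p - j, by push_cast; ring⟩
    · exact ⟨p - j - 1, by push_cast; ring⟩
  obtain ⟨a, rfl⟩ := key hh
  obtain ⟨b, rfl⟩ := key hh'
  obtain ⟨h1, h2⟩ := abs_lt.1 hd
  have h3 : (b : ℝ) < (a + 1 : ℤ) := by push_cast; linarith
  have h4 : (a : ℝ) < (b + 1 : ℤ) := by push_cast; linarith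
  have h3 := Int.cast_lt.1 h3
  have h4 := Int.cast_lt.1 h4
  rw [show b = a by omega]

theorem PassingHeight.two_le_abs {p r : ℕ} {h : ℝ} (hh : PassingHeight p r h) : 2 ≤ |h| := by
  rcases hh with ⟨j, hj, rfl⟩ | ⟨j, hj, -, rfl⟩
  · have : (j : ℝ) + 1 ≤ p := by exact_mod_cast hj
    exact le_trans (by linarith) (le_abs_self _)
  · have : (p : ℝ) ≤ j := by exact_mod_cast hj
    exact le_trans (by linarith) (neg_le_abs _)

/-- The points `(d, y, z)` of the two strands concerned by an event, at the signed distance `d` of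
the abscissas. -/
def Elem.Concerned : Elem Unit → ℝ → ℝ → ℝ → Prop
  | .birth, d, y, z => d = y ^ 2 ∧ z = 2 / 3 * y ^ 3
  | .cross _, d, y, z => (y = 1 ∨ y = -1) ∧ z = y * d
  | .death, d, y, z => d = -y ^ 2 ∧ z = -(2 / 3 * y ^ 3)

/-- Strands below the event are renumbered by the shift `k`, so that passing strands get the same
description on both sides. The sign `ε` is the derivative of the distance `u` with respect to the
abscissa. -/
theorem exists_strand_iff (e : Event Unit) {k s : ℕ} (hk : k = 0 ∨ k = 2) (hs : e.pos + k ≤ s)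
    (ε u : ℝ) (q : ℝ × ℝ) :
    (∃ j < s, q = (ε * (strandSign e.pos k j * e.elem.slope u), sideHeight e k j u)) ↔
      (q.1 = 0 ∧ PassingHeight e.pos (s - k) q.2) ∨
      (k = 2 ∧ (q = (ε * e.elem.slope u, e.elem.profile u) ∨
        q = (-(ε * e.elem.slope u), -e.elem.profile u))) := by
  constructor
  · rintro ⟨j, hj, rfl⟩
    unfold sideHeight baseHeight strandSign
    by_cases h1 : j < e.pos
    · exact Or.inl ⟨by simp [h1], Or.inl ⟨j, h1, by simp [h1]⟩⟩
    by_cases h2 : j < e.pos + k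
    · have hk : k = 2 := by omega
      subst hk
      by_cases h3 : j = e.pos
      · exact Or.inr ⟨rfl, Or.inl (by simp [h3])⟩
      · exact Or.inr ⟨rfl, Or.inr (by simp [h1, h2, h3])⟩
    · refine Or.inl ⟨by simp [h1, h2], Or.inr ⟨j - k, by omega, by omega, ?_⟩⟩
      rw [Nat.cast_sub (by omega)]
      simp [h1, h2]
      ring
  · obtain ⟨y, z⟩ := q
    rintro (⟨h0, ⟨j, hj, h⟩ | ⟨j, hj, hjs, h⟩⟩ | ⟨rfl, h | h⟩)
    · simp only at h0 h
      subst h0 h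
      exact ⟨j, by omega, by simp [sideHeight, baseHeight, strandSign, hj]⟩
    · simp only at h0 h
      subst h0 h
      refine ⟨j + k, by omega, ?_⟩
      have h1 : ¬ j + k < e.pos := by omega
      have h2 : ¬ j + k < e.pos + k := by omega
      simp [sideHeight, baseHeight, strandSign, h1, h2]
      ring
    · exact ⟨e.pos, by omega, by rw [h]; simp [sideHeight, baseHeight, strandSign]⟩
    · exact ⟨e.pos + 1, by omega, by rw [h]; simp [sideHeight, baseHeight, strandSign]⟩

/-- Glues the half-strands on the two sides: square roots become the semicubical parabola with
smooth parameter `y`, and at a crossing the halves become two straight lines of slopes `1` and `-1`.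
-/
theorem Elem.concerned_iff (e : Elem Unit) (d : ℝ) (q : ℝ × ℝ) :
    ((d ≤ 0 ∧ e.ins = 2 ∧ (q = (-1 * e.slope (-d), e.profile (-d)) ∨
        q = (-(-1 * e.slope (-d)), -e.profile (-d)))) ∨
      (0 ≤ d ∧ e.outs = 2 ∧ (q = (1 * e.slope d, e.profile d) ∨
        q = (-(1 * e.slope d), -e.profile d)))) ↔ e.Concerned d q.1 q.2 := by
  obtain ⟨y, z⟩ := q
  have cusp : ∀ d y : ℝ, (0 ≤ d ∧ ((y = √d ∧ z = 2 / 3 * (d * √d)) ∨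
      (y = -√d ∧ z = -(2 / 3 * (d * √d))))) ↔ d = y ^ 2 ∧ z = 2 / 3 * y ^ 3 := by
    intro d y
    constructor
    · rintro ⟨hd, ⟨rfl, rfl⟩ | ⟨rfl, rfl⟩⟩
      · have := Real.sq_sqrt hd
        exact ⟨this.symm, by rw [pow_succ, this]⟩
      · have := Real.sq_sqrt hd
        exact ⟨by rw [neg_sq, this], by rw [pow_succ, neg_sq, this]; ring⟩
    · rintro ⟨rfl, rfl⟩
      refine ⟨sq_nonneg y, ?_⟩
      rw [Real.sqrt_sq_eq_abs]
      rcases abs_choice y with h | h <;> rw [h]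
      · exact Or.inl ⟨rfl, by ring⟩
      · exact Or.inr ⟨by ring, by ring⟩
  cases e with
  | birth =>
    simpa [Elem.ins, Elem.outs, Elem.slope, Elem.profile, Elem.Concerned] using cusp d y
  | cross a =>
    simp only [Elem.ins, Elem.outs, Elem.slope, Elem.profile, Elem.Concerned, Prod.mk.injEq,
      true_and]
    constructor
    · rintro (⟨-, ⟨rfl, rfl⟩ | ⟨rfl, rfl⟩⟩ | ⟨-, ⟨rfl, rfl⟩ | ⟨rfl, rfl⟩⟩) <;> norm_num
    · rintro ⟨rfl | rfl, rfl⟩ <;> rcases le_total d 0 with h | h <;> simp [h]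
  | death =>
    have h := cusp (-d) (-y)
    rw [neg_sq, show 2 / 3 * (-y) ^ 3 = -(2 / 3 * y ^ 3) by ring, neg_eq_iff_eq_neg, neg_nonneg,
      neg_inj, neg_eq_iff_eq_neg] at h
    simpa [Elem.ins, Elem.outs, Elem.slope, Elem.profile, Elem.Concerned] using h

theorem mem_frontLift_near_iff {w : Front} (hw : IsClosedWord w) {i : ℕ} {e : Event Unit}
    (he : w[i]? = some e) {p : ℝ × ℝ × ℝ} (hp : |p.1 - (i + 1)| < 1 / 4) : p ∈ frontLift w ↔
      (p.2.1 = 0 ∧ PassingHeight e.pos (strandCount w i - e.elem.ins) p.2.2) ∨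
      e.elem.Concerned (p.1 - (i + 1)) p.2.1 p.2.2 := by
  obtain ⟨hs, hs'⟩ := strandCount_succ hw he
  obtain ⟨hp1, hp2⟩ := abs_lt.1 hp
  have hl := exists_strand_iff e e.elem.ins_eq hs (-1) (i + 1 - p.1) p.2
  have ht : strandCount w (i + 1) - e.elem.outs = strandCount w i - e.elem.ins := by omega
  have ht' : e.pos + e.elem.outs ≤ strandCount w (i + 1) := by omega
  have hx : (i : ℝ) + 2 / 3 < p.1 := by linarith
  have hx' : p.1 < (i : ℝ) + 1 + 1 / 3 := by linarith
  have hr := exists_strand_iff e e.elem.outs_eq ht' 1 (p.1 - (i + 1)) p.2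
  rw [ht] at hr
  simp only [← frontStrand_left he _ hx] at hl
  simp only [← frontStrand_right he _ hx'] at hr
  have hc := e.elem.concerned_iff (p.1 - (i + 1)) p.2
  rw [neg_sub, sub_nonneg, sub_nonpos] at hc
  rw [mem_frontLift_near (List.getElem?_eq_some_iff.1 he).1 hp, ← hc, hl, hr,
    and_or_left (a := p.1 ≤ _), and_or_left (a := (i : ℝ) + 1 ≤ _), or_or_or_comm, ← or_and_right,
    and_iff_right (le_total _ _)]

/-! ### Legendrian charts of the lifted link. -/

/-- A differentiable left inverse defined on all of space gives immersion by the chain rule and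
embedding by continuity. -/
theorem isLegendrianArc_of_leftInverse {X Y Z X' : ℝ → ℝ} {φ : ℝ × ℝ × ℝ → ℝ}
    (hX : ContDiffOn ℝ ∞ X (Ioo (-1) 1)) (hY : ContDiffOn ℝ ∞ Y (Ioo (-1) 1))
    (hZ : ContDiffOn ℝ ∞ Z (Ioo (-1) 1))
    (hX' : ∀ s ∈ Ioo (-1 : ℝ) 1, HasDerivAt X (X' s) s)
    (hZ' : ∀ s ∈ Ioo (-1 : ℝ) 1, HasDerivAt Z (Y s * X' s) s)
    (hφ : Differentiable ℝ φ) (hinv : ∀ s ∈ Ioo (-1 : ℝ) 1, φ (X s, Y s, Z s) = s) :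
    IsLegendrianArc fun s => (X s, Y s, Z s) := by
  have hsm : ContDiffOn ℝ ∞ (fun s => (X s, Y s, Z s)) (Ioo (-1) 1) :=
    hX.prodMk (hY.prodMk hZ)
  have hd : ∀ s ∈ Ioo (-1 : ℝ) 1,
      HasDerivAt (fun s => (X s, Y s, Z s)) (X' s, deriv Y s, Y s * X' s) s := fun s hs =>
    (hX' s hs).prodMk ((((hY.differentiableOn (by simp)) s hs).differentiableAt
      (isOpen_Ioo.mem_nhds hs)).hasDerivAt.prodMk (hZ' s hs))
  refine ⟨hsm, fun s hs h0 => ?_, ?_, fun s hs => by rw [(hd s hs).deriv]⟩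
  · have h1 : HasDerivAt (fun s => φ (X s, Y s, Z s))
        (fderiv ℝ φ (X s, Y s, Z s) (X' s, deriv Y s, Y s * X' s)) s :=
      ((hφ _).hasFDerivAt).comp_hasDerivAt s (hd s hs)
    rw [← (hd s hs).deriv, h0, map_zero] at h1
    have h2 : (fun s => φ (X s, Y s, Z s)) =ᶠ[nhds s] id := by
      filter_upwards [isOpen_Ioo.mem_nhds hs] with v hv using hinv v hv
    exact one_ne_zero (((hasDerivAt_id s).congr_of_eventuallyEq h2).unique h1)
  · have h1 : Continuous ((Ioo (-1 : ℝ) 1).domRestrict fun s => (X s, Y s, Z s)) :=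
      continuousOn_iff_continuous_domRestrict.1 hsm.continuousOn
    refine Topology.IsEmbedding.of_comp h1 hφ.continuous ?_
    convert Topology.IsEmbedding.subtypeVal (p := (· ∈ Ioo (-1 : ℝ) 1)) using 1
    funext s
    exact hinv s s.2

/-- Near `p`, the set `K` is a Legendrian arc. -/
def HasLegendrianChart (K : Set (ℝ × ℝ × ℝ)) (p : ℝ × ℝ × ℝ) : Prop :=
  ∃ U : Set (ℝ × ℝ × ℝ), IsOpen U ∧ p ∈ U ∧
    ∃ c : ℝ → ℝ × ℝ × ℝ, IsLegendrianArc c ∧ c '' Ioo (-1) 1 = K ∩ U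

theorem hasLegendrianChart_of_mem_Ioo {w : Front} {p : ℝ × ℝ × ℝ} {i j : ℕ} (hi : i ≤ w.length)
    (hj : j < strandCount w i) (hx : p.1 ∈ Ioo (i : ℝ) (i + 1)) (hp : p.2 = frontStrand w i j p.1) :
    HasLegendrianChart (frontLift w) p := by
  have hc : ∀ l, Continuous fun q : ℝ × ℝ × ℝ => (frontStrand w i l q.1).2 := fun l =>
    ((continuous_frontStrand w i l).comp continuous_fst).snd
  have hz : Continuous fun q : ℝ × ℝ × ℝ => q.2.2 := continuous_snd.snd
  have hne : ∀ l ≠ j, ∀ x ∈ Ioo (i : ℝ) (i + 1),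
      (frontStrand w i j x).2 ≠ (frontStrand w i l x).2 := by
    intro l hl x hx
    rcases hl.lt_or_gt with h | h
    · exact (frontStrand_lt w i h hx).ne
    · exact (frontStrand_lt w i h hx).ne'
  -- The neighbourhood consists of the points that are closer in height to the strand `j` than to
  -- any other strand over the same abscissa.
  refine ⟨{q | q.1 ∈ Ioo (i : ℝ) (i + 1)} ∩ ⋂ l ∈ (Finset.range (strandCount w i)).erase j,
      {q | |q.2.2 - (frontStrand w i j q.1).2| < |q.2.2 - (frontStrand w i l q.1).2|},
    (isOpen_Ioo.preimage continuous_fst).inter (isOpen_biInter_finset fun l _ =>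
      isOpen_lt (hz.sub (hc j)).abs (hz.sub (hc l)).abs), ⟨hx, ?_⟩,
    fun s => ((i : ℝ) + (1 + s) / 2, frontStrand w i j (i + (1 + s) / 2)), ?_, ?_⟩
  · simp only [mem_iInter, mem_ofPred_eq]
    intro l hl
    rw [hp, sub_self, abs_zero]
    exact abs_pos.2 (sub_ne_zero.2 (hne l (Finset.ne_of_mem_erase hl) _ hx))
  · have h0 : ContDiffOn ℝ ∞ (fun s : ℝ => (1 + s) / 2) (Ioo (-1) 1) := by fun_prop
    have hm : MapsTo (fun s : ℝ => (1 + s) / 2) (Ioo (-1) 1) (Ioo 0 1) := fun s hs =>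
      ⟨by linarith [hs.1], by linarith [hs.2]⟩
    have hd : ∀ s : ℝ, HasDerivAt (fun s : ℝ => (1 + s) / 2) (1 / 2) s := fun s =>
      ((hasDerivAt_id s).const_add 1).div_const 2
    simp only [frontStrand, add_sub_cancel_left]
    refine isLegendrianArc_of_leftInverse (X' := fun _ => 1 / 2)
      (φ := fun q => 2 * (q.1 - i) - 1) (by fun_prop)
      ((contDiffOn_midSlope _ _ j).comp h0 hm) ((contDiffOn_midHeight _ _ j).comp h0 hm)
      (fun s _ => (hd s).const_add _) (fun s hs => ?_) (by fun_prop) (fun s _ => by ring)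
    exact (hasDerivAt_midHeight _ _ j (hm hs)).comp s (hd s)
  · ext ⟨x, q⟩
    simp only [mem_image, mem_inter_iff, mem_iInter, mem_ofPred_eq]
    constructor
    · rintro ⟨s, hs, h⟩
      obtain ⟨rfl, rfl⟩ := Prod.mk.inj h
      have hx : (i : ℝ) + (1 + s) / 2 ∈ Ioo (i : ℝ) (i + 1) :=
        ⟨by linarith [hs.1], by linarith [hs.2]⟩
      refine ⟨(mem_frontLift_of_mem_Ioo hi hx).2 ⟨j, hj, rfl⟩, hx, fun l hl => ?_⟩
      rw [sub_self, abs_zero]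
      exact abs_pos.2 (sub_ne_zero.2 (hne l (Finset.ne_of_mem_erase hl) _ hx))
    · rintro ⟨hK, hx, hU⟩
      obtain ⟨l, hl, h⟩ := (mem_frontLift_of_mem_Ioo hi hx).1 hK
      simp only at h
      obtain rfl : l = j := by
        by_contra hlj
        have := hU l (Finset.mem_erase.2 ⟨hlj, Finset.mem_range.2 hl⟩)
        rw [h, sub_self, abs_zero] at this
        exact absurd this (not_lt.2 (abs_nonneg _))
      have hx2 : (i : ℝ) + (1 + (2 * (x - i) - 1)) / 2 = x := by ring
      refine ⟨2 * (x - i) - 1, ⟨by linarith [hx.1], by linarith [hx.2]⟩, ?_⟩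
      rw [hx2, h]

/-- Separates the concerned strands from the passing ones, whose heights have absolute value at
least `2`. -/
theorem Elem.Concerned.abs_lt_one {e : Elem Unit} {d y z : ℝ} (h : e.Concerned d y z)
    (hd : |d| < 1 / 4) : |z| < 1 := by
  have cusp : y ^ 2 < 1 / 4 → |2 / 3 * y ^ 3| < 1 := fun hy => by
    have h1 : |y| < 1 / 2 := abs_lt_of_sq_lt_sq (by linarith) (by norm_num)
    have h2 := abs_nonneg y
    rw [abs_mul, abs_pow, abs_of_pos (by norm_num : (0 : ℝ) < 2 / 3), pow_succ, sq_abs]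
    nlinarith [sq_nonneg y]
  cases e with
  | birth =>
    obtain ⟨rfl, rfl⟩ := h
    exact cusp ((le_abs_self _).trans_lt hd)
  | cross a =>
    obtain ⟨rfl | rfl, rfl⟩ := h
    · rw [one_mul]
      linarith
    · rw [neg_one_mul, abs_neg]
      linarith
  | death =>
    obtain ⟨rfl, rfl⟩ := h
    rw [abs_neg] at hd ⊢
    exact cusp ((le_abs_self _).trans_lt hd)

theorem isOpen_near (c h : ℝ) :
    IsOpen {q : ℝ × ℝ × ℝ | |q.1 - c| < 1 / 4 ∧ |q.2.2 - h| < 1} :=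
  IsOpen.and (isOpen_lt (by fun_prop) (by fun_prop)) (isOpen_lt (by fun_prop) (by fun_prop))

theorem abs_quarter_lt {s : ℝ} : |s / 4| < 1 / 4 ↔ s ∈ Ioo (-1 : ℝ) 1 := by
  rw [abs_lt, mem_Ioo]
  constructor <;> rintro ⟨h1, h2⟩ <;> constructor <;> linarith

theorem abs_sq_half_lt {s : ℝ} : |(s / 2) ^ 2| < 1 / 4 ↔ s ∈ Ioo (-1 : ℝ) 1 := by
  rw [abs_of_nonneg (sq_nonneg _), mem_Ioo, ← abs_lt, ← sq_lt_one_iff_abs_lt_one]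
  constructor <;> intro h <;> linarith

theorem hasLegendrianChart_of_passing {w : Front} (hw : IsClosedWord w) {i : ℕ} {e : Event Unit}
    (he : w[i]? = some e) {p : ℝ × ℝ × ℝ} (hx : p.1 = i + 1)
    (hz : PassingHeight e.pos (strandCount w i - e.elem.ins) p.2.2) :
    HasLegendrianChart (frontLift w) p := by
  refine ⟨_, isOpen_near (i + 1) p.2.2, by simp [hx], fun s => ((i : ℝ) + 1 + s / 4, 0, p.2.2),
    isLegendrianArc_of_leftInverse (X' := fun _ => 1 / 4) (φ := fun q => 4 * (q.1 - (i + 1)))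
      (by fun_prop) (by fun_prop) (by fun_prop)
      (fun s _ => ((hasDerivAt_id s).div_const 4).const_add _)
      (fun s _ => by simpa using hasDerivAt_const s p.2.2) (by fun_prop) (fun s _ => by ring), ?_⟩
  ext ⟨x, y, z⟩
  simp only [mem_image, mem_inter_iff, mem_ofPred_eq]
  constructor
  · rintro ⟨s, hs, h⟩
    simp only [Prod.mk.injEq] at h
    obtain ⟨rfl, rfl, rfl⟩ := h
    have hd : |(i : ℝ) + 1 + s / 4 - (i + 1)| < 1 / 4 := by
      rw [add_sub_cancel_left]
      exact abs_quarter_lt.2 hs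
    exact ⟨(mem_frontLift_near_iff hw he hd).2 (Or.inl ⟨rfl, hz⟩), hd, by simp⟩
  · rintro ⟨hK, hd, hh⟩
    rcases (mem_frontLift_near_iff hw he hd).1 hK with ⟨h0, h1⟩ | h1
    · refine ⟨4 * (x - (i + 1)), abs_quarter_lt.1 (by convert hd using 2; ring), ?_⟩
      simp only at h0 h1
      rw [h0, hz.eq_of_abs_lt h1 hh]
      simp only [Prod.mk.injEq, and_true]
      ring
    · have h2 := h1.abs_lt_one hd
      have h3 := hz.two_le_abs
      have h4 := abs_sub_abs_le_abs_sub p.2.2 z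
      rw [abs_sub_comm] at h4
      simp only at h2 hh
      linarith

/-- The common part for cusps and crossings. The open set `V` is there to select one of the two
branches at a crossing. -/
theorem hasLegendrianChart_of_concerned {w : Front} (hw : IsClosedWord w) {i : ℕ} {e : Event Unit}
    (he : w[i]? = some e) {p : ℝ × ℝ × ℝ} (hx : p.1 = i + 1)
    (hp : e.elem.Concerned 0 p.2.1 p.2.2) {V : Set (ℝ × ℝ × ℝ)} (hV : IsOpen V) (hpV : p ∈ V)
    {X Y Z : ℝ → ℝ} (hc : IsLegendrianArc fun s => (i + 1 + X s, Y s, Z s))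
    (hmaps : ∀ s ∈ Ioo (-1 : ℝ) 1, |X s| < 1 / 4 ∧ e.elem.Concerned (X s) (Y s) (Z s) ∧
      ((i : ℝ) + 1 + X s, Y s, Z s) ∈ V)
    (hsurj : ∀ d y z, |d| < 1 / 4 → e.elem.Concerned d y z → ((i : ℝ) + 1 + d, y, z) ∈ V →
      ∃ s ∈ Ioo (-1 : ℝ) 1, X s = d ∧ Y s = y ∧ Z s = z) :
    HasLegendrianChart (frontLift w) p := by
  refine ⟨_, (isOpen_near (i + 1) 0).inter hV, ⟨⟨by simp [hx], ?_⟩, hpV⟩, _, hc, ?_⟩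
  · rw [sub_zero]
    exact hp.abs_lt_one (by simp)
  ext ⟨x, y, z⟩
  simp only [mem_image, mem_inter_iff, mem_ofPred_eq, sub_zero]
  constructor
  · rintro ⟨s, hs, h⟩
    simp only [Prod.mk.injEq] at h
    obtain ⟨rfl, rfl, rfl⟩ := h
    obtain ⟨h1, h2, h3⟩ := hmaps s hs
    have hd : |(i : ℝ) + 1 + X s - (i + 1)| < 1 / 4 := by rwa [add_sub_cancel_left]
    refine ⟨(mem_frontLift_near_iff hw he hd).2 (Or.inr ?_), ⟨hd, h2.abs_lt_one h1⟩, h3⟩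
    rwa [add_sub_cancel_left]
  · rintro ⟨hK, ⟨hd, hh⟩, hV⟩
    rcases (mem_frontLift_near_iff hw he hd).1 hK with ⟨-, h1⟩ | h1
    · have h2 : 2 ≤ |z| := h1.two_le_abs
      linarith
    · obtain ⟨s, hs, hX, rfl, rfl⟩ := hsurj (x - (i + 1)) y z hd h1 (by rwa [add_sub_cancel])
      exact ⟨s, hs, by rw [hX, add_sub_cancel]⟩

theorem hasDerivAt_cusp (s : ℝ) : HasDerivAt (fun s : ℝ => (s / 2) ^ 2) (s / 2) s ∧
    HasDerivAt (fun s : ℝ => 2 / 3 * (s / 2) ^ 3) (s / 2 * (s / 2)) s := by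
  have h : HasDerivAt (fun s : ℝ => s / 2) (1 / 2) s := (hasDerivAt_id s).div_const 2
  exact ⟨(h.fun_pow 2).congr_deriv (by norm_num; ring),
    ((h.fun_pow 3).const_mul (2 / 3)).congr_deriv (by norm_num; ring)⟩

theorem hasLegendrianChart_of_event {w : Front} (hw : IsClosedWord w) {i : ℕ} (hi : i < w.length)
    {p : ℝ × ℝ × ℝ} (hp : p ∈ frontLift w) (hx : p.1 = i + 1) :
    HasLegendrianChart (frontLift w) p := by
  obtain ⟨e, he⟩ : ∃ e, w[i]? = some e := ⟨_, List.getElem?_eq_getElem hi⟩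
  rcases (mem_frontLift_near_iff hw he (by simp [hx])).1 hp with ⟨-, hz⟩ | h
  · exact hasLegendrianChart_of_passing hw he hx hz
  rw [hx, sub_self] at h
  have key := @hasLegendrianChart_of_concerned w hw i e he p hx h
  obtain ⟨el, k⟩ := e
  cases el with
  | birth =>
    refine key isOpen_univ (mem_univ _) (X := fun s => (s / 2) ^ 2) (Y := fun s => s / 2)
      (Z := fun s => 2 / 3 * (s / 2) ^ 3)
      (isLegendrianArc_of_leftInverse (X' := fun s => s / 2) (φ := fun q => 2 * q.2.1)
        (by fun_prop) (by fun_prop) (by fun_prop) (fun s _ => (hasDerivAt_cusp s).1.const_add _)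
        (fun s _ => (hasDerivAt_cusp s).2) (by fun_prop) (fun s _ => by ring))
      (fun s hs => ⟨abs_sq_half_lt.2 hs, ⟨rfl, rfl⟩, mem_univ _⟩) ?_
    rintro d y z hd ⟨rfl, rfl⟩ -
    have h2 : 2 * y / 2 = y := by ring
    exact ⟨2 * y, abs_sq_half_lt.1 (by rwa [h2]), by rw [h2], h2, by rw [h2]⟩
  | death =>
    refine key isOpen_univ (mem_univ _) (X := fun s => -(s / 2) ^ 2) (Y := fun s => s / 2)
      (Z := fun s => -(2 / 3 * (s / 2) ^ 3))
      (isLegendrianArc_of_leftInverse (X' := fun s => -(s / 2)) (φ := fun q => 2 * q.2.1)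
        (by fun_prop) (by fun_prop) (by fun_prop) (fun s _ => (hasDerivAt_cusp s).1.neg.const_add _)
        (fun s _ => by rw [mul_neg]; exact (hasDerivAt_cusp s).2.neg) (by fun_prop)
        (fun s _ => by ring))
      (fun s hs => ⟨by rw [abs_neg]; exact abs_sq_half_lt.2 hs, ⟨rfl, rfl⟩, mem_univ _⟩) ?_
    rintro d y z hd ⟨rfl, rfl⟩ -
    have h2 : 2 * y / 2 = y := by ring
    rw [abs_neg] at hd
    exact ⟨2 * y, abs_sq_half_lt.1 (by rwa [h2]), by rw [h2], h2, by rw [h2]⟩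
  | cross a =>
    obtain ⟨ε, hε, hy⟩ : ∃ ε : ℝ, (ε = 1 ∨ ε = -1) ∧ p.2.1 = ε := ⟨_, h.1, rfl⟩
    have hεε : ε * ε = 1 := by rcases hε with rfl | rfl <;> norm_num
    -- The two branches project to the same point of the front but have opposite slopes `y`, so the
    -- sign of `y` isolates the branch through `p`.
    refine key (V := {q | 0 < ε * q.2.1}) (isOpen_lt (by fun_prop) (by fun_prop))
      (by simp [hy, hεε]) (X := fun s => s / 4) (Y := fun _ => ε) (Z := fun s => ε * (s / 4))
      (isLegendrianArc_of_leftInverse (X' := fun _ => 1 / 4) (φ := fun q => 4 * (q.1 - (i + 1)))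
        (by fun_prop) (by fun_prop) (by fun_prop)
        (fun s _ => ((hasDerivAt_id s).div_const 4).const_add _)
        (fun s _ => ((hasDerivAt_id s).div_const 4).const_mul ε) (by fun_prop)
        (fun s _ => by ring))
      (fun s hs => ⟨abs_quarter_lt.2 hs, ⟨hε, rfl⟩, by simp [hεε]⟩) ?_
    rintro d y z hd ⟨hy1, rfl⟩ hV
    have hV : 0 < ε * y := hV
    obtain rfl : ε = y := by
      rcases hε with rfl | rfl <;> rcases hy1 with rfl | rfl <;> first | rfl | norm_num at hV
    have h2 : 4 * d / 4 = d := by ring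
    exact ⟨4 * d, abs_quarter_lt.1 (by rwa [h2]), h2, rfl, by rw [h2]⟩

theorem isLegendrianLink_frontLift {w : Front} (hw : IsClosedWord w) :
    IsLegendrianLink (frontLift w) := by
  refine ⟨isCompact_frontLift w, fun p hp => ?_⟩
  change HasLegendrianChart (frontLift w) p
  obtain ⟨i, hi, j, hj, hx, h⟩ := id hp
  rcases hx.1.eq_or_lt with h1 | h1
  · obtain _ | i := i
    · rw [strandCount_zero] at hj
      omega
    · exact hasLegendrianChart_of_event hw hi hp (by rw [← h1]; push_cast; ring)
  rcases hx.2.eq_or_lt with h2 | h2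
  · refine hasLegendrianChart_of_event hw (hi.lt_of_ne ?_) hp h2
    rintro rfl
    rw [strandCount_length hw] at hj
    omega
  · exact hasLegendrianChart_of_mem_Ioo hi hj ⟨h1, h2⟩ h

theorem strandsMeet_frontStrand {w : Front} {i : ℕ} {e : Event Unit}
    (he : w[i]? = some e) : StrandsMeet e (strandCount w i) (strandCount w (i + 1))
      (fun j => frontStrand w i j (i + 1)) (fun j => frontStrand w (i + 1) j (i + 1)) := by
  have hl : ∀ j, frontStrand w i j (i + 1) =
      (-(strandSign e.pos e.elem.ins j * e.elem.slope 0), baseHeight e.pos e.elem.ins j) := by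
    intro j
    rw [frontStrand_left he j (by linarith), sub_self, sideHeight_zero, neg_one_mul]
  have hr : ∀ j, frontStrand w (i + 1) j (i + 1) =
      (strandSign e.pos e.elem.outs j * e.elem.slope 0, baseHeight e.pos e.elem.outs j) := by
    intro j
    rw [frontStrand_right he j (by linarith), sub_self, sideHeight_zero, one_mul]
  constructor
  · intro j l hjl _
    simp only [hl]
    exact baseHeight_eq_iff e.elem.ins_eq hjl
  · intro j l hjl _
    simp only [hr]
    exact baseHeight_eq_iff e.elem.outs_eq hjl
  · intro j hj
    simp [hl, hr, strandSign, baseHeight, hj]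
  · intro j hj _
    have h1 : ∀ k, ¬ j + k < e.pos := fun k => by omega
    simp [hl, hr, strandSign, baseHeight, h1, Nat.not_lt.2 hj]
    ring
  · obtain ⟨el, k⟩ := e
    cases el <;> simp [hl, hr, strandSign, baseHeight, Elem.slope, Elem.ins, Elem.outs]
    norm_num

theorem hasFront_frontLift {w : Front} (hw : IsClosedWord w) : HasFront (frontLift w) w := by
  refine ⟨hw, fun i => i, frontStrand w, Nat.strictMono_cast, ?_, ?_, ?_⟩
  · rintro p ⟨i, hi, j, hj, hx, -⟩
    have h1 : i ≠ 0 := by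
      rintro rfl
      rw [strandCount_zero] at hj
      omega
    have h2 : i ≠ w.length := by
      rintro rfl
      rw [strandCount_length hw] at hj
      omega
    have h3 : (1 : ℝ) ≤ i := by exact_mod_cast Nat.one_le_iff_ne_zero.2 h1
    have h4 : (i : ℝ) + 1 ≤ w.length := by exact_mod_cast (hi.lt_of_ne h2)
    push_cast
    exact ⟨by linarith [hx.1], by linarith [hx.2]⟩
  · intro i hi
    push_cast
    refine ⟨fun j _ => (continuous_frontStrand w i j).continuousOn, fun x hx => ⟨?_, ?_⟩⟩
    · ext q
      exact mem_frontLift_of_mem_Ioo (p := (x, q)) hi hx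
    · exact fun j l hjl _ => frontStrand_lt w i hjl hx
  · intro i e he
    push_cast
    refine ⟨?_, strandsMeet_frontStrand he⟩
    ext q
    have := mem_frontLift_near (p := ((i : ℝ) + 1, q)) (List.getElem?_eq_some_iff.1 he).1 (by simp)
    simpa using this

theorem mainTheorem2 (n : ℕ) :
    ∃ (K : Set (ℝ × ℝ × ℝ)) (w : Front),
      IsLegendrianLink K ∧ HasFront K w ∧
      IsTorusLink w 4 (-(2 * (n : ℤ) + 5)) ∧
      (∃ ρ : Finset ℕ, IsNormalRuling w ρ ∧
        (∀ ρ' : Finset ℕ, IsNormalRuling w ρ' → ρ' = ρ) ∧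
        claspCount w ρ = 2 * n + 5) ∧
      ¬ HasDecomposableFilling w := by
  -- With `N = 2 * n + 1` twists, both the braid exponent and the number of clasps are `N + 4 = 2 *
  -- n + 5`.
  have hw := isClosedWord_torusFront (2 * n + 1)
  have hρ := isNormalRuling_torusRuling (2 * n + 1)
  refine ⟨frontLift (torusFront (2 * n + 1)), torusFront (2 * n + 1), isLegendrianLink_frontLift hw,
    hasFront_frontLift hw, ?_,
    ⟨torusRuling (2 * n + 1), hρ, fun ρ' h => hρ.eq_of_torusFront hw h, ?_⟩,
    not_hasDecomposableFilling_torusFront n⟩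
  · convert isTorusLink_torusFront (2 * n + 1) using 2
    push_cast
    ring
  · rw [claspCount_torusRuling]
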